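/- An \emph{edge-colored partially oriented graph} (ecPOG) is a finite directed graph without loops together with a coloring $c$ of its arcs such that $c(v,w)=c(w,v)$ whenever both $(v,w)$ and $(w,v)$ are arcs, and such that no color occurs both on a directed and on an undirected edge; here an arc $(v,w)$ is \emph{undirected} if $(w,v)$ is also an arc (the two arcs then form one undirected edge $\{v,w\}$) and \emph{directed} otherwise. An ecPOG is \emph{complete} if for any two distinct vertices $v,w$ at least one of $(v,w)$, $(w,v)$ is an arc. It is \emph{color-regular} if, for each color $c$, all vertices have the same number of incoming directed edges of color $c$, the same number of outgoing directed edges of color $c$, and the same number of undirected edges of color $c$. Isomorphisms preserve arcs and their colors. The logic $C^2$ is the two-variable fragment of first-order logic with counting quantifiers $\exists^{\ge t}$ ($t\in\mathbb N$), with equality and, for each color $c$, a binary relation symbol for the arcs of color $c$. It \emph{identifies} $G$ if there is a $C^2$-sentence that holds in $G$ and such that every ecPOG satisfying it (with colors from the same color set) is isomorphic to $G$. \textbf{Theorem.} Let $G$ be a color-regular complete ecPOG. Then $C^2$ identifies $G$ if and only if $G$ is one of the following: \begin{enumerate} \item an undirected complete graph with only one edge color (with no edge at all if $G$ has at most one vertex);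 \item undirected with exactly two edge colors, one of which induces a perfect matching; \item a directed $3$-cycle (in one color); \item an undirected graph on four vertices with exactly three edge colors, each of which induces a perfect matching; \item a graph on four vertices with exactly two edge colors, one of which induces a $4$-cycle that is either undirected or directed, while the other induces an undirected perfect matching; \item the regular tournament on five vertices (in one color); \item a graph on five vertices with exactly two edge colors, both of which induce a $5$-cycle, at most one of the two being directed; \item an undirected graph on six vertices with exactly five edge colors, each of which induces a perfect matching; \item an undirected graph on six vertices with exactly three edge colors, one of which induces the complement of a $6$-cycle, while each of the other two induces a perfect matching. \end{enumerate} -/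

import Mathlib

/-- An edge-colored partially oriented graph with vertex set `V` and colors in `C`: a loopless
digraph with a coloring of its arcs, such that the two orientations of an undirected edge have the
same color and no color occurs both on a directed and on an undirected edge. -/
structure ECPOG (V : Type*) (C : Type*) extends Digraph V where
  /-- the coloring of the arcs -/
  color : ∀ v w : V, Adj v w → C
  loopless : ∀ v, ¬ Adj v v
  color_symm : ∀ v w (h : Adj v w) (h' : Adj w v), color v w h = color w v h'
  not_mixed : ∀ v w x y (h : Adj v w) (h' : Adj x y),
    color v w h = color x y h' → Adj w v → Adj y x

namespace ECPOG

variable {V W C : Type*}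

/-- `(v, w)` is an arc of color `c`. -/
def HasColor (G : ECPOG V C) (c : C) (v w : V) : Prop :=
  ∃ h : G.Adj v w, G.color v w h = c

/-- `G` is complete: any two distinct vertices are joined by an arc in at least one direction. -/
def IsComplete (G : ECPOG V C) : Prop :=
  ∀ v w, v ≠ w → G.Adj v w ∨ G.Adj w v

/-- The number of directed edges of color `c` that leave `v`. -/
noncomputable def outDegree (G : ECPOG V C) (c : C) (v : V) : ℕ :=
  {w | G.HasColor c v w ∧ ¬ G.Adj w v}.ncard

/-- The number of directed edges of color `c` that enter `v`. -/
noncomputable def inDegree (G : ECPOG V C) (c : C) (v : V) : ℕ :=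
  {w | G.HasColor c w v ∧ ¬ G.Adj v w}.ncard

/-- The number of undirected edges of color `c` at `v`. -/
noncomputable def undirectedDegree (G : ECPOG V C) (c : C) (v : V) : ℕ :=
  {w | G.HasColor c v w ∧ G.Adj w v}.ncard

/-- For each color, all vertices have the same indegree, the same outdegree and the same degree
for undirected edges. -/
def IsColorRegular (G : ECPOG V C) : Prop :=
  ∀ c v w, G.inDegree c v = G.inDegree c w ∧ G.outDegree c v = G.outDegree c w ∧
    G.undirectedDegree c v = G.undirectedDegree c w

/-- A bijection of the vertices that preserves arcs, non-arcs and colors. -/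
structure Iso (G : ECPOG V C) (H : ECPOG W C) extends V ≃ W where
  hasColor_iff : ∀ c v w, G.HasColor c v w ↔ H.HasColor c (toFun v) (toFun w)

end ECPOG

/-- Formulas of the `k`-variable counting logic on edge-colored partially oriented graphs with
colors in `C`; the vocabulary has one binary relation symbol for each color. -/
inductive CountingFormula (C : Type*) (k : ℕ) where
  /-- `x_i = x_j` -/
  | eq (i j : Fin k) : CountingFormula C k
  /-- `(x_i, x_j)` is an arc of color `c` -/
  | arc (c : C) (i j : Fin k) : CountingFormula C k
  /-- negation -/
  | neg (φ : CountingFormula C k) : CountingFormula C k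
  /-- conjunction -/
  | and (φ ψ : CountingFormula C k) : CountingFormula C k
  /-- there are at least `t` values of `x_i` for which `φ` holds -/
  | existsGE (t : ℕ) (i : Fin k) (φ : CountingFormula C k) : CountingFormula C k

namespace CountingFormula

variable {V C : Type*} {k : ℕ}

/-- The free variables of a formula. -/
def freeVars : CountingFormula C k → Finset (Fin k)
  | eq i j => {i, j}
  | arc _ i j => {i, j}
  | neg φ => φ.freeVars
  | and φ ψ => φ.freeVars ∪ ψ.freeVars
  | existsGE _ i φ => φ.freeVars.erase i

/-- A sentence is a formula without free variables. -/
def IsSentence (φ : CountingFormula C k) : Prop := φ.freeVars = ∅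

/-- Satisfaction under a partial assignment `a` of the variables. (Partial assignments are used so
that truth of sentences also makes sense in the graph without vertices; the values at variables
that are not free do not matter.) -/
def Sat (G : ECPOG V C) : CountingFormula C k → (Fin k → Option V) → Prop
  | eq i j, a => ∃ v, a i = some v ∧ a j = some v
  | arc c i j, a => ∃ v w, a i = some v ∧ a j = some w ∧ G.HasColor c v w
  | neg φ, a => ¬ φ.Sat G a
  | and φ ψ, a => φ.Sat G a ∧ ψ.Sat G a
  | existsGE t i φ, a =>
      ∃ s : Finset V, s.card = t ∧ ∀ v ∈ s, φ.Sat G (Function.update a i (some v))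

end CountingFormula

namespace ECPOG

/-- The sentence `φ` holds in `G`. -/
def Models {V C : Type*} {k : ℕ} (G : ECPOG V C) (φ : CountingFormula C k) : Prop :=
  φ.Sat G fun _ => none

/-- The `k`-variable counting logic identifies `G`: some sentence holds in `G` and, up to
isomorphism, in no other finite edge-colored partially oriented graph. -/
def IsIdentifiedByCounting.{u, v} {V : Type u} {C : Type v} (k : ℕ) (G : ECPOG V C) : Prop :=
  ∃ φ : CountingFormula C k, φ.IsSentence ∧ G.Models φ ∧
    ∀ (W : Type u) [Finite W] (H : ECPOG W C), H.Models φ → Nonempty (G.Iso H)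

variable {V C : Type*}

/-- All edges are undirected. -/
def IsUndirected (G : ECPOG V C) : Prop := ∀ v w, G.Adj v w → G.Adj w v

/-- The set of edge colors that occur in `G`. -/
def edgeColors (G : ECPOG V C) : Set C := {c | ∃ v w, G.HasColor c v w}

/-- The simple graph induced by the edges of color `c`, with directions forgotten. -/
def colorGraph (G : ECPOG V C) (c : C) : SimpleGraph V := SimpleGraph.fromRel (G.HasColor c)

/-- All edges of color `c` are undirected. -/
def IsUndirectedColor (G : ECPOG V C) (c : C) : Prop :=
  ∀ v w, G.HasColor c v w → G.HasColor c w v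

/-- The edges of color `c` are undirected and form a perfect matching. -/
def IsMatchingColor (G : ECPOG V C) (c : C) : Prop :=
  G.IsUndirectedColor c ∧ (⊤ : (G.colorGraph c).Subgraph).IsPerfectMatching

/-- The edges of color `c` are undirected and form a cycle through all vertices, `n` in number. -/
def IsUndirectedCycleColor (G : ECPOG V C) (n : ℕ) (c : C) : Prop :=
  G.IsUndirectedColor c ∧ Nonempty (G.colorGraph c ≃g SimpleGraph.cycleGraph n)

/-- The edges of color `c` form a directed cycle through all vertices, `n` in number (`n ≥ 3`). -/
def IsDirectedCycleColor (G : ECPOG V C) (n : ℕ) (c : C) : Prop :=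
  ∃ e : V ≃ ZMod n, ∀ v w, G.HasColor c v w ↔ e w = e v + 1

/-- Type 1: an undirected complete graph with only one edge color (no edge color occurs if there
is at most one vertex). -/
def IsMonochromatic (G : ECPOG V C) : Prop :=
  G.IsUndirected ∧ G.edgeColors.Subsingleton

/-- Type 2: undirected with two edge colors, one of which is a perfect matching. -/
def IsMatchingAndComplement (G : ECPOG V C) : Prop :=
  G.IsUndirected ∧ ∃ c₁ c₂, c₁ ≠ c₂ ∧ G.edgeColors = {c₁, c₂} ∧ G.IsMatchingColor c₁

/-- Type 3: a directed 3-cycle. -/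
def IsDirectedTriangle (G : ECPOG V C) : Prop :=
  ∃ c, G.edgeColors = {c} ∧ G.IsDirectedCycleColor 3 c

/-- Types 4 and 8: undirected on `n` vertices with `m` edge colors, each a perfect matching. -/
def IsMatchingDecomposition (G : ECPOG V C) (n m : ℕ) : Prop :=
  Nat.card V = n ∧ G.IsUndirected ∧ G.edgeColors.ncard = m ∧
    ∀ c ∈ G.edgeColors, G.IsMatchingColor c

/-- Type 5: four vertices and two edge colors, a possibly directed 4-cycle and an undirected
perfect matching. -/
def IsFourCycleAndMatching (G : ECPOG V C) : Prop :=
  Nat.card V = 4 ∧ ∃ c₁ c₂, c₁ ≠ c₂ ∧ G.edgeColors = {c₁, c₂} ∧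
    (G.IsUndirectedCycleColor 4 c₁ ∨ G.IsDirectedCycleColor 4 c₁) ∧ G.IsMatchingColor c₂

/-- Type 6: a regular tournament on five vertices, with one edge color. -/
def IsFiveTournament (G : ECPOG V C) : Prop :=
  Nat.card V = 5 ∧ (∃ c, G.edgeColors = {c}) ∧
    (∀ v w, v ≠ w → (G.Adj v w ↔ ¬ G.Adj w v)) ∧
    ∃ d, ∀ v, {w | G.Adj v w}.ncard = d ∧ {w | G.Adj w v}.ncard = d

/-- Type 7: five vertices and two edge colors which are both 5-cycles, at most one of them
directed. -/
def IsTwoFiveCycles (G : ECPOG V C) : Prop :=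
  Nat.card V = 5 ∧ ∃ c₁ c₂, c₁ ≠ c₂ ∧ G.edgeColors = {c₁, c₂} ∧
    G.IsUndirectedCycleColor 5 c₁ ∧
    (G.IsUndirectedCycleColor 5 c₂ ∨ G.IsDirectedCycleColor 5 c₂)

/-- Type 9: undirected on six vertices with three edge colors, one of which is the complement of a
6-cycle and the other two are perfect matchings. -/
def IsCoSixCycleAndTwoMatchings (G : ECPOG V C) : Prop :=
  Nat.card V = 6 ∧ G.IsUndirected ∧ ∃ c₁ c₂ c₃, c₁ ≠ c₂ ∧ c₁ ≠ c₃ ∧ c₂ ≠ c₃ ∧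
    G.edgeColors = {c₁, c₂, c₃} ∧
    Nonempty (G.colorGraph c₁ ≃g (SimpleGraph.cycleGraph 6)ᶜ) ∧
    G.IsMatchingColor c₂ ∧ G.IsMatchingColor c₃

end ECPOG

/-! From logic to degrees. In a complete graph the atomic type of a pair of distinct vertices is one
color together with its direction. If two complete graphs have the same order and the same degrees
in every color, then in the bijective two-pebble game the vertices of the two graphs can always be
matched according to their type towards the pebble that stays in place. So C² cannot separate such
graphs (`PartialIso.sat_iff`). Conversely, a C²-sentence expresses the order, the degrees, and
completeness within the finitely many colors of `G`. Hence `G` is identified iff every graph with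
its parameters is isomorphic to it (`isIdentifiedByCounting_two_iff`).

Removing directions. In a color-regular graph a directed color has equal in- and outdegree, hence
even total degree, and Hall's theorem gives every regular graph of even degree a balanced
orientation. So every edge coloring of a complete graph with the right total degrees underlies a
graph with the parameters of `G`, and if `G` is unique, any two such colorings are isomorphic
(`IsParamUnique.exists_equiv`).

Non-uniqueness. Colorings arise by merging the classes of a factorization, where a chosen set `T` of
colors can be given any classes of the right number. On `2m + 1` vertices let `T` have degree `2K`
with `2 ≤ K ≤ m / 2`. In the circulant factorization, the `K` shortest distances put each of their
edges into a triangle, while the `K` longest leave some edge in none. On `2m` vertices let `T` have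
degree between `3` and `m - 1`. One one-factorization gives `T` a triangle, another makes `T`
bipartite. Passing to the complement of `T` where necessary, this leaves degree sequences with one
dominant color, and small orders. For these there are special pairs: one cycle against two, cycles
of two matchings of different lengths, tables on six and seven vertices, and rotational orientations
against the result of reversing a directed 3-cycle.

Uniqueness. All colors but one undirected color determine the graph (`ParamEq.nonempty_iso`). It
remains to put a matching, a permutation without cycles of length at most two on at most five
points, two disjoint matchings on four or six vertices, four disjoint matchings on six vertices, or
the tournament on five vertices into a standard position. -/

namespace ECPOG

/-! ### Pair types and graphs with equal parameters -/

section Basic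

variable {V W C : Type*} {G : ECPOG V C} {c c' : C} {v w x y : V}

lemma HasColor.ne (h : G.HasColor c v w) : v ≠ w := by
  rintro rfl
  exact G.loopless _ h.1

lemma not_hasColor_self (G : ECPOG V C) (c : C) (v : V) : ¬ G.HasColor c v v :=
  fun h => h.ne rfl

lemma HasColor.unique (h : G.HasColor c v w) (h' : G.HasColor c' v w) : c = c' := by
  obtain ⟨_, rfl⟩ := h
  obtain ⟨_, rfl⟩ := h'
  rfl

lemma HasColor.symm_of_adj (h : G.HasColor c v w) (h' : G.Adj w v) : G.HasColor c w v :=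
  ⟨h', by rw [← h.2]; exact G.color_symm _ _ _ _⟩

lemma HasColor.unique_swap (h : G.HasColor c v w) (h' : G.HasColor c' w v) : c = c' :=
  (h.symm_of_adj h'.1).unique h'

lemma HasColor.adj_swap (h : G.HasColor c v w) (h' : G.HasColor c x y) (hs : G.Adj w v) :
    G.Adj y x :=
  G.not_mixed v w x y h.1 h'.1 (h.2.trans h'.2.symm) hs

lemma exists_hasColor (h : G.Adj v w) : ∃ c, G.HasColor c v w := ⟨_, h, rfl⟩

lemma hasColor_and_adj_iff : G.HasColor c v w ∧ G.Adj w v ↔ G.HasColor c v w ∧ G.HasColor c w v :=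
  ⟨fun h => ⟨h.1, h.1.symm_of_adj h.2⟩, fun h => ⟨h.1, h.2.1⟩⟩

lemma hasColor_and_not_adj_iff :
    G.HasColor c v w ∧ ¬ G.Adj w v ↔ G.HasColor c v w ∧ ¬ G.HasColor c w v :=
  ⟨fun h => ⟨h.1, fun h' => h.2 h'.1⟩, fun h => ⟨h.1, fun h' => h.2 (h.1.symm_of_adj h')⟩⟩

/-- Two complete graphs have the same parameters if they have equally many vertices and all their
vertices have the same degrees in each color. -/
structure ParamEq (G : ECPOG V C) (H : ECPOG W C) : Prop where
  card : Nat.card V = Nat.card W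
  left : G.IsComplete
  right : H.IsComplete
  deg : ∀ c v w, G.inDegree c v = H.inDegree c w ∧ G.outDegree c v = H.outDegree c w ∧
    G.undirectedDegree c v = H.undirectedDegree c w

lemma ParamEq.symm {G : ECPOG V C} {H : ECPOG W C} (h : ParamEq G H) : ParamEq H G :=
  ⟨h.card.symm, h.right, h.left, fun c v w =>
    ⟨(h.deg c w v).1.symm, (h.deg c w v).2.1.symm, (h.deg c w v).2.2.symm⟩⟩

/-- The atomic type of an ordered pair of vertices. -/
def pairType (G : ECPOG V C) (x v : V) : Prop × Set C × Set C :=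
  (x = v, {c | G.HasColor c x v}, {c | G.HasColor c v x})

lemma pairType_eq_iff {G : ECPOG V C} {H : ECPOG W C} {x v : V} {y w : W} :
    G.pairType x v = H.pairType y w ↔ (x = v ↔ y = w) ∧
      (∀ c, G.HasColor c x v ↔ H.HasColor c y w) ∧ ∀ c, G.HasColor c v x ↔ H.HasColor c w y := by
  simp [pairType, Set.ext_iff]

/-- An arc has only one color, so one color and the presence of the reverse arc already fix the
whole type. This and the next two lemmas turn the number of vertices of a given type into one of the
three degrees. -/
lemma pairType_fiber_und {G : ECPOG V C} {x v : V} (hc : G.HasColor c x v) (hvx : G.Adj v x)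
    (K : ECPOG W C) (z : W) :
    {w | K.pairType z w = G.pairType x v} = {w | K.HasColor c z w ∧ K.Adj w z} := by
  have hne := hc.ne
  ext w
  simp only [Set.mem_ofPred_eq, pairType_eq_iff]
  constructor
  · rintro ⟨-, h1, h2⟩
    exact ⟨(h1 c).2 hc, ((h2 c).2 (hc.symm_of_adj hvx)).1⟩
  · rintro ⟨h1, h2⟩
    have h3 := h1.symm_of_adj h2
    have h4 := hc.symm_of_adj hvx
    exact ⟨iff_of_false h1.ne hne, fun d => ⟨fun hd => h1.unique hd ▸ hc,
      fun hd => hc.unique hd ▸ h1⟩, fun d => ⟨fun hd => h3.unique hd ▸ h4,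
      fun hd => h4.unique hd ▸ h3⟩⟩

lemma pairType_fiber_out {G : ECPOG V C} {x v : V} (hc : G.HasColor c x v) (hvx : ¬ G.Adj v x)
    (K : ECPOG W C) (z : W) :
    {w | K.pairType z w = G.pairType x v} = {w | K.HasColor c z w ∧ ¬ K.Adj w z} := by
  have hne := hc.ne
  ext w
  simp only [Set.mem_ofPred_eq, pairType_eq_iff]
  constructor
  · rintro ⟨-, h1, h2⟩
    refine ⟨(h1 c).2 hc, fun h3 => hvx ?_⟩
    exact ((h2 c).1 (((h1 c).2 hc).symm_of_adj h3)).1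
  · rintro ⟨h1, h2⟩
    exact ⟨iff_of_false h1.ne hne, fun d => ⟨fun hd => h1.unique hd ▸ hc,
      fun hd => hc.unique hd ▸ h1⟩, fun d => ⟨fun hd => (h2 hd.1).elim,
      fun hd => (hvx hd.1).elim⟩⟩

lemma pairType_fiber_in {G : ECPOG V C} {x v : V} (hc : G.HasColor c v x) (hxv : ¬ G.Adj x v)
    (K : ECPOG W C) (z : W) :
    {w | K.pairType z w = G.pairType x v} = {w | K.HasColor c w z ∧ ¬ K.Adj z w} := by
  have hne := hc.ne.symm
  ext w
  simp only [Set.mem_ofPred_eq, pairType_eq_iff]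
  constructor
  · rintro ⟨-, h1, h2⟩
    refine ⟨(h2 c).2 hc, fun h3 => hxv ?_⟩
    exact ((h1 c).1 (((h2 c).2 hc).symm_of_adj h3)).1
  · rintro ⟨h1, h2⟩
    exact ⟨iff_of_false h1.ne.symm hne, fun d => ⟨fun hd => (h2 hd.1).elim,
      fun hd => (hxv hd.1).elim⟩, fun d => ⟨fun hd => h1.unique hd ▸ hc,
      fun hd => hc.unique hd ▸ h1⟩⟩

lemma pairType_fiber_eq_of_exists [Finite V] [Finite W] {G : ECPOG V C} {H : ECPOG W C}
    (h : ParamEq G H) (x v : V) (y : W) :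
    {v' | G.pairType x v' = G.pairType x v}.ncard =
      {w | H.pairType y w = G.pairType x v}.ncard := by
  rcases eq_or_ne x v with rfl | hne
  · have h1 : {v' | G.pairType x v' = G.pairType x x} = {x} := by
      ext v'
      simp only [Set.mem_ofPred_eq, pairType_eq_iff, Set.mem_singleton_iff]
      refine ⟨fun h => (h.1.2 trivial).symm, ?_⟩
      rintro rfl
      simp
    have h2 : {w | H.pairType y w = G.pairType x x} = {y} := by
      ext v'
      simp only [Set.mem_ofPred_eq, pairType_eq_iff, Set.mem_singleton_iff]
      refine ⟨fun h => (h.1.2 trivial).symm, ?_⟩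
      rintro rfl
      simp [not_hasColor_self]
    rw [h1, h2, Set.ncard_singleton, Set.ncard_singleton]
  by_cases hxv : G.Adj x v
  · obtain ⟨c, hc⟩ := exists_hasColor hxv
    by_cases hvx : G.Adj v x
    · rw [pairType_fiber_und hc hvx G, pairType_fiber_und hc hvx H]
      exact (h.deg c x y).2.2
    · rw [pairType_fiber_out hc hvx G, pairType_fiber_out hc hvx H]
      exact (h.deg c x y).2.1
  · have hvx : G.Adj v x := (h.left x v hne).resolve_left hxv
    obtain ⟨c, hc⟩ := exists_hasColor hvx
    rw [pairType_fiber_in hc hxv G, pairType_fiber_in hc hxv H]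
    exact (h.deg c x y).1

/-- Every type realized at `x` or at `y` is equality or is counted by a degree, so all fibers of the
two type maps have equal size and bijections between the fibers can be glued. -/
lemma ParamEq.exists_equiv_pairType [Finite V] [Finite W] {G : ECPOG V C} {H : ECPOG W C}
    (h : ParamEq G H) (x : V) (y : W) :
    ∃ σ : V ≃ W, ∀ v, H.pairType y (σ v) = G.pairType x v := by
  have key : ∀ τ, {v | G.pairType x v = τ}.ncard = {w | H.pairType y w = τ}.ncard := by
    intro τ
    by_cases h1 : ∃ v, G.pairType x v = τ
    · obtain ⟨v, rfl⟩ := h1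
      exact pairType_fiber_eq_of_exists h x v y
    by_cases h2 : ∃ w, H.pairType y w = τ
    · obtain ⟨w, rfl⟩ := h2
      exact (pairType_fiber_eq_of_exists h.symm y w x).symm
    · push Not at h1 h2
      simp [h1, h2]
  have e : ∀ τ, Nonempty ({v // G.pairType x v = τ} ≃ {w // H.pairType y w = τ}) :=
    fun τ => Finite.card_eq.1 (key τ)
  exact ⟨Equiv.ofFiberEquiv fun τ => (e τ).some, fun v => Equiv.ofFiberEquiv_map _ v⟩

end Basic

end ECPOG

namespace CountingFormula

open ECPOG

/-! ### Equal parameters imply C²-equivalence -/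

section Equivalence

variable {V W C : Type*} {G : ECPOG V C} {H : ECPOG W C} {k : ℕ}

/-- The assignments `a` and `b` define a partial isomorphism. -/
def PartialIso (G : ECPOG V C) (H : ECPOG W C) (a : Fin k → Option V) (b : Fin k → Option W) :
    Prop :=
  (∀ i, a i = none ↔ b i = none) ∧ ∀ i j v w v' w', a i = some v → a j = some w →
    b i = some v' → b j = some w' → (v = w ↔ v' = w') ∧ ∀ c, G.HasColor c v w ↔ H.HasColor c v' w'

/-- This is one round of the bijective game: variable `i` is reassigned, so only the value of the
other variable constrains the answer. -/
lemma PartialIso.exists_equiv [Finite V] [Finite W] (h : ParamEq G H) {a : Fin 2 → Option V}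
    {b : Fin 2 → Option W} (hab : PartialIso G H a b) (i : Fin 2) :
    ∃ σ : V ≃ W, ∀ v, PartialIso G H (Function.update a i (some v))
      (Function.update b i (some (σ v))) := by
  obtain ⟨j, hji, hj⟩ : ∃ j : Fin 2, j ≠ i ∧ ∀ l, l = i ∨ l = j := by
    revert i; decide
  rcases ha : a j with _ | x
  -- With the other variable unassigned there is no constraint, and equality of the orders suffices.
  · have hb : b j = none := (hab.1 j).1 ha
    refine ⟨(Finite.card_eq.1 h.card).some, fun v => ⟨fun l => ?_, fun l m => ?_⟩⟩
    · rcases hj l with rfl | rfl <;> simp [hji, ha, hb]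
    · rcases hj l with rfl | rfl <;> rcases hj m with rfl | rfl <;>
        simp +contextual [hji, ha, hb, not_hasColor_self]
  · obtain ⟨y, hb⟩ : ∃ y, b j = some y :=
      Option.ne_none_iff_exists'.1 fun hb => by simp [(hab.1 j).2 hb] at ha
    obtain ⟨σ, hσ⟩ := h.exists_equiv_pairType x y
    refine ⟨σ, fun v => ⟨fun l => ?_, fun l m => ?_⟩⟩
    · rcases hj l with rfl | rfl <;> simp [hji, ha, hb]
    · obtain ⟨h1, h2, h3⟩ := pairType_eq_iff.1 (hσ v)
      rcases hj l with rfl | rfl <;> rcases hj m with rfl | rfl <;>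
        simp only [Function.update_self, ne_eq, hji, not_false_eq_true, Function.update_of_ne, ha,
          hb, Option.some.injEq] <;> rintro _ _ _ _ rfl rfl rfl rfl
      · simp [not_hasColor_self]
      · exact ⟨by rw [eq_comm, ← h1, eq_comm], fun c => (h3 c).symm⟩
      · exact ⟨h1.symm, fun c => (h2 c).symm⟩
      · simp [not_hasColor_self]

/-- The quantifier case works because the answer is a bijection chosen before the witnesses: it
carries a set of `t` witnesses to a set of `t` witnesses. -/
lemma PartialIso.sat_iff [Finite V] [Finite W] (h : ParamEq G H) (φ : CountingFormula C 2) :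
    ∀ {a : Fin 2 → Option V} {b : Fin 2 → Option W}, PartialIso G H a b →
      (φ.Sat G a ↔ φ.Sat H b) := by
  classical
  induction φ with
  | eq i j =>
    intro a b hab
    constructor
    · rintro ⟨v, hi, hj⟩
      obtain ⟨v', hi'⟩ := Option.ne_none_iff_exists'.1 fun hb => by simp [(hab.1 i).2 hb] at hi
      obtain ⟨w', hj'⟩ := Option.ne_none_iff_exists'.1 fun hb => by simp [(hab.1 j).2 hb] at hj
      have := (hab.2 i j v v v' w' hi hj hi' hj').1.1 rfl
      exact ⟨v', hi', this ▸ hj'⟩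
    · rintro ⟨v, hi, hj⟩
      obtain ⟨v', hi'⟩ := Option.ne_none_iff_exists'.1 fun hb => by simp [(hab.1 i).1 hb] at hi
      obtain ⟨w', hj'⟩ := Option.ne_none_iff_exists'.1 fun hb => by simp [(hab.1 j).1 hb] at hj
      have := (hab.2 i j v' w' v v hi' hj' hi hj).1.2 rfl
      exact ⟨v', hi', this ▸ hj'⟩
  | arc c i j =>
    intro a b hab
    constructor
    · rintro ⟨v, w, hi, hj, hc⟩
      obtain ⟨v', hi'⟩ := Option.ne_none_iff_exists'.1 fun hb => by simp [(hab.1 i).2 hb] at hi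
      obtain ⟨w', hj'⟩ := Option.ne_none_iff_exists'.1 fun hb => by simp [(hab.1 j).2 hb] at hj
      exact ⟨v', w', hi', hj', ((hab.2 i j v w v' w' hi hj hi' hj').2 c).1 hc⟩
    · rintro ⟨v, w, hi, hj, hc⟩
      obtain ⟨v', hi'⟩ := Option.ne_none_iff_exists'.1 fun hb => by simp [(hab.1 i).1 hb] at hi
      obtain ⟨w', hj'⟩ := Option.ne_none_iff_exists'.1 fun hb => by simp [(hab.1 j).1 hb] at hj
      exact ⟨v', w', hi', hj', ((hab.2 i j v' w' v w hi' hj' hi hj).2 c).2 hc⟩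
  | neg φ ih => exact fun hab => not_congr (ih hab)
  | and φ ψ ih₁ ih₂ => exact fun hab => and_congr (ih₁ hab) (ih₂ hab)
  | existsGE t i φ ih =>
    intro a b hab
    obtain ⟨σ, hσ⟩ := hab.exists_equiv h i
    constructor
    · rintro ⟨s, hs, hsφ⟩
      refine ⟨s.map σ.toEmbedding, by simpa using hs, fun w hw => ?_⟩
      obtain ⟨v, hv, rfl⟩ := Finset.mem_map.1 hw
      exact (ih (hσ v)).1 (hsφ v hv)
    · rintro ⟨s, hs, hsφ⟩
      refine ⟨s.map σ.symm.toEmbedding, by simpa using hs, fun w hw => ?_⟩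
      obtain ⟨v, hv, rfl⟩ := Finset.mem_map.1 hw
      refine (ih (hσ _)).2 ?_
      simpa using hsφ v hv

end Equivalence

/-! ### A sentence for the order and the degrees -/

section Formulas

variable {V C : Type*} {k : ℕ} {G : ECPOG V C}

/-- A formula that is always true. -/
def verum [NeZero k] : CountingFormula C k := existsGE 0 0 (eq 0 0)

/-- The conjunction of a list of formulas. -/
def conj [NeZero k] (l : List (CountingFormula C k)) : CountingFormula C k := l.foldr and verum

/-- The disjunction of a list of formulas. -/
def disj [NeZero k] (l : List (CountingFormula C k)) : CountingFormula C k := neg (conj (l.map neg))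

/-- Universal quantification. -/
def all (i : Fin k) (φ : CountingFormula C k) : CountingFormula C k := neg (existsGE 1 i (neg φ))

/-- There are exactly `t` values of `x_i` for which `φ` holds. -/
def exactly (t : ℕ) (i : Fin k) (φ : CountingFormula C k) : CountingFormula C k :=
  and (existsGE t i φ) (neg (existsGE (t + 1) i φ))

@[simp] lemma sat_verum [NeZero k] {a : Fin k → Option V} : verum.Sat G a :=
  ⟨∅, by simp⟩

@[simp] lemma sat_conj [NeZero k] {l : List (CountingFormula C k)} {a : Fin k → Option V} :
    (conj l).Sat G a ↔ ∀ φ ∈ l, φ.Sat G a := by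
  induction l with
  | nil => simp [conj]
  | cons φ l ih => simpa [conj, Sat] using fun _ => ih

@[simp] lemma sat_disj [NeZero k] {l : List (CountingFormula C k)} {a : Fin k → Option V} :
    (disj l).Sat G a ↔ ∃ φ ∈ l, φ.Sat G a := by
  simp [disj, Sat]

@[simp] lemma sat_all {i : Fin k} {φ : CountingFormula C k} {a : Fin k → Option V} :
    (all i φ).Sat G a ↔ ∀ v, φ.Sat G (Function.update a i (some v)) := by
  simp only [all, Sat, not_exists, not_and]
  constructor
  · intro h v
    by_contra hv
    exact h {v} (by simp) (by simpa using hv)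
  · intro h s hs h'
    obtain ⟨v, hv⟩ := Finset.card_pos.1 (by omega : 0 < s.card)
    exact h' v hv (h v)

lemma sat_existsGE [Finite V] {t : ℕ} {i : Fin k} {φ : CountingFormula C k}
    {a : Fin k → Option V} :
    (existsGE t i φ).Sat G a ↔ t ≤ {v | φ.Sat G (Function.update a i (some v))}.ncard := by
  classical
  have := Fintype.ofFinite V
  simp only [Sat]
  rw [Set.ncard_eq_toFinset_card']
  constructor
  · rintro ⟨s, rfl, hs⟩
    exact Finset.card_le_card fun v hv => by simpa using hs v hv
  · intro h
    obtain ⟨s, hs, rfl⟩ := Finset.exists_subset_card_eq h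
    exact ⟨s, rfl, fun v hv => by simpa using hs hv⟩

@[simp] lemma sat_exactly [Finite V] {t : ℕ} {i : Fin k} {φ : CountingFormula C k}
    {a : Fin k → Option V} :
    (exactly t i φ).Sat G a ↔ {v | φ.Sat G (Function.update a i (some v))}.ncard = t := by
  rw [exactly, Sat, Sat, sat_existsGE, sat_existsGE]
  omega

lemma isSentence_conj [NeZero k] {l : List (CountingFormula C k)} (h : ∀ φ ∈ l, φ.IsSentence) :
    (conj l).IsSentence := by
  induction l with
  | nil => simp [conj, verum, IsSentence, freeVars]
  | cons φ l ih =>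
    simp only [List.mem_cons, forall_eq_or_imp] at h
    have h1 := h.1
    have h2 := ih h.2
    simp only [IsSentence, conj] at h1 h2 ⊢
    simp [freeVars, h1, h2]

lemma isSentence_all_all (φ : CountingFormula C 2) : (all 0 (all 1 φ)).IsSentence := by
  ext i
  fin_cases i <;> simp [all, freeVars]

lemma isSentence_all_exactly (t : ℕ) (φ : CountingFormula C 2) :
    (all 0 (exactly t 1 φ)).IsSentence := by
  ext i
  fin_cases i <;> simp [all, exactly, freeVars]

/-- The sentence that describes the order and the degrees of a graph. -/
noncomputable def paramSentence (n : ℕ) (l : List C) (din dout dund : C → ℕ) :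
    CountingFormula C 2 :=
  and (exactly n 0 (eq 0 0)) (and
    (all 0 (all 1 (disj (eq 0 1 :: (l.map (arc · 0 1) ++ l.map (arc · 1 0))))))
    (conj (l.map fun c => and (all 0 (exactly (din c) 1 (and (arc c 1 0) (neg (arc c 0 1)))))
      (and (all 0 (exactly (dout c) 1 (and (arc c 0 1) (neg (arc c 1 0)))))
        (all 0 (exactly (dund c) 1 (and (arc c 0 1) (arc c 1 0))))))))

lemma isSentence_paramSentence (n : ℕ) (l : List C) (din dout dund : C → ℕ) :
    (paramSentence n l din dout dund).IsSentence := by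
  have h1 : (exactly n 0 (eq 0 0) : CountingFormula C 2).IsSentence := by
    ext i
    fin_cases i <;> simp [exactly, freeVars]
  have h2 := isSentence_all_all (C := C)
    (disj (eq 0 1 :: (l.map (arc · 0 1) ++ l.map (arc · 1 0))))
  have h3 : (conj (l.map fun c => and
      (all 0 (exactly (din c) 1 (and (arc c 1 0) (neg (arc c 0 1)))))
      (and (all 0 (exactly (dout c) 1 (and (arc c 0 1) (neg (arc c 1 0)))))
        (all 0 (exactly (dund c) 1 (and (arc c 0 1) (arc c 1 0)))))) :
        CountingFormula C 2).IsSentence := by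
    refine isSentence_conj fun φ hφ => ?_
    obtain ⟨c, -, rfl⟩ := List.mem_map.1 hφ
    have h4 := isSentence_all_exactly (din c) (and (arc c 1 0) (neg (arc c 0 1)))
    have h5 := isSentence_all_exactly (dout c) (and (arc c 0 1) (neg (arc c 1 0)))
    have h6 := isSentence_all_exactly (dund c) (and (arc c 0 1) (arc c 1 0))
    rw [IsSentence] at h4 h5 h6 ⊢
    rw [freeVars, freeVars, h4, h5, h6]
    rfl
  rw [IsSentence] at h1 h2 h3
  rw [paramSentence, IsSentence, freeVars, freeVars, h1, h2, h3]
  rfl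

lemma models_paramSentence_iff [Finite V] {n : ℕ} {l : List C} {din dout dund : C → ℕ} :
    G.Models (paramSentence n l din dout dund) ↔ Nat.card V = n ∧
      (∀ v w, v ≠ w → ∃ c ∈ l, G.HasColor c v w ∨ G.HasColor c w v) ∧
      ∀ c ∈ l, ∀ v, G.inDegree c v = din c ∧ G.outDegree c v = dout c ∧
        G.undirectedDegree c v = dund c := by
  simp only [Models, paramSentence, Sat, sat_exactly, sat_all, sat_conj, sat_disj, List.mem_map,
    List.mem_cons, List.mem_append]
  refine and_congr ?_ (and_congr ?_ ?_)
  · simp [Set.ncard_univ]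
  · refine forall₂_congr fun v w => ?_
    constructor
    · rintro ⟨φ, (rfl | ⟨c, hc, rfl⟩ | ⟨c, hc, rfl⟩), h⟩ hne
      · simp [Sat, hne.symm] at h
      · simp [Sat] at h
        exact ⟨c, hc, Or.inl h⟩
      · simp [Sat] at h
        exact ⟨c, hc, Or.inr h⟩
    · intro h
      by_cases hne : v = w
      · subst hne
        exact ⟨_, Or.inl rfl, by simp [Sat]⟩
      · obtain ⟨c, hc, h | h⟩ := h hne
        · exact ⟨_, Or.inr (Or.inl ⟨c, hc, rfl⟩), by simpa [Sat] using h⟩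
        · exact ⟨_, Or.inr (Or.inr ⟨c, hc, rfl⟩), by simpa [Sat] using h⟩
  · simp only [forall_exists_index, and_imp, forall_apply_eq_imp_iff₂]
    refine forall₂_congr fun c hc => ?_
    simp only [Sat, sat_all, sat_exactly, inDegree, outDegree, undirectedDegree,
      hasColor_and_not_adj_iff, hasColor_and_adj_iff]
    simp only [← forall_and]
    refine forall_congr' fun v => ?_
    simp

end Formulas

end CountingFormula

/-! ### Identification as uniqueness for the parameters -/

namespace ECPOG

open CountingFormula

universe u v

/-- Every graph with the same parameters as `G` is isomorphic to `G`. -/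
def IsParamUnique {V : Type u} {C : Type v} (G : ECPOG V C) : Prop :=
  ∀ (W : Type u) [Finite W] (H : ECPOG W C), ParamEq G H → Nonempty (G.Iso H)

lemma finite_edgeColors {V C : Type*} [Finite V] (G : ECPOG V C) : G.edgeColors.Finite := by
  have : G.edgeColors ⊆ ⋃ p : V × V, {c | G.HasColor c p.1 p.2} := by
    rintro c ⟨v, w, h⟩
    exact Set.mem_iUnion.2 ⟨(v, w), h⟩
  refine (Set.finite_iUnion fun p => Set.Subsingleton.finite ?_).subset this
  exact fun c hc c' hc' => HasColor.unique hc hc'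

theorem isIdentifiedByCounting_two_iff {V : Type u} {C : Type v} [Finite V] {G : ECPOG V C}
    (hG : G.IsComplete) (hreg : G.IsColorRegular) :
    G.IsIdentifiedByCounting 2 ↔ G.IsParamUnique := by
  constructor
  · rintro ⟨φ, -, hφ, h⟩ W _ H hGH
    -- Sentences are evaluated at the empty assignment, which is trivially a partial isomorphism.
    refine h W H ((PartialIso.sat_iff hGH φ ?_).1 hφ)
    simp [PartialIso]
  · intro h
    let l := G.finite_edgeColors.toFinset.toList
    have hl : ∀ c, c ∈ l ↔ c ∈ G.edgeColors := by simp [l]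
    obtain ⟨din, dout, dund, hd⟩ : ∃ din dout dund : C → ℕ, ∀ c v, G.inDegree c v = din c ∧
        G.outDegree c v = dout c ∧ G.undirectedDegree c v = dund c := by
      rcases isEmpty_or_nonempty V with hV | ⟨⟨v⟩⟩
      · exact ⟨0, 0, 0, fun _ => hV.elim⟩
      · exact ⟨fun c => G.inDegree c v, fun c => G.outDegree c v,
          fun c => G.undirectedDegree c v, fun c w => hreg c w v⟩
    have hGm : G.Models (paramSentence (Nat.card V) l din dout dund) := by
      refine models_paramSentence_iff.2 ⟨rfl, fun v w hne => ?_, fun c _ v => hd c v⟩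
      rcases hG v w hne with h | h
      · obtain ⟨c, hc⟩ := exists_hasColor h
        exact ⟨c, (hl c).2 ⟨v, w, hc⟩, Or.inl hc⟩
      · obtain ⟨c, hc⟩ := exists_hasColor h
        exact ⟨c, (hl c).2 ⟨w, v, hc⟩, Or.inr hc⟩
    refine ⟨_, isSentence_paramSentence _ _ _ _ _, hGm, fun W _ H hH => h W H ?_⟩
    obtain ⟨h1, h2, h3⟩ := models_paramSentence_iff.1 hH
    refine ⟨h1.symm, hG, fun v w hne => ?_, fun c v w => ?_⟩
    · obtain ⟨c, -, hc | hc⟩ := h2 v w hne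
      · exact Or.inl hc.1
      · exact Or.inr hc.1
    · obtain ⟨h4, h5, h6⟩ := hd c v
      rw [h4, h5, h6]
      by_cases hc : c ∈ l
      · obtain ⟨h4, h5, h6⟩ := h3 c hc w
        rw [h4, h5, h6]
        simp
      -- The sentence mentions only the colors of `G`. Other colors cannot occur in `H` either,
      -- since each pair of its vertices is already joined in a listed color.
      · have hGc : ∀ x y, ¬ G.HasColor c x y := fun x y hxy => hc ((hl c).2 ⟨x, y, hxy⟩)
        have hHc : ∀ x y, ¬ H.HasColor c x y := fun x y hxy => by
          obtain ⟨c', hc', h' | h'⟩ := h2 x y hxy.ne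
          · exact hc (hxy.unique h' ▸ hc')
          · exact hc (hxy.unique_swap h' ▸ hc')
        rw [← h4, ← h5, ← h6]
        simp [inDegree, outDegree, undirectedDegree, hGc, hHc]

end ECPOG

/-! ### Balanced orientations -/

section Orientation

variable {V : Type*}

lemma sum_ncard_eq_sum_ncard_swap [Fintype V] (R : V → V → Prop) :
    ∑ v, {w | R v w}.ncard = ∑ v, {w | R w v}.ncard := by
  classical
  have := Finset.sum_card_bipartiteAbove_eq_sum_card_bipartiteBelow (s := Finset.univ)
    (t := Finset.univ) R
  simpa [Set.ncard_eq_toFinset_card', Finset.bipartiteAbove, Finset.bipartiteBelow] using this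

/-- A regular graph of even degree has an orientation in which all in- and outdegrees are equal. -/
theorem SimpleGraph.exists_balanced_orientation [Finite V] (X : SimpleGraph V) (k : ℕ)
    (hX : ∀ v, {w | X.Adj v w}.ncard = 2 * k) :
    ∃ R : V → V → Prop, (∀ v w, R v w → X.Adj v w) ∧
      (∀ v w, X.Adj v w → (R v w ↔ ¬ R w v)) ∧
      ∀ v, {w | R v w}.ncard = k ∧ {w | R w v}.ncard = k := by
  classical
  have := Fintype.ofFinite V
  have hdeg : ∀ v, X.degree v = 2 * k := fun v => by
    rw [← hX v, Set.ncard_eq_toFinset_card', ← SimpleGraph.card_neighborFinset_eq_degree]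
    congr 1
  -- Every vertex offers `k` slots, and each edge must choose a slot at one of its ends, which
  -- becomes its tail. Hall's condition holds because edges `s` covering the vertex set `U` satisfy
  -- `2 * |s| ≤ 2 * k * |U|`.
  let t : X.edgeSet → Finset (V × Fin k) := fun e => e.1.toFinset ×ˢ Finset.univ
  have hall : ∀ s : Finset X.edgeSet, s.card ≤ (s.biUnion t).card := by
    intro s
    let U : Finset V := s.biUnion fun e => e.1.toFinset
    have h1 : s.biUnion t = U ×ˢ Finset.univ := by
      ext ⟨v, i⟩
      simp [t, U]
    have h2 : ∑ e ∈ s, (U.bipartiteAbove (fun (e : X.edgeSet) v => v ∈ e.1) e).card =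
        s.card * 2 := by
      refine Finset.sum_const_nat fun e he => ?_
      rw [← Sym2.card_toFinset_of_not_isDiag e.1 (X.not_isDiag_of_mem_edgeSet e.2)]
      congr 1
      ext v
      simp only [Finset.bipartiteAbove, Finset.mem_filter, Sym2.mem_toFinset, and_iff_right_iff_imp]
      exact fun hv => Finset.mem_biUnion.2 ⟨e, he, by simpa using hv⟩
    have h3 : ∀ v ∈ U, (s.bipartiteBelow (fun (e : X.edgeSet) v => v ∈ e.1) v).card ≤ 2 * k := by
      intro v _
      rw [← hdeg v, ← X.card_incidenceFinset_eq_degree v,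
        ← Finset.card_map (Function.Embedding.subtype _)]
      refine Finset.card_le_card fun e he => ?_
      obtain ⟨e, he', rfl⟩ := Finset.mem_map.1 he
      have he'' : v ∈ e.1 := (Finset.mem_filter.1 he').2
      simp [SimpleGraph.incidenceSet, he'']
    have h4 := Finset.sum_le_sum h3
    rw [← Finset.sum_card_bipartiteAbove_eq_sum_card_bipartiteBelow, h2, Finset.sum_const,
      smul_eq_mul] at h4
    rw [h1, Finset.card_product, Finset.card_univ, Fintype.card_fin]
    nlinarith
  obtain ⟨g, hg, hgt⟩ := (Finset.all_card_le_biUnion_card_iff_exists_injective t).1 hall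
  have hmem : ∀ e, (g e).1 ∈ e.1 := fun e => by simpa [t] using hgt e
  let R : V → V → Prop := fun v w => ∃ h : X.Adj v w, (g ⟨s(v, w), h⟩).1 = v
  have hR : ∀ v w, X.Adj v w → (R v w ↔ ¬ R w v) := by
    intro v w h
    have h1 : (⟨s(w, v), h.symm⟩ : X.edgeSet) = ⟨s(v, w), h⟩ := Subtype.ext Sym2.eq_swap
    have h2 := hmem ⟨s(v, w), h⟩
    have h3 : R w v ↔ (g ⟨s(v, w), h⟩).1 = w := by
      rw [← h1]
      exact ⟨fun ⟨_, h⟩ => h, fun h' => ⟨h.symm, h'⟩⟩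
    have h4 : R v w ↔ (g ⟨s(v, w), h⟩).1 = v := ⟨fun ⟨_, h⟩ => h, fun h' => ⟨h, h'⟩⟩
    rw [h3, h4]
    rcases Sym2.mem_iff.1 h2 with h2 | h2 <;> rw [h2] <;> simp [h.ne, h.ne.symm]
  have hsum : ∀ v, {w | R v w}.ncard + {w | R w v}.ncard = 2 * k := by
    intro v
    rw [← hX v, ← Set.ncard_union_eq]
    · congr 1
      ext w
      simp only [Set.mem_union, Set.mem_ofPred_eq]
      constructor
      · rintro (⟨h, -⟩ | ⟨h, -⟩)
        exacts [h, h.symm]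
      · intro h
        have := hR v w h
        tauto
    · refine Set.disjoint_left.2 fun w h h' => (hR v w h.1).1 h h'
  -- Injectivity of the choice bounds each outdegree by `k`. The outdegrees have average `k`, so all
  -- bounds are attained.
  have hle : ∀ v ∈ Finset.univ, {w | R v w}.ncard ≤ k := by
    intro v _
    have h1 := Nat.card_le_card_of_injective
      (fun w : {w | R v w} => (g ⟨s(v, w.1), w.2.1⟩).2) fun ⟨w, h, hw⟩ ⟨w', h', hw'⟩ heq => by
        have h2 := hg (Prod.ext (hw.trans hw'.symm) heq)
        have h3 : s(v, w) = s(v, w') := congrArg Subtype.val h2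
        exact Subtype.ext (Sym2.congr_right.1 h3)
    rwa [Nat.card_coe_set_eq, Nat.card_fin] at h1
  have htot : ∑ v, {w | R v w}.ncard = ∑ _v : V, k := by
    have h1 := Finset.sum_congr rfl fun v (_ : v ∈ Finset.univ) => hsum v
    rw [Finset.sum_add_distrib, ← sum_ncard_eq_sum_ncard_swap R, Finset.sum_const] at h1
    rw [Finset.sum_const]
    simp only [smul_eq_mul] at h1 ⊢
    linarith
  have hout := (Finset.sum_eq_sum_iff_of_le hle).1 htot
  refine ⟨R, fun v w h => h.1, hR, fun v => ?_⟩
  have h1 := hout v (Finset.mem_univ _)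
  have h2 := hsum v
  exact ⟨h1, by omega⟩

end Orientation

namespace ECPOG

/-! ### Total degrees and directed colors -/

section Degrees

variable {V W C : Type*} {G : ECPOG V C} {c : C} {v w : V}

lemma colorGraph_adj : (G.colorGraph c).Adj v w ↔ G.HasColor c v w ∨ G.HasColor c w v := by
  rw [colorGraph, SimpleGraph.fromRel_adj, and_iff_right_iff_imp]
  rintro (h | h)
  exacts [h.ne, h.ne.symm]

lemma colorGraph_adj_unique {c' : C} (h : (G.colorGraph c).Adj v w)
    (h' : (G.colorGraph c').Adj v w) : c = c' := by
  rw [colorGraph_adj] at h h'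
  rcases h with h | h <;> rcases h' with h' | h'
  exacts [h.unique h', h.unique_swap h', h.unique_swap h', h.unique h']

lemma IsComplete.exists_colorGraph_adj (hG : G.IsComplete) (h : v ≠ w) :
    ∃ c, (G.colorGraph c).Adj v w := by
  rcases hG v w h with h | h <;> obtain ⟨c, hc⟩ := exists_hasColor h
  exacts [⟨c, colorGraph_adj.2 (Or.inl hc)⟩, ⟨c, colorGraph_adj.2 (Or.inr hc)⟩]

/-- The number of edges of color `c` at `v`, directed or not. -/
noncomputable def totalDegree (G : ECPOG V C) (c : C) (v : V) : ℕ :=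
  {w | (G.colorGraph c).Adj v w}.ncard

lemma totalDegree_eq [Finite V] (G : ECPOG V C) (c : C) (v : V) :
    G.totalDegree c v = G.inDegree c v + G.outDegree c v + G.undirectedDegree c v := by
  rw [inDegree, outDegree, undirectedDegree, totalDegree, ← Set.ncard_union_eq,
    ← Set.ncard_union_eq]
  · congr 1
    ext w
    simp only [Set.mem_ofPred_eq, colorGraph_adj, Set.mem_union, hasColor_and_adj_iff,
      hasColor_and_not_adj_iff]
    tauto
  · refine Set.disjoint_left.2 fun w h h' => ?_
    rcases h with h | h
    · exact h.2 h'.1.1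
    · exact h.2 h'.2
  · exact Set.disjoint_left.2 fun w h h' => h.2 h'.1.1

lemma ParamEq.totalDegree_eq [Finite V] [Finite W] {H : ECPOG W C} (h : ParamEq G H) (c : C)
    (v : V) (w : W) : G.totalDegree c v = H.totalDegree c w := by
  rw [ECPOG.totalDegree_eq, ECPOG.totalDegree_eq, (h.deg c v w).1, (h.deg c v w).2.1,
    (h.deg c v w).2.2]

lemma IsColorRegular.totalDegree_eq [Finite V] (h : G.IsColorRegular) (c : C) (v w : V) :
    G.totalDegree c v = G.totalDegree c w := by
  rw [ECPOG.totalDegree_eq, ECPOG.totalDegree_eq, (h c v w).1, (h c v w).2.1, (h c v w).2.2]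

lemma IsColorRegular.inDegree_eq_outDegree [Finite V] (h : G.IsColorRegular) (c : C) (v : V) :
    G.inDegree c v = G.outDegree c v := by
  have := Fintype.ofFinite V
  have h1 := sum_ncard_eq_sum_ncard_swap fun v w => G.HasColor c v w ∧ ¬ G.Adj w v
  have h2 : ∀ w ∈ Finset.univ, G.outDegree c w = G.outDegree c v := fun w _ => (h c w v).2.1
  have h3 : ∀ w ∈ Finset.univ, G.inDegree c w = G.inDegree c v := fun w _ => (h c w v).1
  change ∑ w, G.outDegree c w = ∑ w, G.inDegree c w at h1
  rw [Finset.sum_congr rfl h2, Finset.sum_congr rfl h3, Finset.sum_const, Finset.sum_const,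
    smul_eq_mul, smul_eq_mul] at h1
  have : Nonempty V := ⟨v⟩
  exact (Nat.eq_of_mul_eq_mul_left (Finset.card_pos.2 Finset.univ_nonempty) h1).symm

/-- Some edge of color `c` is directed. -/
def IsDirectedColor (G : ECPOG V C) (c : C) : Prop := ∃ v w, G.HasColor c v w ∧ ¬ G.Adj w v

lemma isUndirectedColor_iff : G.IsUndirectedColor c ↔ ¬ G.IsDirectedColor c := by
  simp only [IsDirectedColor, hasColor_and_not_adj_iff, not_exists, not_and, not_not]
  rfl

lemma IsDirectedColor.not_adj (h : G.IsDirectedColor c) (hc : G.HasColor c v w) : ¬ G.Adj w v := by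
  obtain ⟨x, y, h1, h2⟩ := h
  exact fun h3 => h2 (hc.adj_swap h1 h3)

lemma IsDirectedColor.not_hasColor (h : G.IsDirectedColor c) (hc : G.HasColor c v w) :
    ¬ G.HasColor c w v := fun h' => h.not_adj hc h'.1

lemma IsDirectedColor.undirectedDegree (h : G.IsDirectedColor c) (v : V) :
    G.undirectedDegree c v = 0 := by
  rw [ECPOG.undirectedDegree]
  convert Set.ncard_empty V
  exact Set.eq_empty_iff_forall_notMem.2 fun w hw => h.not_adj hw.1 hw.2

lemma IsUndirectedColor.outDegree (h : G.IsUndirectedColor c) (v : V) : G.outDegree c v = 0 := by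
  rw [ECPOG.outDegree]
  convert Set.ncard_empty V
  exact Set.eq_empty_iff_forall_notMem.2 fun w hw => hw.2 (h _ _ hw.1).1

lemma IsUndirectedColor.inDegree (h : G.IsUndirectedColor c) (v : V) : G.inDegree c v = 0 := by
  rw [ECPOG.inDegree]
  convert Set.ncard_empty V
  exact Set.eq_empty_iff_forall_notMem.2 fun w hw => hw.2 (h _ _ hw.1).1

lemma IsUndirectedColor.undirectedDegree [Finite V] (h : G.IsUndirectedColor c) (v : V) :
    G.undirectedDegree c v = G.totalDegree c v := by
  rw [ECPOG.totalDegree_eq, h.outDegree, h.inDegree, zero_add, zero_add]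

lemma IsDirectedColor.totalDegree [Finite V] (h : G.IsDirectedColor c) (hG : G.IsColorRegular)
    (v : V) : G.totalDegree c v = 2 * G.outDegree c v := by
  rw [ECPOG.totalDegree_eq, h.undirectedDegree, hG.inDegree_eq_outDegree]
  ring

end Degrees

/-! ### Realizing edge colorings with prescribed degrees -/

section Realization

variable {V W W' C : Type*}

/-- The edge coloring `f` of the complete graph on `W` has as many vertices as `G`, and the same
degrees when directions are forgotten. -/
structure IsRecoloring (G : ECPOG V C) (f : W → W → C) : Prop where
  card : Nat.card V = Nat.card W
  symm : ∀ x y, x ≠ y → f x y = f y x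
  deg : ∀ c v x, {y | y ≠ x ∧ f x y = c}.ncard = G.totalDegree c v

/-- A recoloring can be directed by a relation that orients the directed colors of `G` with the
right outdegrees. -/
theorem IsRecoloring.exists_paramEq_of_orientation [Finite V] [Finite W] {G : ECPOG V C}
    (hG : G.IsComplete) (hreg : G.IsColorRegular) {f : W → W → C} (hf : IsRecoloring G f)
    {R : W → W → Prop} (hR : ∀ x y, x ≠ y → G.IsDirectedColor (f x y) → (R x y ↔ ¬ R y x))
    (hout : ∀ c, G.IsDirectedColor c → ∀ v x,
      {y | y ≠ x ∧ f x y = c ∧ R x y}.ncard = G.outDegree c v) :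
    ∃ (H : ECPOG V C) (e : V ≃ W), ParamEq G H ∧
      ∀ c v w, H.HasColor c v w ↔
        v ≠ w ∧ f (e v) (e w) = c ∧ (G.IsDirectedColor c → R (e v) (e w)) := by
  obtain ⟨e⟩ := Finite.card_eq.1 hf.card
  have hsymm : ∀ {v w}, v ≠ w → f (e v) (e w) = f (e w) (e v) := fun h =>
    hf.symm _ _ (e.injective.ne h)
  have hRe : ∀ {v w}, v ≠ w → G.IsDirectedColor (f (e v) (e w)) →
      (R (e v) (e w) ↔ ¬ R (e w) (e v)) := fun h => hR _ _ (e.injective.ne h)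
  let H : ECPOG V C :=
    -- Only the colors that are directed in `G` follow `R`; an edge of any other color receives both
    -- arcs.
    { Adj := fun v w => v ≠ w ∧ (G.IsDirectedColor (f (e v) (e w)) → R (e v) (e w))
      color := fun v w _ => f (e v) (e w)
      loopless := fun v h => h.1 rfl
      color_symm := fun v w h _ => hsymm h.1
      not_mixed := fun v w x y h h' heq hs => by
        change f (e v) (e w) = f (e x) (e y) at heq
        have hu : ¬ G.IsDirectedColor (f (e v) (e w)) := fun hd =>
          (hRe h.1 hd).1 (h.2 hd) (hs.2 (hsymm h.1 ▸ hd))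
        refine ⟨h'.1.symm, fun hd => (hu ?_).elim⟩
        rwa [heq, hsymm h'.1] }
  have hH : ∀ c v w, H.HasColor c v w ↔
      v ≠ w ∧ f (e v) (e w) = c ∧ (G.IsDirectedColor c → R (e v) (e w)) := by
    intro c v w
    constructor
    · rintro ⟨h, rfl⟩
      exact ⟨h.1, rfl, h.2⟩
    · rintro ⟨h, rfl, h'⟩
      exact ⟨⟨h, h'⟩, rfl⟩
  have hHX : ∀ c v w, (H.colorGraph c).Adj v w ↔ v ≠ w ∧ f (e v) (e w) = c := by
    intro c v w
    rw [colorGraph_adj, hH, hH]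
    constructor
    · rintro (h | h)
      exacts [⟨h.1, h.2.1⟩, ⟨h.1.symm, (hsymm h.1.symm).trans h.2.1⟩]
    · rintro ⟨h, rfl⟩
      have h1 := hRe h
      have h2 := hsymm h
      tauto
  have htot : ∀ c v w, H.totalDegree c w = G.totalDegree c v := by
    intro c v w
    rw [← hf.deg c v (e w), totalDegree, ← Set.ncard_image_of_injective _ e.injective]
    congr 1
    ext y
    obtain ⟨u, rfl⟩ := e.surjective y
    simp [hHX, eq_comm]
  refine ⟨H, e, ⟨rfl, hG, fun v w hne => ?_, fun c v w => ?_⟩, hH⟩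
  · rcases colorGraph_adj.1 ((hHX (f (e v) (e w)) v w).2 ⟨hne, rfl⟩) with h | h
    exacts [Or.inl h.1, Or.inr h.1]
  · by_cases hc : G.IsDirectedColor c
    · have hHc : ∀ u u', H.HasColor c u u' → ¬ H.HasColor c u' u := fun u u' h h' => by
        rw [hH] at h h'
        obtain ⟨h1, rfl, h2⟩ := h
        exact (hRe h1 hc).1 (h2 hc) (h'.2.2 hc)
      have hund : H.undirectedDegree c w = 0 := by
        rw [undirectedDegree]
        convert Set.ncard_empty V
        refine Set.eq_empty_iff_forall_notMem.2 fun u hu => ?_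
        rw [Set.mem_ofPred_eq, hasColor_and_adj_iff] at hu
        exact hHc _ _ hu.1 hu.2
      have hout' : H.outDegree c w = G.outDegree c v := by
        rw [← hout c hc v (e w), outDegree, ← Set.ncard_image_of_injective _ e.injective]
        congr 1
        ext y
        obtain ⟨u, rfl⟩ := e.surjective y
        have h1 := hHc w u
        have h2 := hH c w u
        simp only [hasColor_and_not_adj_iff, Set.mem_image_equiv, Equiv.symm_apply_apply,
          Set.mem_ofPred_eq, e.injective.ne_iff]
        rw [ne_comm]
        tauto
      -- For a directed color the indegree is what remains of the total degree, which is twice the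
      -- outdegree.
      have h1 := htot c v w
      rw [hc.totalDegree hreg, ECPOG.totalDegree_eq, hund, hout'] at h1
      rw [hund, hout', hc.undirectedDegree, hreg.inDegree_eq_outDegree]
      exact ⟨by omega, rfl, rfl⟩
    · have hu : H.IsUndirectedColor c := fun x y hxy => by
        rw [hH] at hxy ⊢
        exact ⟨hxy.1.symm, (hsymm hxy.1.symm).trans hxy.2.1, fun h => (hc h).elim⟩
      have hu' := isUndirectedColor_iff.2 hc
      rw [hu.inDegree, hu.outDegree, hu'.inDegree, hu'.outDegree, hu.undirectedDegree,
        hu'.undirectedDegree, htot c v w]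
      exact ⟨rfl, rfl, rfl⟩

/-- A directed color of `G` has total degree twice its outdegree, so each directed color class of
`f` has a balanced orientation. The orientations of the different classes do not interact. -/
theorem IsRecoloring.exists_orientation [Finite W] {G : ECPOG V C} [Finite V]
    (hreg : G.IsColorRegular) {f : W → W → C} (hf : IsRecoloring G f) :
    ∃ R : W → W → Prop, (∀ x y, x ≠ y → G.IsDirectedColor (f x y) → (R x y ↔ ¬ R y x)) ∧
      ∀ c, G.IsDirectedColor c → ∀ v x,
        {y | y ≠ x ∧ f x y = c ∧ R x y}.ncard = G.outDegree c v := by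
  let X : C → SimpleGraph W := fun c =>
    { Adj := fun x y => y ≠ x ∧ f x y = c
      symm := ⟨fun x y h => ⟨h.1.symm, by rw [hf.symm _ _ h.1]; exact h.2⟩⟩
      loopless := ⟨fun v h => h.1 rfl⟩ }
  have hor : ∀ c, ∃ R : W → W → Prop, G.IsDirectedColor c → (∀ x y, R x y → (X c).Adj x y) ∧
      (∀ x y, (X c).Adj x y → (R x y ↔ ¬ R y x)) ∧
      ∀ v x, {y | R x y}.ncard = G.outDegree c v := by
    intro c
    by_cases hc : G.IsDirectedColor c
    · obtain ⟨v₀, -⟩ := id hc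
      obtain ⟨R, h1, h2, h3⟩ := (X c).exists_balanced_orientation (G.outDegree c v₀)
        fun x => (hf.deg c v₀ x).trans (hc.totalDegree hreg v₀)
      refine ⟨R, fun _ => ⟨h1, h2, fun v x => ?_⟩⟩
      rw [(hreg c v v₀).2.1]
      exact (h3 x).1
    · exact ⟨fun _ _ => False, fun h => (hc h).elim⟩
  choose R hR using hor
  refine ⟨fun x y => R (f x y) x y, fun x y hxy hc => ?_, fun c hc v x => ?_⟩
  · simp only [hf.symm y x hxy.symm]
    exact (hR _ hc).2.1 x y ⟨hxy.symm, rfl⟩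
  · rw [← (hR c hc).2.2 v x]
    congr 1
    ext y
    constructor
    · rintro ⟨-, rfl, h⟩
      exact h
    · intro h
      obtain ⟨h1, rfl⟩ := (hR c hc).1 x y h
      exact ⟨h1, rfl, h⟩

universe u v

/-- Both oriented colorings have the parameters of `G`, so both are isomorphic to `G` and thus to
each other. Every later proof of non-uniqueness contradicts the resulting `σ`. -/
theorem IsParamUnique.exists_equiv_of_orientation {V : Type u} {C : Type v} [Finite V] [Finite W]
    [Finite W'] {G : ECPOG V C} (hG : G.IsComplete) (hreg : G.IsColorRegular)
    (h : G.IsParamUnique) {f : W → W → C} {g : W' → W' → C} (hf : IsRecoloring G f)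
    (hg : IsRecoloring G g) {R : W → W → Prop} {S : W' → W' → Prop}
    (hR : ∀ x y, x ≠ y → G.IsDirectedColor (f x y) → (R x y ↔ ¬ R y x))
    (hRout : ∀ c, G.IsDirectedColor c → ∀ v x,
      {y | y ≠ x ∧ f x y = c ∧ R x y}.ncard = G.outDegree c v)
    (hS : ∀ x y, x ≠ y → G.IsDirectedColor (g x y) → (S x y ↔ ¬ S y x))
    (hSout : ∀ c, G.IsDirectedColor c → ∀ v x,
      {y | y ≠ x ∧ g x y = c ∧ S x y}.ncard = G.outDegree c v) :
    ∃ σ : W ≃ W', ∀ x y, x ≠ y → g (σ x) (σ y) = f x y ∧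
      (G.IsDirectedColor (f x y) → R x y → S (σ x) (σ y)) := by
  obtain ⟨H₁, e₁, h₁, hc₁⟩ := hf.exists_paramEq_of_orientation hG hreg hR hRout
  obtain ⟨H₂, e₂, h₂, hc₂⟩ := hg.exists_paramEq_of_orientation hG hreg hS hSout
  obtain ⟨i₁⟩ := h V H₁ h₁
  obtain ⟨i₂⟩ := h V H₂ h₂
  have key : ∀ c x y, H₁.HasColor c (e₁.symm x) (e₁.symm y) →
      H₂.HasColor c (i₂.toEquiv (i₁.toEquiv.symm (e₁.symm x)))
        (i₂.toEquiv (i₁.toEquiv.symm (e₁.symm y))) := fun c x y hxy =>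
    (i₂.hasColor_iff _ _ _).1 ((i₁.hasColor_iff c _ _).2 (by
      change H₁.HasColor c (i₁.toEquiv _) (i₁.toEquiv _)
      simpa using hxy))
  have hf' : ∀ x y, x ≠ y → (G.IsDirectedColor (f x y) → R x y) →
      H₁.HasColor (f x y) (e₁.symm x) (e₁.symm y) := fun x y hxy h =>
    (hc₁ _ _ _).2 ⟨e₁.symm.injective.ne hxy, by simpa using h⟩
  refine ⟨e₁.symm.trans (i₁.toEquiv.symm.trans (i₂.toEquiv.trans e₂)), fun x y hxy =>
    ⟨?_, fun hd hRxy => ((hc₂ _ _ _).1 (key _ _ _ (hf' x y hxy fun _ => hRxy))).2.2 hd⟩⟩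
  -- If `R` does not orient the pair from `x` to `y`, the color is read off the reverse arc and
  -- carried back by symmetry of `f` and `g`.
  by_cases h3 : G.IsDirectedColor (f x y) → R x y
  · exact ((hc₂ _ _ _).1 (key _ _ _ (hf' x y hxy h3))).2.1
  · obtain ⟨hd, hn⟩ := Classical.not_imp.1 h3
    have h5 := ((hc₂ _ _ _).1 (key _ _ _ (hf' y x hxy.symm fun _ => by
      have := hR x y hxy hd
      tauto)))
    rw [← hf.symm y x hxy.symm, ← h5.2.1]
    exact hg.symm _ _ (e₂.injective.ne h5.1.symm)

theorem IsParamUnique.exists_equiv {V : Type u} {C : Type v} [Finite V] [Finite W] [Finite W']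
    {G : ECPOG V C} (hG : G.IsComplete) (hreg : G.IsColorRegular) (h : G.IsParamUnique)
    {f : W → W → C} {g : W' → W' → C} (hf : IsRecoloring G f) (hg : IsRecoloring G g) :
    ∃ σ : W ≃ W', ∀ x y, x ≠ y → g (σ x) (σ y) = f x y := by
  obtain ⟨R, hR, hRout⟩ := hf.exists_orientation hreg
  obtain ⟨S, hS, hSout⟩ := hg.exists_orientation hreg
  obtain ⟨σ, hσ⟩ := h.exists_equiv_of_orientation hG hreg hf hg hR hRout hS hSout
  exact ⟨σ, fun x y hxy => (hσ x y hxy).1⟩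

end Realization

end ECPOG

/-! ### Merging the classes of a factorization -/

section Assignment

lemma exists_fiber_card {I C : Type*} [DecidableEq I] [DecidableEq C] [Nonempty C]
    (k : C → ℕ) (P : Finset C) :
    ∀ s : Finset I, ∑ c ∈ P, k c = s.card →
      ∃ g : I → C, (∀ i ∈ s, g i ∈ P) ∧ ∀ c ∈ P, {i ∈ s | g i = c}.card = k c := by
  induction P using Finset.induction_on with
  | empty =>
    intro s hs
    -- Outside `s` the values are irrelevant; an arbitrary color serves as default.
    have : s = ∅ := Finset.card_eq_zero.1 (by simpa using hs.symm)
    exact ⟨fun _ => Classical.arbitrary C, by simp [this], by simp⟩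
  | insert a P ha ih =>
    intro s hs
    rw [Finset.sum_insert ha] at hs
    obtain ⟨t, ht, htk⟩ := Finset.exists_subset_card_eq (by omega : k a ≤ s.card)
    obtain ⟨g, hg, hgk⟩ := ih (s \ t) (by rw [Finset.card_sdiff_of_subset ht]; omega)
    refine ⟨fun i => if i ∈ t then a else g i, fun i hi => ?_, fun c hc => ?_⟩
    · by_cases hit : i ∈ t
      · simp [hit]
      · simp [hit, hg i (by simp [hi, hit])]
    · rcases Finset.mem_insert.1 hc with rfl | hc
      · rw [← htk]
        congr 1
        ext i
        by_cases hit : i ∈ t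
        · simp [hit, ht hit]
        · simp only [Finset.mem_filter, hit, if_false, iff_false, not_and]
          exact fun hi h => ha (h ▸ hg i (by simp [hi, hit]))
      · have hca : a ≠ c := fun h => ha (h ▸ hc)
        rw [← hgk c hc]
        congr 1
        ext i
        by_cases hit : i ∈ t <;> simp [hit, hca]

/-- The colors of `T` share out the elements of `S`, and independently the colors of `P \ T` share
out `s \ S`. -/
lemma exists_fiber_card_of_subset {I C : Type*} [DecidableEq I] [DecidableEq C] [Nonempty C]
    {k : C → ℕ} {P T : Finset C} {s S : Finset I} (hT : T ⊆ P) (hS : S ⊆ s)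
    (h : ∑ c ∈ P, k c = s.card) (h' : ∑ c ∈ T, k c = S.card) :
    ∃ g : I → C, (∀ i ∈ s, g i ∈ P) ∧ (∀ c ∈ P, {i ∈ s | g i = c}.card = k c) ∧
      ∀ i ∈ s, g i ∈ T ↔ i ∈ S := by
  obtain ⟨g₁, h1, h2⟩ := exists_fiber_card k T S h'
  obtain ⟨g₂, h3, h4⟩ := exists_fiber_card k (P \ T) (s \ S) (by
    have := Finset.sum_sdiff hT (f := k)
    rw [Finset.card_sdiff_of_subset hS]
    omega)
  have key : ∀ i ∈ s, (if i ∈ S then g₁ i else g₂ i) ∈ P ∧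
      ((if i ∈ S then g₁ i else g₂ i) ∈ T ↔ i ∈ S) := by
    intro i hi
    by_cases hiS : i ∈ S
    · simp [hiS, h1 i hiS, hT (h1 i hiS)]
    · have := Finset.mem_sdiff.1 (h3 i (by simp [hi, hiS]))
      simp [hiS, this]
  refine ⟨fun i => if i ∈ S then g₁ i else g₂ i, fun i hi => (key i hi).1, fun c hc => ?_,
    fun i hi => (key i hi).2⟩
  by_cases hcT : c ∈ T
  · rw [← h2 c hcT]
    congr 1
    ext i
    by_cases hiS : i ∈ S
    · simp [hiS, hS hiS]
    · simp only [Finset.mem_filter, hiS, if_false, false_and, iff_false, not_and]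
      exact fun hi h => (Finset.mem_sdiff.1 (h3 i (by simp [hi, hiS]))).2 (h ▸ hcT)
  · rw [← h4 c (by simp [hc, hcT])]
    congr 1
    ext i
    by_cases hiS : i ∈ S
    · simp only [Finset.mem_filter, hiS, if_true, Finset.mem_sdiff, not_true, and_false, false_and,
        iff_false, not_and]
      exact fun hi h => hcT (h ▸ h1 i hiS)
    · simp [hiS]

end Assignment

/-- The edge coloring `F` of the complete graph on `W` with colors in `s` has color classes that
are regular of degree `r`. -/
structure IsFactorization {W I : Type*} (F : W → W → I) (s : Finset I) (r : ℕ) : Prop where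
  symm : ∀ x y, x ≠ y → F x y = F y x
  mem : ∀ x y, x ≠ y → F x y ∈ s
  deg : ∀ x, ∀ i ∈ s, {y | y ≠ x ∧ F x y = i}.ncard = r

lemma sum_ncard_fiber {W I : Type*} [Finite W] (F : W → W → I) (s : Finset I)
    (x : W) (h : ∀ y, y ≠ x → F x y ∈ s) :
    ∑ i ∈ s, {y | y ≠ x ∧ F x y = i}.ncard = Nat.card W - 1 := by
  classical
  have := Fintype.ofFinite W
  have h1 := Finset.card_eq_sum_card_fiberwise (s := Finset.univ.erase x) (t := s) (f := F x)
    fun y hy => h y (by simpa using hy)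
  rw [Finset.card_erase_of_mem (Finset.mem_univ _), Finset.card_univ] at h1
  rw [Nat.card_eq_fintype_card, h1]
  refine Finset.sum_congr rfl fun i _ => ?_
  rw [Set.ncard_eq_toFinset_card']
  congr 1
  ext y
  simp

lemma ncard_fiber_comp {W I C : Type*} [Finite W] [DecidableEq C] {F : W → W → I} {s : Finset I}
    {x : W} (h : ∀ y, y ≠ x → F x y ∈ s) (g : I → C) (c : C) :
    {y | y ≠ x ∧ g (F x y) = c}.ncard =
      ∑ i ∈ s with g i = c, {y | y ≠ x ∧ F x y = i}.ncard := by
  classical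
  have := Fintype.ofFinite W
  have h1 := Finset.card_eq_sum_card_fiberwise (s := {y | y ≠ x ∧ g (F x y) = c})
    (t := {i ∈ s | g i = c}) (f := F x) fun y hy => by
      simp only [Finset.coe_filter, Finset.mem_univ, true_and, Set.mem_ofPred_eq] at hy ⊢
      exact ⟨h y hy.1, hy.2⟩
  rw [Set.ncard_eq_toFinset_card', Set.toFinset_ofPred, h1]
  refine Finset.sum_congr rfl fun i hi => ?_
  rw [Set.ncard_eq_toFinset_card']
  congr 1
  ext y
  simp only [Finset.mem_filter] at hi
  simp only [Finset.mem_filter, Finset.mem_univ, true_and, Set.toFinset_ofPred]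
  constructor
  · rintro ⟨⟨h1, -⟩, h2⟩
    exact ⟨h1, h2⟩
  · rintro ⟨h1, rfl⟩
    exact ⟨⟨h1, hi.2⟩, rfl⟩

lemma IsFactorization.card_mul {W I : Type*} [Finite W] [Nonempty W] {F : W → W → I}
    {s : Finset I} {r : ℕ} (h : IsFactorization F s r) : s.card * r = Nat.card W - 1 := by
  obtain ⟨x⟩ := ‹Nonempty W›
  rw [← sum_ncard_fiber F s x fun y hy => h.mem x y hy.symm, Finset.sum_congr rfl (h.deg x),
    Finset.sum_const, smul_eq_mul]

namespace ECPOG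

section

variable {V W C : Type*} {G : ECPOG V C}

/-- The edge colors of a finite graph. -/
noncomputable def colors [Finite V] (G : ECPOG V C) : Finset C := G.finite_edgeColors.toFinset

@[simp] lemma mem_colors [Finite V] {c : C} : c ∈ G.colors ↔ c ∈ G.edgeColors := by
  simp [colors]

lemma totalDegree_eq_zero [Finite V] {c : C} (h : c ∉ G.colors) (v : V) :
    G.totalDegree c v = 0 := by
  rw [totalDegree]
  convert Set.ncard_empty V
  refine Set.eq_empty_iff_forall_notMem.2 fun w hw => h (mem_colors.2 ?_)
  rcases colorGraph_adj.1 hw with h | h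
  exacts [⟨_, _, h⟩, ⟨_, _, h⟩]

lemma totalDegree_pos [Finite V] (hreg : G.IsColorRegular) {c : C} (h : c ∈ G.colors) (v : V) :
    0 < G.totalDegree c v := by
  obtain ⟨x, y, hxy⟩ := mem_colors.1 h
  rw [hreg.totalDegree_eq c v x, totalDegree, Set.ncard_pos]
  exact ⟨y, colorGraph_adj.2 (Or.inl hxy)⟩

lemma mem_colors_iff_totalDegree [Finite V] (hreg : G.IsColorRegular) {c : C} (v : V) :
    c ∈ G.colors ↔ G.totalDegree c v ≠ 0 :=
  ⟨fun h => (totalDegree_pos hreg h v).ne', fun h => by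
    by_contra h'
    exact h (totalDegree_eq_zero h' v)⟩

lemma sum_totalDegree [Finite V] (hG : G.IsComplete) (v : V) :
    ∑ c ∈ G.colors, G.totalDegree c v = Nat.card V - 1 := by
  classical
  rcases isEmpty_or_nonempty C with hC | hC
  -- Without any color, completeness leaves at most one vertex, and both sides vanish; the
  -- subtraction on the right is truncated if there is no vertex.
  · have : Subsingleton V := ⟨fun x y => by
      by_contra hxy
      obtain ⟨c, -⟩ := hG.exists_colorGraph_adj hxy
      exact hC.elim c⟩
    have h1 : Nat.card V ≤ 1 := Finite.card_le_one_iff_subsingleton.2 this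
    have h2 : G.colors = ∅ := Finset.eq_empty_of_isEmpty _
    rw [h2, Finset.sum_empty]
    omega
  have hex : ∀ w, w ≠ v → ∃ c, (G.colorGraph c).Adj v w := fun w hw =>
    hG.exists_colorGraph_adj hw.symm
  choose! f hf using hex
  have h1 := sum_ncard_fiber (fun _ => f) G.colors v fun w hw => by
    rw [mem_colors]
    rcases colorGraph_adj.1 (hf w hw) with h | h
    exacts [⟨_, _, h⟩, ⟨_, _, h⟩]
  rw [← h1]
  refine Finset.sum_congr rfl fun c _ => ?_
  rw [totalDegree]
  congr 1
  ext w
  constructor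
  · intro h
    have h' : (G.colorGraph c).Adj v w := h
    exact ⟨h'.ne.symm, colorGraph_adj_unique (hf w h'.ne.symm) h'⟩
  · rintro ⟨h, rfl⟩
    exact hf w h

/-- If all degrees of `G` are multiples of `r`, each color `c` can take `k c` of the classes. The
freedom to choose which classes `S` go to the colors in `T` is what produces non-isomorphic
recolorings. -/
lemma _root_.IsFactorization.exists_isRecoloring [Finite V] [Finite W] [Nonempty V] {I : Type*}
    [Nonempty C] (hG : G.IsComplete) {F : W → W → I} {s : Finset I}
    {r : ℕ} (hr : 0 < r) (hF : IsFactorization F s r) (hcard : Nat.card V = Nat.card W) {k : C → ℕ}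
    (hk : ∀ c v, G.totalDegree c v = k c * r) {T : Finset C} {S : Finset I} (hS : S ⊆ s)
    (hT : T ⊆ G.colors) (hTS : ∑ c ∈ T, k c = S.card) :
    ∃ g : I → C, IsRecoloring G (fun x y => g (F x y)) ∧ ∀ i ∈ s, g i ∈ T ↔ i ∈ S := by
  classical
  obtain ⟨v₀⟩ := id ‹Nonempty V›
  have : Nonempty W := (Finite.card_eq.1 hcard).some.symm.nonempty
  have hsum : ∑ c ∈ G.colors, k c = s.card := by
    have h1 := sum_totalDegree hG v₀
    rw [Finset.sum_congr rfl fun c _ => hk c v₀, ← Finset.sum_mul, hcard, ← hF.card_mul] at h1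
    exact Nat.eq_of_mul_eq_mul_right hr h1
  obtain ⟨g, h1, h2, h3⟩ := exists_fiber_card_of_subset hT hS hsum hTS
  refine ⟨g, ⟨hcard, fun x y h => congrArg g (hF.symm x y h), fun c v x => ?_⟩, h3⟩
  rw [ncard_fiber_comp (fun y hy => hF.mem x y hy.symm) g c,
    Finset.sum_congr rfl fun i hi => hF.deg x i (Finset.mem_filter.1 hi).1, Finset.sum_const,
    smul_eq_mul, hk]
  congr 1
  by_cases hc : c ∈ G.colors
  · exact h2 c hc
  · have h4 := hk c v₀
    rw [totalDegree_eq_zero hc, eq_comm, mul_eq_zero] at h4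
    rw [h4.resolve_right hr.ne', Finset.card_eq_zero, Finset.filter_eq_empty_iff]
    exact fun i hi h => hc (h ▸ h1 i hi)

/-- It suffices to check the degrees in all colors but one. -/
lemma isRecoloring_of_forall_ne [Finite V] [Finite W] (hG : G.IsComplete)
    {f : W → W → C} (hcard : Nat.card V = Nat.card W) (hsymm : ∀ x y, x ≠ y → f x y = f y x)
    {c₀ : C} (hc₀ : c₀ ∈ G.colors)
    (hdeg : ∀ c, c ≠ c₀ → ∀ v x, {y | y ≠ x ∧ f x y = c}.ncard = G.totalDegree c v) :
    IsRecoloring G f := by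
  classical
  refine ⟨hcard, hsymm, fun c v x => ?_⟩
  by_cases hc : c = c₀
  -- All degrees at a vertex sum to the order minus one on both sides, so the degree in the last
  -- color follows by subtraction.
  · subst hc
    have h1 := sum_totalDegree hG v
    have h2 := sum_ncard_fiber f G.colors x fun y hy => by
      by_contra h
      have h3 := hdeg (f x y) (fun h' => h (h' ▸ hc₀)) v x
      rw [totalDegree_eq_zero h, Set.ncard_eq_zero] at h3
      exact h3.subset ⟨hy, rfl⟩
    rw [← Finset.add_sum_erase _ _ hc₀] at h1 h2
    rw [Finset.sum_congr rfl fun c hc => hdeg c (Finset.mem_erase.1 hc).1 v x] at h2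
    omega
  · exact hdeg c hc v x

end

end ECPOG

lemma ZMod.intCast_ne_zero_of_abs_lt {n : ℕ} {a : ℤ} (h : a ≠ 0) (h' : |a| < n) :
    (a : ZMod n) ≠ 0 := fun h0 =>
  h (Int.eq_zero_of_abs_lt_dvd ((ZMod.intCast_zmod_eq_zero_iff_dvd a n).1 h0) h')

/-! ### Odd order: circulant factorizations -/

section Circulant

variable {m : ℕ}

/-- The vertices at cyclic distance `i` from `x` are `x - i` and `x + i`; they differ because `0 < 2
* i < 2 * m + 1`. -/
lemma isFactorization_circulant (m : ℕ) :
    IsFactorization (fun x y : ZMod (2 * m + 1) => (x - y).valMinAbs.natAbs)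
      (Finset.Icc 1 m) 2 := by
  refine ⟨fun x y _ => ?_, fun x y h => ?_, fun x i hi => ?_⟩
  · rw [← neg_sub, ZMod.natAbs_valMinAbs_neg]
  · have h1 := ZMod.natAbs_valMinAbs_le (x - y)
    have h2 : (x - y).valMinAbs ≠ 0 := by simpa [sub_eq_zero] using h
    rw [Finset.mem_Icc]
    omega
  · obtain ⟨h1, h2⟩ := Finset.mem_Icc.1 hi
    have hi0 : (i : ZMod (2 * m + 1)) ≠ 0 := by
      have := ZMod.intCast_ne_zero_of_abs_lt (n := 2 * m + 1) (a := i) (by omega)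
        (by rw [Nat.abs_cast]; omega)
      simpa using this
    have hii : (i : ZMod (2 * m + 1)) + i ≠ 0 := by
      have := ZMod.intCast_ne_zero_of_abs_lt (n := 2 * m + 1) (a := i + i) (by omega)
        (by rw [abs_of_nonneg (by omega)]; omega)
      simpa using this
    have hv : (i : ZMod (2 * m + 1)).valMinAbs.natAbs = i := by
      rw [(ZMod.valMinAbs_spec (i : ZMod (2 * m + 1)) i).2 ⟨by simp, ⟨by omega, by omega⟩⟩]
      simp
    have h3 : {y | y ≠ x ∧ (x - y).valMinAbs.natAbs = i} = {x - i, x + i} := by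
      ext y
      simp only [Set.mem_ofPred_eq, Set.mem_insert_iff, Set.mem_singleton_iff]
      have h4 := ZMod.natAbs_valMinAbs_eq_natAbs_valMinAbs (a := x - y)
        (b := (i : ZMod (2 * m + 1)))
      rw [hv] at h4
      rw [h4]
      constructor
      · rintro ⟨-, h | h⟩
        · left; rw [← h]; ring
        · right; linear_combination -h
      · rintro (rfl | rfl)
        · simp [hi0]
        · simp [hi0]
    rw [h3, Set.ncard_pair]
    intro h
    exact hii (by linear_combination -h)

/-- The third vertex lies one step from `x` in the direction of `y`, or two steps if `x` and `y` are
neighbors on the circle; the latter needs `2 ≤ K`. -/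
lemma circulant_exists_triangle {K : ℕ} (hK : 2 ≤ K) (hKm : K ≤ m) {x y : ZMod (2 * m + 1)}
    (hne : x ≠ y) (h : (x - y).valMinAbs.natAbs ≤ K) :
    ∃ z, z ≠ x ∧ z ≠ y ∧ (x - z).valMinAbs.natAbs ≤ K ∧ (y - z).valMinAbs.natAbs ≤ K := by
  set a := (x - y).valMinAbs with ha
  have ha0 : a ≠ 0 := by simpa [ha, sub_eq_zero] using hne
  have hax : (a : ZMod (2 * m + 1)) = x - y := by simp [ha]
  obtain ⟨b, hb0, hb, hab0, hab⟩ : ∃ b : ℤ, b ≠ 0 ∧ b.natAbs ≤ K ∧ b - a ≠ 0 ∧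
      (b - a).natAbs ≤ K := by
    rcases lt_trichotomy a 0 with h1 | h1 | h1
    · by_cases h2 : a = -1
      · exact ⟨-2, by omega, by omega, by omega, by omega⟩
      · exact ⟨-1, by omega, by omega, by omega, by omega⟩
    · exact (ha0 h1).elim
    · by_cases h2 : a = 1
      · exact ⟨2, by omega, by omega, by omega, by omega⟩
      · exact ⟨1, by omega, by omega, by omega, by omega⟩
  have key : ∀ b : ℤ, b ≠ 0 → b.natAbs ≤ K → (b : ZMod (2 * m + 1)).valMinAbs = b ∧
      (b : ZMod (2 * m + 1)) ≠ 0 := by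
    intro b h0 hb
    exact ⟨(ZMod.valMinAbs_spec _ b).2 ⟨rfl, ⟨by push_cast; omega, by push_cast; omega⟩⟩,
      ZMod.intCast_ne_zero_of_abs_lt h0 (by rw [Int.abs_eq_natAbs]; omega)⟩
  obtain ⟨h1, h2⟩ := key b hb0 hb
  obtain ⟨h3, h4⟩ := key (b - a) hab0 hab
  have h5 : y - (x - b) = ((b - a : ℤ) : ZMod (2 * m + 1)) := by
    push_cast
    rw [hax]
    ring
  refine ⟨x - b, by simpa using h2, fun h => h4 ?_, ?_, ?_⟩
  · rw [← h5, h, sub_self]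
  · rw [sub_sub_cancel, h1]
    exact hb
  · rw [h5, h3]
    exact hab

/-- The distances of `z` to `0` and to `m` add up to `m` or `m + 1`, according to the sign of the
representative of `z`. Two distances above `m - K` would add up to at least `2 * (m - K + 1) ≥ m +
2`. -/
lemma circulant_not_exists_triangle {K : ℕ} (hK : 2 * K ≤ m) (z : ZMod (2 * m + 1))
    (h : m - K < (0 - z).valMinAbs.natAbs) :
    ¬ m - K < ((m : ZMod (2 * m + 1)) - z).valMinAbs.natAbs := by
  intro h'
  rw [zero_sub, ZMod.natAbs_valMinAbs_neg] at h
  have hz := z.valMinAbs_mem_Ioc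
  set b := z.valMinAbs with hb
  have hbz : (b : ZMod (2 * m + 1)) = z := by simp [hb]
  obtain ⟨hz1, hz2⟩ := hz
  push_cast at hz1 hz2
  rcases le_or_gt 0 b with h0 | h0
  · have h1 : ((m : ZMod (2 * m + 1)) - z).valMinAbs = m - b :=
      (ZMod.valMinAbs_spec _ _).2 ⟨by push_cast; rw [hbz],
        ⟨by push_cast; omega, by push_cast; omega⟩⟩
    rw [h1] at h'
    omega
  · have h1 : ((m : ZMod (2 * m + 1)) - z).valMinAbs = m - b - (2 * m + 1) := by
      refine (ZMod.valMinAbs_spec _ _).2 ⟨?_, ⟨by push_cast; omega, by push_cast; omega⟩⟩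
      have h2 : ((2 * m + 1 : ℕ) : ZMod (2 * m + 1)) = 0 := ZMod.natCast_self _
      push_cast at h2 ⊢
      rw [hbz]
      linear_combination h2
    rw [h1] at h'
    omega

end Circulant

namespace ECPOG

universe u v

variable {V : Type u} {C : Type v} [Finite V] {G : ECPOG V C}

/-- An odd number of vertices and a set of colors of total degree `2K` with `2 ≤ K ≤ m / 2`. -/
theorem not_isParamUnique_of_circulants (hG : G.IsComplete) (hreg : G.IsColorRegular) {m : ℕ}
    (hV : Nat.card V = 2 * m + 1) {k : C → ℕ} (hk : ∀ c v, G.totalDegree c v = k c * 2)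
    {T : Finset C} (hT : T ⊆ G.colors) (h2 : 2 ≤ ∑ c ∈ T, k c) (hm : 2 * ∑ c ∈ T, k c ≤ m) :
    ¬ G.IsParamUnique := by
  intro huniq
  set K := ∑ c ∈ T, k c with hK
  have : Nonempty V := (Nat.card_pos_iff.1 (by omega)).1
  obtain ⟨c₀, -⟩ : T.Nonempty := by
    by_contra h
    rw [Finset.not_nonempty_iff_eq_empty] at h
    simp [h] at hK
    omega
  have : Nonempty C := ⟨c₀⟩
  have hcard : Nat.card V = Nat.card (ZMod (2 * m + 1)) := by rw [hV, Nat.card_zmod]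
  obtain ⟨f, hf, hfT⟩ := (isFactorization_circulant m).exists_isRecoloring hG two_pos hcard hk
    (S := Finset.Icc 1 K) (Finset.Icc_subset_Icc_right (by omega)) hT (by simp [hK])
  obtain ⟨g, hg, hgT⟩ := (isFactorization_circulant m).exists_isRecoloring hG two_pos hcard hk
    (S := Finset.Icc (m - K + 1) m) (Finset.Icc_subset_Icc_left (by omega)) hT (by
      rw [← hK, Nat.card_Icc]; omega)
  obtain ⟨σ, hσ⟩ := huniq.exists_equiv hG hreg hg hf
  have hmem := (isFactorization_circulant m).mem
  have hfT' : ∀ x y : ZMod (2 * m + 1), x ≠ y →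
      (f (x - y).valMinAbs.natAbs ∈ T ↔ (x - y).valMinAbs.natAbs ≤ K) := by
    intro x y hxy
    have h1 := hmem x y hxy
    rw [hfT _ h1]
    rw [Finset.mem_Icc] at h1 ⊢
    tauto
  have hgT' : ∀ x y : ZMod (2 * m + 1), x ≠ y →
      (g (x - y).valMinAbs.natAbs ∈ T ↔ m - K < (x - y).valMinAbs.natAbs) := by
    intro x y hxy
    have h1 := hmem x y hxy
    rw [hgT _ h1]
    rw [Finset.mem_Icc] at h1 ⊢
    omega
  have hm0 : (0 : ZMod (2 * m + 1)) ≠ m := by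
    have := ZMod.intCast_ne_zero_of_abs_lt (n := 2 * m + 1) (a := m) (by omega)
        (by rw [Nat.abs_cast]; omega)
    exact fun h => this (by simpa using h.symm)
  have h0m : m - K < ((0 : ZMod (2 * m + 1)) - m).valMinAbs.natAbs := by
    rw [zero_sub, ZMod.natAbs_valMinAbs_neg,
      (ZMod.valMinAbs_spec (m : ZMod (2 * m + 1)) m).2 ⟨by simp, ⟨by omega, by omega⟩⟩]
    omega
  -- The edge from `0` to `m` has a color of `T` in the coloring by long distances. Its image lies
  -- in a triangle with colors in `T`, which `σ` pulls back.
  have h1 := (hgT' _ _ hm0).2 h0m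
  rw [← hσ _ _ hm0, hfT' _ _ (σ.injective.ne hm0)] at h1
  obtain ⟨z, hz1, hz2, hz3, hz4⟩ := circulant_exists_triangle h2 (by omega) (σ.injective.ne hm0) h1
  obtain ⟨z, rfl⟩ := σ.surjective z
  rw [σ.injective.ne_iff] at hz1 hz2
  rw [← hfT' _ _ (σ.injective.ne hz1.symm), hσ _ _ hz1.symm, hgT' _ _ hz1.symm] at hz3
  rw [← hfT' _ _ (σ.injective.ne hz2.symm), hσ _ _ hz2.symm, hgT' _ _ hz2.symm] at hz4
  exact circulant_not_exists_triangle hm z hz3 hz4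

end ECPOG

/-! ### Even order: one-factorizations with and without triangles -/

section OneFactorizations

/-- The standard one-factorization of the complete graph on `A` and one more point. -/
def pointedSum {A : Type*} [Add A] [Zero A] : Option A → Option A → A
  | none, none => 0
  | none, some x => x + x
  | some x, none => x + x
  | some x, some y => x + y

/-- In class `c` the partner of `x` is `c - x`. This fails only for the unique half of `c`, which is
matched with the extra point instead. -/
lemma isFactorization_pointedSum {A : Type*} [AddCommGroup A] [Fintype A]
    (hA : Function.Bijective fun x : A => x + x) :
    IsFactorization (pointedSum (A := A)) Finset.univ 1 := by
  refine ⟨fun x y _ => ?_, fun _ _ _ => Finset.mem_univ _, fun x c _ => ?_⟩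
  · cases x <;> cases y <;> simp [pointedSum, add_comm]
  · rw [Set.ncard_eq_one]
    obtain ⟨d, rfl⟩ := hA.2 c
    rcases x with _ | x
    · refine ⟨some d, Set.ext fun y => ?_⟩
      rcases y with _ | y
      · simp
      · simpa [pointedSum] using hA.1.eq_iff
    · by_cases hx : x = d
      · subst hx
        refine ⟨none, Set.ext fun y => ?_⟩
        rcases y with _ | y
        · simp [pointedSum]
        · simp [pointedSum]
      · refine ⟨some (d + d - x), Set.ext fun y => ?_⟩
        rcases y with _ | y
        · simpa [pointedSum] using fun h => hx (hA.1 h)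
        · simp only [ne_eq, Option.some.injEq, pointedSum, Set.mem_ofPred_eq,
            Set.mem_singleton_iff]
          constructor
          · rintro ⟨-, h⟩
            rw [← h]
            abel
          · rintro rfl
            refine ⟨fun h => hx (hA.1 ?_), by abel⟩
            simp only
            nth_rw 1 [← h]
            abel

lemma ZMod.bijective_add_self {q : ℕ} (hq : Odd q) :
    Function.Bijective fun x : ZMod q => x + x := by
  have : NeZero q := ⟨by rintro rfl; simp at hq⟩
  rw [Finite.injective_iff_bijective.symm]
  intro x y h
  have h2 : IsUnit ((2 : ℕ) : ZMod q) :=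
    (ZMod.isUnit_iff_coprime 2 q).2 (Nat.coprime_two_left.2 hq)
  refine h2.mul_left_cancel ?_
  push_cast
  simpa [two_mul] using h

/-- For odd `m`, a one-factorization of the complete graph on two copies of `ℤ/m` that contains
a factorization of the complete bipartite graph without a perfect matching. -/
def twoCopiesSum {m : ℕ} (x y : ZMod m × Bool) : ZMod m ⊕ ZMod m :=
  if x.2 ≠ y.2 ∧ x.1 ≠ y.1 then Sum.inr (if x.2 then x.1 - y.1 else y.1 - x.1)
  else Sum.inl (x.1 + y.1)

/-- For odd `m` the class `x + y = c` in one copy of `ℤ/m` misses only the half of `c`. The two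
missed vertices, one per copy, are joined to each other. This uses up the edges of difference `0`
between the copies; the `m - 1` nonzero differences remain as bipartite classes. -/
lemma exists_bipartite_factorization_of_odd {m : ℕ} (hm : Odd m) :
    ∃ (F : ZMod m × Bool → ZMod m × Bool → ZMod m ⊕ ZMod m) (s S : Finset (ZMod m ⊕ ZMod m)),
      IsFactorization F s 1 ∧ S ⊆ s ∧ m - 1 ≤ S.card ∧ ∀ x y, x ≠ y → F x y ∈ S → x.2 ≠ y.2 := by
  classical
  have : NeZero m := ⟨by rintro rfl; simp at hm⟩
  have hA := ZMod.bijective_add_self hm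
  let S : Finset (ZMod m ⊕ ZMod m) := (Finset.univ.erase 0).map Function.Embedding.inr
  have hS : ∀ c, Sum.inr c ∈ S ↔ c ≠ 0 := fun c => by simp [S]
  have hS' : ∀ c, Sum.inl c ∉ S := fun c => by simp [S]
  refine ⟨twoCopiesSum, Finset.univ.map Function.Embedding.inl ∪ S, S, ⟨?_, ?_, ?_⟩,
    Finset.subset_union_right, ?_, ?_⟩
  · rintro ⟨x, a⟩ ⟨y, b⟩ -
    rcases eq_or_ne x y with rfl | h
    · simp [twoCopiesSum]
    · cases a <;> cases b <;> simp [twoCopiesSum, h, h.symm, add_comm]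
  · rintro ⟨x, a⟩ ⟨y, b⟩ -
    by_cases h : a ≠ b ∧ x ≠ y
    · refine Finset.mem_union_right _ ?_
      rw [twoCopiesSum, if_pos h, hS]
      cases a <;> simp [sub_eq_zero, h.2, h.2.symm]
    · refine Finset.mem_union_left _ ?_
      rw [twoCopiesSum, if_neg h]
      simp
  · rintro ⟨x, a⟩ c hc
    rw [Set.ncard_eq_one]
    rcases c with c | c
    · by_cases hx : c = x + x
      · refine ⟨(x, !a), Set.ext fun ⟨y, b⟩ => ?_⟩
        simp only [Set.mem_ofPred_eq, Set.mem_singleton_iff, Prod.mk.injEq, twoCopiesSum, hx, ne_eq]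
        rcases eq_or_ne x y with rfl | h
        · cases a <;> cases b <;> simp
        · cases a <;> cases b <;> simp [h, h.symm]
      · refine ⟨(c - x, a), Set.ext fun ⟨y, b⟩ => ?_⟩
        simp only [Set.mem_ofPred_eq, Set.mem_singleton_iff, Prod.mk.injEq, twoCopiesSum, ne_eq]
        rcases eq_or_ne x y with rfl | h
        · have h1 : x ≠ c - x := fun h => hx (by linear_combination -h)
          have h2 : x + x ≠ c := fun h => hx h.symm
          cases a <;> cases b <;> simp [h1, h2]
        · have h1 : x + y = c ↔ y = c - x := by rw [eq_sub_iff_add_eq, add_comm]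
          cases a <;> cases b <;> simp [h, h.symm, h1]
    · have hc0 : c ≠ 0 := by
        rw [Finset.mem_union, hS] at hc
        simpa using hc
      refine ⟨(if a then x - c else x + c, !a), Set.ext fun ⟨y, b⟩ => ?_⟩
      simp only [Set.mem_ofPred_eq, Set.mem_singleton_iff, Prod.mk.injEq, twoCopiesSum, ne_eq]
      have h1 : x - y = c ↔ y = x - c := by
        constructor <;> intro h <;> linear_combination -h
      have h2 : y - x = c ↔ y = x + c := by
        constructor <;> intro h <;> linear_combination h
      rcases eq_or_ne x y with rfl | h
      · have h3 : x ≠ x - c := fun h => hc0 (by linear_combination h)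
        cases a <;> cases b <;> simp [hc0, h3]
      · cases a <;> cases b <;> simp [h, h.symm, h1, h2]
  · simp [S, ZMod.card]
  · rintro ⟨x, a⟩ ⟨y, b⟩ - h
    by_contra hab
    rw [twoCopiesSum, if_neg (fun h => h.1 hab)] at h
    exact hS' _ h

/-- For even `m` each side carries a one-factorization of its own, by sums in `ℤ/(m - 1)` with an
extra point, and the `m` differences factor the edges between the sides. -/
lemma exists_bipartite_factorization_of_even {m : ℕ} (hm : Even m) (hm0 : 0 < m) :
    ∃ (F : ZMod m × Bool → ZMod m × Bool → ZMod (m - 1) ⊕ ZMod m)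
      (s S : Finset (ZMod (m - 1) ⊕ ZMod m)),
      IsFactorization F s 1 ∧ S ⊆ s ∧ m - 1 ≤ S.card ∧ ∀ x y, x ≠ y → F x y ∈ S → x.2 ≠ y.2 := by
  classical
  have hq : Odd (m - 1) := Nat.Even.sub_odd hm0 hm odd_one
  have : NeZero m := ⟨hm0.ne'⟩
  have : NeZero (m - 1) := ⟨fun h => by simp [h] at hq⟩
  have hP := isFactorization_pointedSum (ZMod.bijective_add_self hq)
  have hcard : Nat.card (ZMod m) = Nat.card (Option (ZMod (m - 1))) := by
    rw [Finite.card_option, Nat.card_zmod, Nat.card_zmod]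
    omega
  obtain ⟨e⟩ := Finite.card_eq.1 hcard
  let F : ZMod m × Bool → ZMod m × Bool → ZMod (m - 1) ⊕ ZMod m := fun x y =>
    if x.2 = y.2 then Sum.inl (pointedSum (e x.1) (e y.1))
    else Sum.inr (if x.2 then x.1 - y.1 else y.1 - x.1)
  refine ⟨F, Finset.univ, Finset.univ.map Function.Embedding.inr, ⟨?_, fun _ _ _ =>
    Finset.mem_univ _, ?_⟩, Finset.subset_univ _, ?_, ?_⟩
  · rintro ⟨x, a⟩ ⟨y, b⟩ hne
    by_cases hab : a = b
    · subst hab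
      have hxy : x ≠ y := fun h => hne (by rw [h])
      simp only [F, if_true]
      rw [hP.symm _ _ (e.injective.ne hxy)]
    · cases a <;> cases b <;> simp_all [F]
  · rintro ⟨x, a⟩ c -
    rw [Set.ncard_eq_one]
    rcases c with c | c
    · obtain ⟨z, hz⟩ := Set.ncard_eq_one.1 (hP.deg (e x) c (Finset.mem_univ _))
      refine ⟨(e.symm z, a), Set.ext fun ⟨y, b⟩ => ?_⟩
      have h1 : (e y ≠ e x ∧ pointedSum (e x) (e y) = c) ↔ e y = z := Set.ext_iff.1 hz (e y)
      rw [e.injective.ne_iff] at h1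
      simp only [Set.mem_ofPred_eq, Set.mem_singleton_iff, Prod.mk.injEq, F, Equiv.eq_symm_apply,
        ← h1]
      cases a <;> cases b <;> simp
    · refine ⟨(if a then x - c else x + c, !a), Set.ext fun ⟨y, b⟩ => ?_⟩
      have h1 : x - y = c ↔ y = x - c := by
        constructor <;> intro h <;> linear_combination -h
      have h2 : y - x = c ↔ y = x + c := by
        constructor <;> intro h <;> linear_combination h
      simp only [Set.mem_ofPred_eq, Set.mem_singleton_iff, Prod.mk.injEq, F]
      cases a <;> cases b <;> simp [h1, h2]
  · simp [ZMod.card]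
  · rintro ⟨x, a⟩ ⟨y, b⟩ - h
    by_contra hab
    obtain rfl : a = b := hab
    simp [F] at h

end OneFactorizations

namespace ECPOG

universe u v

variable {V : Type u} {C : Type v} [Finite V] {G : ECPOG V C}

/-- Colors of total degree at least `3` can be made to contain a triangle, and colors of total
degree at most `m - 1` can be made bipartite. -/
lemma not_isParamUnique_of_bipartite (hG : G.IsComplete) (hreg : G.IsColorRegular) {m : ℕ}
    (hV : Nat.card V = 2 * m) {T : Finset C} (hT : T ⊆ G.colors) {d : C → ℕ}
    (hd : ∀ c v, G.totalDegree c v = d c) (h3 : 3 ≤ ∑ c ∈ T, d c) (hm : ∑ c ∈ T, d c ≤ m - 1)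
    {I : Type*} {F : ZMod m × Bool → ZMod m × Bool → I} {s S : Finset I}
    (hF : IsFactorization F s 1) (hS : S ⊆ s) (hSm : m - 1 ≤ S.card)
    (hside : ∀ x y, x ≠ y → F x y ∈ S → x.2 ≠ y.2) : ¬ G.IsParamUnique := by
  intro huniq
  have hq : Odd (2 * m - 1) := Nat.Even.sub_odd (by omega) (even_two_mul m) odd_one
  have : NeZero (2 * m - 1) := ⟨fun h => by simp [h] at hq⟩
  have : NeZero m := ⟨by omega⟩
  have : Nonempty V := (Nat.card_pos_iff.1 (by omega)).1
  obtain ⟨c₀, -⟩ : T.Nonempty := by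
    by_contra h
    rw [Finset.not_nonempty_iff_eq_empty] at h
    simp [h] at h3
  have : Nonempty C := ⟨c₀⟩
  have hd' : ∀ c v, G.totalDegree c v = d c * 1 := fun c v => by rw [hd, mul_one]
  have hcard₁ : Nat.card V = Nat.card (Option (ZMod (2 * m - 1))) := by
    rw [hV, Finite.card_option, Nat.card_zmod]
    omega
  have hcard₂ : Nat.card V = Nat.card (ZMod m × Bool) := by
    rw [hV, Nat.card_prod, Nat.card_zmod]
    simp [mul_comm]
  have h10 : (1 : ZMod (2 * m - 1)) ≠ 0 := by
    simpa using ZMod.intCast_ne_zero_of_abs_lt (n := 2 * m - 1) (a := 1) (by omega)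
      (by rw [abs_of_nonneg (by omega)]; omega)
  -- The extra point, `0` and `1` span a triangle whose edges lie in the classes `0`, `1` and `1 +
  -- 1`.
  obtain ⟨S₁, hS₁, -, hS₁c⟩ := Finset.exists_subsuperset_card_eq
    (s := ({0, 1, 1 + 1} : Finset (ZMod (2 * m - 1)))) (t := Finset.univ) (n := ∑ c ∈ T, d c)
    (Finset.subset_univ _) (Finset.card_le_three.trans h3)
    (by rw [Finset.card_univ, ZMod.card]; omega)
  obtain ⟨S₂, hS₂, hS₂c⟩ := Finset.exists_subset_card_eq (hm.trans hSm)
  obtain ⟨f, hf, hfT⟩ := (isFactorization_pointedSum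
    (ZMod.bijective_add_self hq)).exists_isRecoloring hG one_pos hcard₁ hd'
    (Finset.subset_univ _) hT hS₁c.symm
  obtain ⟨g, hg, hgT⟩ := hF.exists_isRecoloring hG one_pos hcard₂ hd' (hS₂.trans hS) hT hS₂c.symm
  obtain ⟨σ, hσ⟩ := huniq.exists_equiv hG hreg hf hg
  have key : ∀ x y, x ≠ y → pointedSum x y ∈ S₁ → (σ x).2 ≠ (σ y).2 := by
    intro x y hxy h
    have h1 := (hfT _ (Finset.mem_univ _)).2 h
    rw [← hσ _ _ hxy, hgT _ (hF.mem _ _ (σ.injective.ne hxy))] at h1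
    exact hside _ _ (σ.injective.ne hxy) (hS₂ h1)
  -- The three vertices of the triangle would have to lie on pairwise different sides, of which
  -- there are two.
  have h1 := key none (some 0) (by simp) (hS₁ (by simp [pointedSum]))
  have h2 := key none (some 1) (by simp) (hS₁ (by simp [pointedSum]))
  have h3 := key (some 0) (some 1) (by simpa using h10.symm) (hS₁ (by simp [pointedSum]))
  revert h1 h2 h3
  generalize (σ none).2 = a
  generalize (σ (some 0)).2 = b
  generalize (σ (some 1)).2 = c
  revert a b c
  decide

/-- An even number of vertices and a set of colors of total degree between `3` and `m - 1`. -/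
theorem not_isParamUnique_of_one_factorizations (hG : G.IsComplete) (hreg : G.IsColorRegular)
    {m : ℕ} (hV : Nat.card V = 2 * m) {T : Finset C} (hT : T ⊆ G.colors) {d : C → ℕ}
    (hd : ∀ c v, G.totalDegree c v = d c) (h3 : 3 ≤ ∑ c ∈ T, d c)
    (hm : ∑ c ∈ T, d c ≤ m - 1) : ¬ G.IsParamUnique := by
  rcases Nat.even_or_odd m with hme | hmo
  · obtain ⟨F, s, S, hF, hS, hSm, hside⟩ := exists_bipartite_factorization_of_even hme (by omega)
    exact not_isParamUnique_of_bipartite hG hreg hV hT hd h3 hm hF hS hSm hside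
  · obtain ⟨F, s, S, hF, hS, hSm, hside⟩ := exists_bipartite_factorization_of_odd hmo
    exact not_isParamUnique_of_bipartite hG hreg hV hT hd h3 hm hF hS hSm hside

end ECPOG

/-! ### Non-uniqueness with one dominant color -/

section SmallDegree

variable {W W' C : Type*}

/-- Adjacency in a cycle. -/
def cycleRel (n : ℕ) (x y : ZMod n) : Prop := x - y = 1 ∨ y - x = 1

lemma ZMod.natCast_ne_zero_of_lt {n a : ℕ} (h : 0 < a) (h' : a < n) : (a : ZMod n) ≠ 0 := by
  simpa using ZMod.intCast_ne_zero_of_abs_lt (n := n) (a := a) (by omega)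
    (by rw [Nat.abs_cast]; omega)

lemma ncard_cycleRel {n : ℕ} (hn : 3 ≤ n) (x : ZMod n) : {y | cycleRel n x y}.ncard = 2 := by
  have h2 : (2 : ZMod n) ≠ 0 := by
    simpa using ZMod.natCast_ne_zero_of_lt (n := n) two_pos (by omega)
  have h : {y | cycleRel n x y} = {x - 1, x + 1} := by
    ext y
    simp only [cycleRel, Set.mem_ofPred_eq, Set.mem_insert_iff, Set.mem_singleton_iff]
    refine or_congr ⟨fun h => ?_, fun h => ?_⟩ ⟨fun h => ?_, fun h => ?_⟩
    exacts [by linear_combination -h, by linear_combination -h, by linear_combination h,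
      by linear_combination h]
  rw [h, Set.ncard_pair]
  exact fun h => h2 (by linear_combination -h)

lemma ncard_liftRel_inl {R : W → W → Prop} {S : W' → W' → Prop} (x : W) :
    {y | Sum.LiftRel R S (Sum.inl x) y}.ncard = {y | R x y}.ncard := by
  rw [← Set.ncard_image_of_injective _ (Sum.inl_injective (α := W) (β := W'))]
  congr 1
  ext y
  rcases y with y | y <;> simp

lemma ncard_liftRel_inr {R : W → W → Prop} {S : W' → W' → Prop} (x : W') :
    {y | Sum.LiftRel R S (Sum.inr x) y}.ncard = {y | S x y}.ncard := by
  rw [← Set.ncard_image_of_injective _ (Sum.inr_injective (α := W) (β := W'))]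
  congr 1
  ext y
  rcases y with y | y <;> simp

namespace ECPOG

universe u v

variable {V : Type u} {C : Type v} [Finite V] {G : ECPOG V C}

lemma isRecoloring_ite [Finite W] (hG : G.IsComplete) {a b : C} (hab : a ≠ b)
    (hcol : (G.colors : Set C) = {a, b}) (hcard : Nat.card V = Nat.card W) {X : W → W → Prop}
    [DecidableRel X] (hsymm : ∀ x y, X x y → X y x) (hirr : ∀ x, ¬ X x x)
    (hX : ∀ v x, {y | X x y}.ncard = G.totalDegree a v) :
    IsRecoloring G fun x y => if X x y then a else b := by
  have hb : b ∈ G.colors := by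
    rw [← Finset.mem_coe, hcol]
    simp
  refine isRecoloring_of_forall_ne hG hcard (fun x y _ => ?_) hb fun c hcb v x => ?_
  · have : X x y ↔ X y x := ⟨hsymm _ _, hsymm _ _⟩
    simp only [this]
  · by_cases hca : c = a
    · subst hca
      rw [← hX v x]
      congr 1
      ext y
      simp only [Set.mem_ofPred_eq]
      constructor
      · rintro ⟨-, h⟩
        by_contra h'
        rw [if_neg h'] at h
        exact hab h.symm
      · intro h
        exact ⟨by rintro rfl; exact hirr _ h, if_pos h⟩
    · rw [totalDegree_eq_zero (by rw [← Finset.mem_coe, hcol]; simp [hca, hcb])]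
      convert Set.ncard_empty W
      refine Set.eq_empty_iff_forall_notMem.2 fun y hy => ?_
      have h := hy.2
      split_ifs at h
      exacts [hca h.symm, hcb h.symm]

lemma isRecoloring_ite_ite [Finite W] (hG : G.IsComplete) {a b c : C} (hab : a ≠ b) (hac : a ≠ c)
    (hbc : b ≠ c) (hcol : (G.colors : Set C) = {a, b, c}) (hcard : Nat.card V = Nat.card W)
    {X Y : W → W → Prop} [DecidableRel X] [DecidableRel Y] (hXs : ∀ x y, X x y → X y x)
    (hYs : ∀ x y, Y x y → Y y x)
    (hXirr : ∀ x, ¬ X x x) (hYirr : ∀ x, ¬ Y x x) (hXY : ∀ x y, X x y → ¬ Y x y)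
    (hX : ∀ v x, {y | X x y}.ncard = G.totalDegree a v)
    (hY : ∀ v x, {y | Y x y}.ncard = G.totalDegree b v) :
    IsRecoloring G fun x y => if X x y then a else if Y x y then b else c := by
  have hc : c ∈ G.colors := by
    rw [← Finset.mem_coe, hcol]
    simp
  refine isRecoloring_of_forall_ne hG hcard (fun x y _ => ?_) hc fun d hdc v x => ?_
  · have h1 : X x y ↔ X y x := ⟨hXs _ _, hXs _ _⟩
    have h2 : Y x y ↔ Y y x := ⟨hYs _ _, hYs _ _⟩
    simp only [h1, h2]
  · by_cases hda : d = a
    · subst hda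
      rw [← hX v x]
      congr 1
      ext y
      simp only [Set.mem_ofPred_eq]
      constructor
      · rintro ⟨-, h⟩
        by_contra h'
        rw [if_neg h'] at h
        split_ifs at h
        exacts [hab h.symm, hac h.symm]
      · intro h
        exact ⟨by rintro rfl; exact hXirr _ h, if_pos h⟩
    by_cases hdb : d = b
    · subst hdb
      rw [← hY v x]
      congr 1
      ext y
      simp only [Set.mem_ofPred_eq]
      constructor
      · rintro ⟨-, h⟩
        by_contra h'
        split_ifs at h
        exacts [hab h, hbc h.symm]
      · intro h
        exact ⟨by rintro rfl; exact hYirr _ h, by rw [if_neg fun h' => hXY _ _ h' h, if_pos h]⟩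
    · rw [totalDegree_eq_zero (by rw [← Finset.mem_coe, hcol]; simp [hda, hdb, hdc])]
      convert Set.ncard_empty W
      refine Set.eq_empty_iff_forall_notMem.2 fun y hy => ?_
      have h := hy.2
      split_ifs at h
      exacts [hda h.symm, hdb h.symm, hdc h.symm]

/-- Two colors, one of which has degree `2`. -/
theorem not_isParamUnique_of_cycles (hG : G.IsComplete) (hreg : G.IsColorRegular) {n : ℕ}
    (hn : 6 ≤ n) (hV : Nat.card V = n) {a b : C} (hab : a ≠ b)
    (hcol : (G.colors : Set C) = {a, b}) (ha : ∀ v, G.totalDegree a v = 2) :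
    ¬ G.IsParamUnique := by
  classical
  intro huniq
  have : NeZero n := ⟨by omega⟩
  have : NeZero (n - 3) := ⟨by omega⟩
  have hirr : ∀ p, 2 ≤ p → ∀ x, ¬ cycleRel p x x := fun p hp x h => by
    have := ZMod.natCast_ne_zero_of_lt (n := p) one_pos (by omega)
    simp only [cycleRel, sub_self, or_self] at h
    exact this (by simpa using h.symm)
  have hf := isRecoloring_ite (W := ZMod n) hG hab hcol (by rw [hV, Nat.card_zmod])
    (X := cycleRel n) (fun x y h => h.symm) (hirr n (by omega))
    fun v x => by rw [ncard_cycleRel (by omega), ha]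
  -- The competitor of the cycle of length `n` is a triangle together with a cycle of length `n -
  -- 3`; the latter needs `6 ≤ n`.
  have hg := isRecoloring_ite (W := ZMod 3 ⊕ ZMod (n - 3)) hG hab hcol
    (by rw [hV, Nat.card_sum, Nat.card_zmod, Nat.card_zmod]; omega)
    (X := Sum.LiftRel (cycleRel 3) (cycleRel (n - 3)))
    (by
      rintro (x | x) (y | y) h <;> simp only [Sum.liftRel_inl_inl, Sum.liftRel_inr_inr,
        Sum.not_liftRel_inl_inr, Sum.not_liftRel_inr_inl] at h ⊢ <;> exact h.symm)
    (by
      rintro (x | x) <;> simp only [Sum.liftRel_inl_inl, Sum.liftRel_inr_inr]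
      exacts [hirr 3 (by omega) x, hirr (n - 3) (by omega) x])
    (by
      rintro v (x | x)
      · rw [ncard_liftRel_inl, ncard_cycleRel le_rfl, ha]
      · rw [ncard_liftRel_inr, ncard_cycleRel (by omega), ha])
  obtain ⟨σ, hσ⟩ := huniq.exists_equiv hG hreg hg hf
  have key : ∀ x y : ZMod 3, x ≠ y → cycleRel 3 x y →
      cycleRel n (σ (Sum.inl x)) (σ (Sum.inl y)) := by
    intro x y hxy h
    have h1 := hσ (Sum.inl x) (Sum.inl y) (by simpa using hxy)
    simp only [Sum.liftRel_inl_inl, h, if_true] at h1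
    by_contra h2
    rw [if_neg h2] at h1
    exact hab h1.symm
  have h1 := key 0 1 (by decide) (by unfold cycleRel; decide)
  have h2 := key 1 2 (by decide) (by unfold cycleRel; decide)
  have h3 := key 2 0 (by decide) (by unfold cycleRel; decide)
  have hone : (1 : ZMod n) ≠ 0 := by
    simpa using ZMod.natCast_ne_zero_of_lt (n := n) one_pos (by omega)
  have hthree : (3 : ZMod n) ≠ 0 := by
    simpa using ZMod.natCast_ne_zero_of_lt (n := n) (a := 3) (by omega) (by omega)
  -- Around the image of the triangle a sum of three signs vanishes in `ZMod n`, so `3 = 0` or `1 =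
  -- 0`.
  rcases h1 with h1 | h1 <;> rcases h2 with h2 | h2 <;> rcases h3 with h3 | h3
  · exact hthree (by linear_combination -h1 - h2 - h3)
  · exact hone (by linear_combination -h1 - h2 + h3)
  · exact hone (by linear_combination -h1 + h2 - h3)
  · exact hone (by linear_combination h1 - h2 - h3)
  · exact hone (by linear_combination h1 - h2 - h3)
  · exact hone (by linear_combination -h1 + h2 - h3)
  · exact hone (by linear_combination -h1 - h2 + h3)
  · exact hthree (by linear_combination -h1 - h2 - h3)

lemma ncard_sum_eq {n : ℕ} (x s : ZMod n) : {y | x + y = s}.ncard = 1 := by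
  rw [Set.ncard_eq_one]
  refine ⟨s - x, Set.ext fun y => ?_⟩
  simp only [Set.mem_ofPred_eq, Set.mem_singleton_iff]
  constructor <;> intro h <;> linear_combination h

/-- Reduction modulo `2` makes the left side zero. Hence the relations `x + y = 1` and `x + y = 3`
are irreflexive on every `ℤ/n` with `n` even. -/
lemma add_self_ne_of_even {n k : ℕ} (hn : Even n) (hk : Odd k) (x : ZMod n) :
    x + x ≠ (k : ZMod n) := by
  intro h
  have h1 := congrArg (ZMod.castHom hn.two_dvd (ZMod 2)) h
  rw [map_add, map_natCast, (ZMod.natCast_eq_one_iff_odd).2 hk] at h1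
  revert h1
  generalize (ZMod.castHom hn.two_dvd (ZMod 2)) x = z
  revert z
  decide

/-- Three colors, two of which have degree `1`. -/
theorem not_isParamUnique_of_two_matchings (hG : G.IsComplete) (hreg : G.IsColorRegular) {n : ℕ}
    (hn : 8 ≤ n) (hne : Even n) (hV : Nat.card V = n) {a b c : C} (hab : a ≠ b) (hac : a ≠ c)
    (hbc : b ≠ c) (hcol : (G.colors : Set C) = {a, b, c}) (ha : ∀ v, G.totalDegree a v = 1)
    (hb : ∀ v, G.totalDegree b v = 1) : ¬ G.IsParamUnique := by
  classical
  intro huniq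
  have : NeZero n := ⟨by omega⟩
  have : NeZero (n - 4) := ⟨by omega⟩
  have hne4 : Even (n - 4) := by
    rw [Nat.even_sub (by omega)]
    exact iff_of_true hne (by decide)
  have h1irr : ∀ p, Even p → ∀ x : ZMod p, ¬ x + x = 1 := fun p hp x => by
    simpa using add_self_ne_of_even hp odd_one x
  have h3irr : ∀ p, Even p → ∀ x : ZMod p, ¬ x + x = 3 := fun p hp x => by
    simpa using add_self_ne_of_even (k := 3) hp (by decide) x
  have hdisj : ∀ p, 4 ≤ p → ∀ x y : ZMod p, x + y = 1 → ¬ x + y = 3 := fun p hp x y h h' => by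
    have : (2 : ZMod p) ≠ 0 := by
      simpa using ZMod.natCast_ne_zero_of_lt (n := p) two_pos (by omega)
    exact this (by linear_combination h - h')
  -- Applying the matchings `x + y = 1` and `x + y = 3` in turn moves `x` to `x + 2`, so their union
  -- is a cycle through all of `ZMod n`. The competitor has an alternating cycle of length four.
  have hf := isRecoloring_ite_ite (W := ZMod n) hG hab hac hbc hcol (by rw [hV, Nat.card_zmod])
    (X := fun x y => x + y = 1) (Y := fun x y => x + y = 3) (fun x y h => by rw [add_comm, h])
    (fun x y h => by rw [add_comm, h]) (h1irr n hne) (h3irr n hne) (hdisj n (by omega))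
    (fun v x => by rw [ncard_sum_eq, ha]) (fun v x => by rw [ncard_sum_eq, hb])
  have hg := isRecoloring_ite_ite (W := ZMod 4 ⊕ ZMod (n - 4)) hG hab hac hbc hcol
    (by rw [hV, Nat.card_sum, Nat.card_zmod, Nat.card_zmod]; omega)
    (X := Sum.LiftRel (fun x y => x + y = 1) (fun x y => x + y = 1))
    (Y := Sum.LiftRel (fun x y => x + y = 3) (fun x y => x + y = 3))
    (by rintro (x | x) (y | y) h <;> simp_all [add_comm])
    (by rintro (x | x) (y | y) h <;> simp_all [add_comm])
    (by
      rintro (x | x) <;> simp only [Sum.liftRel_inl_inl, Sum.liftRel_inr_inr]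
      exacts [h1irr 4 (by decide) x, h1irr (n - 4) hne4 x])
    (by
      rintro (x | x) <;> simp only [Sum.liftRel_inl_inl, Sum.liftRel_inr_inr]
      exacts [h3irr 4 (by decide) x, h3irr (n - 4) hne4 x])
    (by
      rintro (x | x) (y | y) <;> simp only [Sum.liftRel_inl_inl, Sum.liftRel_inr_inr,
        Sum.not_liftRel_inl_inr, Sum.not_liftRel_inr_inl, not_false_eq_true, implies_true]
      exacts [hdisj 4 le_rfl x y, hdisj (n - 4) (by omega) x y])
    (by
      rintro v (x | x)
      · rw [ncard_liftRel_inl, ncard_sum_eq, ha]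
      · rw [ncard_liftRel_inr, ncard_sum_eq, ha])
    (by
      rintro v (x | x)
      · rw [ncard_liftRel_inl, ncard_sum_eq, hb]
      · rw [ncard_liftRel_inr, ncard_sum_eq, hb])
  obtain ⟨σ, hσ⟩ := huniq.exists_equiv hG hreg hg hf
  have key1 : ∀ x y : ZMod 4, x ≠ y → x + y = 1 → σ (Sum.inl x) + σ (Sum.inl y) = 1 := by
    intro x y hxy h
    have h1 := hσ (Sum.inl x) (Sum.inl y) (by simpa using hxy)
    simp only [Sum.liftRel_inl_inl, h, if_true] at h1
    by_contra h2
    rw [if_neg h2] at h1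
    split_ifs at h1
    exacts [hab h1.symm, hac h1.symm]
  have key3 : ∀ x y : ZMod 4, x ≠ y → x + y = 3 → σ (Sum.inl x) + σ (Sum.inl y) = 3 := by
    intro x y hxy h
    have h1 := hσ (Sum.inl x) (Sum.inl y) (by simpa using hxy)
    simp only [Sum.liftRel_inl_inl, h, if_true] at h1
    rw [if_neg (by decide : ¬ (3 : ZMod 4) = 1)] at h1
    by_contra h2
    rw [if_neg h2] at h1
    split_ifs at h1
    exacts [hab h1, hbc h1.symm]
  have h1 := key1 0 1 (by decide) (by decide)
  have h2 := key3 1 2 (by decide) (by decide)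
  have h3 := key1 2 3 (by decide) (by decide)
  have h4 := key3 3 0 (by decide) (by decide)
  have hfour : (4 : ZMod n) ≠ 0 := by
    simpa using ZMod.natCast_ne_zero_of_lt (n := n) (a := 4) (by omega) (by omega)
  -- The alternating sum around the image of the 4-cycle telescopes to zero on the left and gives `1
  -- - 3 + 1 - 3 = -4` on the right.
  exact hfour (by linear_combination h1 - h2 + h3 - h4)

end ECPOG

end SmallDegree

/-! ### Non-uniqueness on six and seven vertices -/

section Tables

/-- A 2-factorization of the complete graph on seven vertices, one of whose factors contains a
triangle. -/
def sevenTable : Fin 7 → Fin 7 → Fin 3 :=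
  ![![0, 0, 0, 1, 2, 2, 1],
    ![0, 0, 0, 2, 1, 1, 2],
    ![0, 0, 0, 2, 1, 2, 1],
    ![1, 2, 2, 0, 0, 1, 0],
    ![2, 1, 1, 0, 0, 0, 2],
    ![2, 1, 2, 1, 0, 0, 0],
    ![1, 2, 1, 0, 2, 0, 0]]

lemma isFactorization_sevenTable : IsFactorization sevenTable Finset.univ 2 := by
  refine ⟨?_, fun _ _ _ => Finset.mem_univ _, fun x i _ => ?_⟩
  · decide
  · rw [Set.ncard_eq_toFinset_card', Set.toFinset_ofPred]
    revert x i
    decide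

/-- The edges of the complete graph on six vertices, partitioned into two triangles and three
perfect matchings. -/
def sixTable : Fin 6 → Fin 6 → Fin 4 :=
  ![![0, 0, 0, 1, 2, 3],
    ![0, 0, 0, 2, 3, 1],
    ![0, 0, 0, 3, 1, 2],
    ![1, 2, 3, 0, 0, 0],
    ![2, 3, 1, 0, 0, 0],
    ![3, 1, 2, 0, 0, 0]]

lemma ncard_sixTable (x : Fin 6) (i : Fin 4) :
    {y | y ≠ x ∧ sixTable x y = i}.ncard = if i = 0 then 2 else 1 := by
  rw [Set.ncard_eq_toFinset_card', Set.toFinset_ofPred]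
  revert x i
  decide

end Tables

namespace ECPOG

universe u v

variable {V : Type u} {C : Type v} [Finite V] {G : ECPOG V C}

/-- Three colors of degree `2` on seven vertices. -/
theorem not_isParamUnique_of_card_seven (hG : G.IsComplete) (hreg : G.IsColorRegular)
    (hV : Nat.card V = 7) (hd : ∀ c ∈ G.colors, ∀ v, G.totalDegree c v = 2) :
    ¬ G.IsParamUnique := by
  classical
  intro huniq
  have : Nonempty V := (Nat.card_pos_iff.1 (by omega)).1
  obtain ⟨v₀⟩ := id this
  have hsum := sum_totalDegree hG v₀
  rw [Finset.sum_congr rfl fun c hc => hd c hc v₀, hV] at hsum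
  obtain ⟨a, ha⟩ : G.colors.Nonempty := by
    by_contra h
    rw [Finset.not_nonempty_iff_eq_empty] at h
    simp [h] at hsum
  have : Nonempty C := ⟨a⟩
  have hk : ∀ c v, G.totalDegree c v = (if c ∈ G.colors then 1 else 0) * 2 := by
    intro c v
    split_ifs with hc
    · rw [hd c hc]
    · rw [totalDegree_eq_zero hc]
  have hT : ({a} : Finset C) ⊆ G.colors := by simpa using ha
  -- Color `a` becomes a 7-cycle in `f`, and a triangle with a 4-cycle in `g`.
  obtain ⟨f, hf, hfT⟩ := (isFactorization_circulant 3).exists_isRecoloring hG two_pos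
    (by rw [hV, Nat.card_zmod]) hk (S := {1}) (by decide) hT
    (by rw [Finset.sum_singleton, if_pos ha]; rfl)
  obtain ⟨g, hg, hgT⟩ := isFactorization_sevenTable.exists_isRecoloring hG two_pos
    (by rw [hV, Nat.card_fin]) hk (S := {0}) (Finset.subset_univ _) hT
    (by rw [Finset.sum_singleton, if_pos ha]; rfl)
  obtain ⟨σ, hσ⟩ := huniq.exists_equiv hG hreg hg hf
  have key : ∀ x y : Fin 7, x ≠ y → sevenTable x y = 0 →
      (σ x - σ y).valMinAbs.natAbs = 1 := by
    intro x y hxy h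
    have h1 := (hgT (sevenTable x y) (Finset.mem_univ _)).2 (by simp [h])
    rw [← hσ x y hxy, hfT _ ((isFactorization_circulant 3).mem _ _ (σ.injective.ne hxy))] at h1
    simpa using h1
  have h1 := key 0 1 (by decide) (by decide)
  have h2 := key 1 2 (by decide) (by decide)
  have h3 := key 2 0 (by decide) (by decide)
  revert h1 h2 h3
  generalize σ 0 = x
  generalize σ 1 = y
  generalize σ 2 = z
  revert x y z
  decide

/-- A color of degree `2` on six vertices. -/
theorem not_isParamUnique_of_card_six (hG : G.IsComplete) (hreg : G.IsColorRegular)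
    (hV : Nat.card V = 6) {a : C} (ha : ∀ v, G.totalDegree a v = 2) :
    ¬ G.IsParamUnique := by
  classical
  intro huniq
  have : Nonempty V := (Nat.card_pos_iff.1 (by omega)).1
  obtain ⟨v₀⟩ := id this
  have hac : a ∈ G.colors := (mem_colors_iff_totalDegree hreg v₀).2 (by rw [ha]; omega)
  have : Nonempty C := ⟨a⟩
  have hd : ∀ c v, G.totalDegree c v = G.totalDegree c v₀ := fun c v => hreg.totalDegree_eq c v v₀
  have hsum := sum_totalDegree hG v₀
  rw [hV, ← Finset.add_sum_erase _ _ hac, ha] at hsum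
  -- Here `a` is a union of two perfect matchings, which contains no triangle; in the competitor `a`
  -- consists of two triangles.
  obtain ⟨f, hf, hfT⟩ := (isFactorization_pointedSum
    (ZMod.bijective_add_self (q := 5) (by decide))).exists_isRecoloring hG one_pos
    (by rw [hV, Finite.card_option, Nat.card_zmod])
    (k := fun c => G.totalDegree c v₀) (fun c v => by rw [hd, mul_one])
    (T := {a}) (S := {0, 1}) (Finset.subset_univ _) (by simpa using hac)
    (by rw [Finset.sum_singleton, ha]; decide)
  -- The remaining colors have total degree `3`, whatever their number, and share the three
  -- matchings of the table.
  obtain ⟨g, hg, hgk⟩ := exists_fiber_card (fun c => G.totalDegree c v₀) (G.colors.erase a)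
    ({1, 2, 3} : Finset (Fin 4)) (by
      have : ({1, 2, 3} : Finset (Fin 4)).card = 3 := by decide
      omega)
  let g' : Fin 4 → C := fun i => if i = 0 then a else g i
  have hga : ∀ i, g' i = a ↔ i = 0 := by
    intro i
    by_cases hi : i = 0
    · simp [g', hi]
    · have := hg i (by revert i; decide)
      simp only [g', if_neg hi, hi, iff_false]
      exact (Finset.mem_erase.1 this).1
  have hg' : IsRecoloring G fun x y => g' (sixTable x y) := by
    refine isRecoloring_of_forall_ne hG (by rw [hV, Nat.card_fin]) (fun x y _ => ?_) hac
      fun c hca v x => ?_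
    · have : ∀ x y, sixTable x y = sixTable y x := by decide
      rw [this]
    · rw [ncard_fiber_comp (s := Finset.univ) (fun y _ => Finset.mem_univ _), hd]
      have h1 : ({i ∈ Finset.univ | g' i = c} : Finset (Fin 4)) =
          {i ∈ ({1, 2, 3} : Finset (Fin 4)) | g i = c} := by
        ext i
        have h2 : i ∈ ({1, 2, 3} : Finset (Fin 4)) ↔ i ≠ 0 := by revert i; decide
        by_cases hi : i = 0
        · simp [hi, g', Ne.symm hca]
        · simp [h2, hi, g']
      rw [h1, Finset.sum_congr rfl (g := fun _ => 1), Finset.sum_const, smul_eq_mul, mul_one]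
      · by_cases hc : c ∈ G.colors
        · exact hgk c (Finset.mem_erase.2 ⟨hca, hc⟩)
        · rw [totalDegree_eq_zero hc, Finset.card_eq_zero, Finset.filter_eq_empty_iff]
          exact fun i hi h => hc (h ▸ (Finset.mem_erase.1 (hg i hi)).2)
      · intro i hi
        have h2 : ∀ i ∈ ({1, 2, 3} : Finset (Fin 4)), i ≠ 0 := by decide
        rw [ncard_sixTable, if_neg (h2 _ (Finset.mem_filter.1 hi).1)]
  obtain ⟨σ, hσ⟩ := huniq.exists_equiv hG hreg hg' hf
  have key : ∀ x y : Fin 6, x ≠ y → sixTable x y = 0 →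
      pointedSum (σ x) (σ y) ∈ ({0, 1} : Finset (ZMod 5)) := by
    intro x y hxy h
    rw [← hfT _ (Finset.mem_univ _), hσ x y hxy, h]
    simp [g']
  have h1 := key 0 1 (by decide) (by decide)
  have h2 := key 1 2 (by decide) (by decide)
  have h3 := key 2 0 (by decide) (by decide)
  have h4 : σ 0 ≠ σ 1 := σ.injective.ne (by decide)
  have h5 : σ 1 ≠ σ 2 := σ.injective.ne (by decide)
  have h6 : σ 2 ≠ σ 0 := σ.injective.ne (by decide)
  revert h1 h2 h3 h4 h5 h6
  generalize σ 0 = x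
  generalize σ 1 = y
  generalize σ 2 = z
  revert x y z
  decide

end ECPOG

/-! ### Rotational orientations and reversal of 3-cycles -/

section Orientations

/-- The arcs from `x` to the vertices that come next in clockwise order. -/
def arcRel (n : ℕ) (x y : ZMod n) : Prop :=
  0 < (y - x).valMinAbs ∧ 2 * (y - x).valMinAbs < n

lemma arcRel_iff {n : ℕ} [NeZero n] {x y : ZMod n} (i : ℤ) (h : y = x + i)
    (h1 : -(n : ℤ) < 2 * i) (h2 : 2 * i ≤ n) : arcRel n x y ↔ 0 < i ∧ 2 * i < n := by
  have : (y - x).valMinAbs = i :=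
    (ZMod.valMinAbs_spec _ _).2 ⟨by rw [h]; ring, ⟨by omega, by omega⟩⟩
  rw [arcRel, this]

lemma exists_eq_add_valMinAbs {n : ℕ} [NeZero n] (x y : ZMod n) :
    ∃ i : ℤ, y = x + i ∧ -(n : ℤ) < 2 * i ∧ 2 * i ≤ n := by
  have h := (y - x).valMinAbs_mem_Ioc
  exact ⟨(y - x).valMinAbs, by simp, by have := h.1; omega, by have := h.2; omega⟩

lemma arcRel_iff_not_swap {n : ℕ} [NeZero n] {x y : ZMod n} (hxy : x ≠ y)
    (h : 2 * (y - x).valMinAbs ≠ n) : arcRel n x y ↔ ¬ arcRel n y x := by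
  obtain ⟨i, hi, h1, h2⟩ := exists_eq_add_valMinAbs x y
  have h3 : (y - x).valMinAbs = i :=
    (ZMod.valMinAbs_spec _ _).2 ⟨by rw [hi]; ring, ⟨by omega, by omega⟩⟩
  have hi0 : i ≠ 0 := by
    rintro rfl
    exact hxy (by simpa using hi.symm)
  rw [h3] at h
  rw [arcRel_iff i hi h1 h2, arcRel_iff (-i) (by rw [hi]; push_cast; ring) (by omega) (by omega)]
  omega

lemma ncard_arcRel {n : ℕ} [NeZero n] (x : ZMod n) : {y | arcRel n x y}.ncard = (n - 1) / 2 := by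
  have h : {y | arcRel n x y} =
      (fun i : ℤ => x + i) '' (Finset.Icc 1 ((n - 1) / 2 : ℕ) : Finset ℤ) := by
    ext y
    obtain ⟨i, hi, h1, h2⟩ := exists_eq_add_valMinAbs x y
    simp only [Set.mem_ofPred_eq, Set.mem_image, Finset.coe_Icc, Set.mem_Icc]
    constructor
    · rw [arcRel_iff i hi h1 h2]
      rintro ⟨h3, h4⟩
      exact ⟨i, by omega, hi.symm⟩
    · rintro ⟨j, hj, rfl⟩
      rw [arcRel_iff j rfl (by omega) (by omega)]
      omega
  rw [h, Set.InjOn.ncard_image, Set.ncard_coe_finset, Int.card_Icc]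
  · omega
  · intro i hi j hj hij
    simp only [Finset.coe_Icc, Set.mem_Icc] at hi hj
    by_contra hne
    refine ZMod.intCast_ne_zero_of_abs_lt (n := n) (a := i - j) (by omega) ?_ ?_
    · rw [abs_lt]
      omega
    · push_cast
      simp only [add_right_inj] at hij
      rw [hij, sub_self]

open Classical in
/-- The relation that arises from `R` by reversing the arcs between `a`, `b` and `c`. -/
def reverseOn {W : Type*} (R : W → W → Prop) (A : Set W) (x y : W) : Prop :=
  if x ∈ A ∧ y ∈ A then R y x else R x y

lemma reverseOn_iff_not_swap {W : Type*} {R : W → W → Prop} {A : Set W} {x y : W}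
    (h : R x y ↔ ¬ R y x) : reverseOn R A x y ↔ ¬ reverseOn R A y x := by
  unfold reverseOn
  by_cases hx : x ∈ A <;> by_cases hy : y ∈ A <;> simp [hx, hy] <;> tauto

/-- Reversing a directed 3-cycle does not change outdegrees. -/
lemma ncard_reverseOn {W : Type*} {R : W → W → Prop} {a b c : W} (hab : R a b ∧ ¬ R b a)
    (hbc : R b c ∧ ¬ R c b) (hca : R c a ∧ ¬ R a c) (x : W) :
    {y | reverseOn R {a, b, c} x y}.ncard = {y | R x y}.ncard := by
  classical
  have h1 : a ≠ b := fun h => hab.2 (h ▸ hab.1)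
  have h2 : b ≠ c := fun h => hbc.2 (h ▸ hbc.1)
  have h3 : c ≠ a := fun h => hca.2 (h ▸ hca.1)
  suffices ∃ τ : Equiv.Perm W, ∀ y, reverseOn R {a, b, c} x (τ y) ↔ R x y by
    obtain ⟨τ, hτ⟩ := this
    rw [← Set.ncard_image_of_injective {y | R x y} τ.injective]
    congr 1
    ext y
    obtain ⟨y, rfl⟩ := τ.surjective y
    simp [hτ]
  -- A vertex `x` of the 3-cycle with successor `p` and predecessor `q` trades the out-neighbor `p`
  -- for `q`, so transposing `p` and `q` matches the old out-neighbors with the new ones.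
  have key : ∀ p q, p ≠ q → x ∈ ({a, b, c} : Set W) → (∀ y, y ∈ ({a, b, c} : Set W) ↔
      y = x ∨ y = p ∨ y = q) → p ≠ x → q ≠ x → (R x p ∧ ¬ R p x) → (R q x ∧ ¬ R x q) →
      ∃ τ : Equiv.Perm W, ∀ y, reverseOn R {a, b, c} x (τ y) ↔ R x y := by
    intro p q hpq hx hA hpx hqx hp hq
    refine ⟨Equiv.swap p q, fun y => ?_⟩
    by_cases hyp : y = p
    · subst hyp
      rw [Equiv.swap_apply_left, reverseOn, if_pos ⟨hx, (hA q).2 (by simp)⟩]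
      tauto
    by_cases hyq : y = q
    · subst hyq
      rw [Equiv.swap_apply_right, reverseOn, if_pos ⟨hx, (hA p).2 (by simp)⟩]
      tauto
    rw [Equiv.swap_apply_of_ne_of_ne hyp hyq, reverseOn]
    split_ifs with h
    · have : y = x := by
        have := (hA y).1 h.2
        tauto
      rw [this]
    · rfl
  by_cases hxa : x = a
  · subst hxa
    exact key b c h2 (by simp) (by simp) h1.symm h3 hab hca
  by_cases hxb : x = b
  · subst hxb
    exact key c a h3 (by simp) (fun y => by
      simp only [Set.mem_insert_iff, Set.mem_singleton_iff]; tauto) h2.symm h1 hbc hab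
  by_cases hxc : x = c
  · subst hxc
    exact key a b h1 (by simp) (fun y => by
      simp only [Set.mem_insert_iff, Set.mem_singleton_iff]; tauto) h3.symm h2 hca hbc
  · refine ⟨1, fun y => ?_⟩
    rw [Equiv.Perm.one_apply, reverseOn, if_neg]
    simp [hxa, hxb, hxc]

end Orientations

namespace ECPOG

universe u v

variable {V : Type u} {C : Type v} [Finite V] {G : ECPOG V C}

lemma arcRel_irrefl {n : ℕ} (x : ZMod n) : ¬ arcRel n x x := by
  simp [arcRel]

lemma reverseOn_irrefl {W : Type*} {R : W → W → Prop} (hR : ∀ x, ¬ R x x) (A : Set W) (x : W) :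
    ¬ reverseOn R A x x := by
  unfold reverseOn
  split_ifs <;> exact hR x

lemma arcRel_of_eq {n : ℕ} [NeZero n] {x y : ZMod n} (i : ℤ) (h : y = x + i)
    (h1 : 0 < i) (h2 : 2 * i < n) : arcRel n x y ∧ ¬ arcRel n y x :=
  ⟨(arcRel_iff i h (by omega) (by omega)).2 ⟨h1, h2⟩, fun h' => by
    have := (arcRel_iff (-i) (by rw [h]; push_cast; ring) (by omega) (by omega)).1 h'
    omega⟩

lemma eq_of_intCast_eq {n : ℕ} {i j : ℤ} (h : (i : ZMod n) = j) (hij : |i - j| < n) : i = j := by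
  by_contra hne
  exact ZMod.intCast_ne_zero_of_abs_lt (sub_ne_zero.2 hne) hij (by push_cast; rw [h, sub_self])

/-- A tournament with at least seven vertices. -/
theorem not_isParamUnique_of_tournament (hG : G.IsComplete) (hreg : G.IsColorRegular) {m : ℕ}
    (hm : 3 ≤ m) (hV : Nat.card V = 2 * m + 1) {c : C} (hcol : G.colors = {c})
    (hc : G.IsDirectedColor c) : ¬ G.IsParamUnique := by
  intro huniq
  have hcc : c ∈ G.colors := by simp [hcol]
  have hout : ∀ v, G.outDegree c v = m := fun v => by
    have h1 := sum_totalDegree hG v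
    rw [hcol, Finset.sum_singleton, hc.totalDegree hreg, hV] at h1
    omega
  have hf : IsRecoloring G fun _ _ : ZMod (2 * m + 1) => c := by
    refine isRecoloring_of_forall_ne hG (by rw [hV, Nat.card_zmod]) (fun _ _ _ => rfl) hcc
      fun d hd v x => ?_
    rw [totalDegree_eq_zero (by simpa [hcol] using hd)]
    simp [hd.symm]
  have hcount : ∀ {R : ZMod (2 * m + 1) → ZMod (2 * m + 1) → Prop}, (∀ x, ¬ R x x) →
      (∀ x, {y | R x y}.ncard = m) → ∀ d, G.IsDirectedColor d → ∀ v x,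
      {y | y ≠ x ∧ c = d ∧ R x y}.ncard = G.outDegree d v := by
    intro R hirr hR d hd v x
    have hdc : d = c := by
      obtain ⟨x, y, h, -⟩ := hd
      simpa [hcol] using mem_colors.2 ⟨x, y, h⟩
    subst hdc
    rw [hout]
    refine Eq.trans ?_ (hR x)
    congr 1
    ext y
    simp only [true_and, Set.mem_ofPred_eq, and_iff_right_iff_imp]
    rintro h rfl
    exact hirr _ h
  have hant : ∀ x y : ZMod (2 * m + 1), x ≠ y →
      (arcRel (2 * m + 1) x y ↔ ¬ arcRel (2 * m + 1) y x) := fun x y hxy =>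
    arcRel_iff_not_swap hxy (by omega)
  have hone : ∀ {x y : ZMod (2 * m + 1)} (i : ℤ), y = x + i → 0 < i → i ≤ m →
      arcRel (2 * m + 1) x y ∧ ¬ arcRel (2 * m + 1) y x := fun i h h1 h2 =>
    arcRel_of_eq i h h1 (by omega)
  have hn : (2 * m + 1 : ZMod (2 * m + 1)) = 0 := by
    have := ZMod.natCast_self (2 * m + 1)
    push_cast at this
    exact this
  -- The arcs `0 → 2 → m + 2 → 0` have lengths `2`, `m` and `m - 1`, which sum to `2 * m + 1`.
  let A : Set (ZMod (2 * m + 1)) := {0, 2, ((m + 2 : ℤ) : ZMod (2 * m + 1))}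
  obtain ⟨σ, hσ⟩ := huniq.exists_equiv_of_orientation hG hreg hf hf
    (R := reverseOn (arcRel (2 * m + 1)) A) (S := arcRel (2 * m + 1))
    (fun x y hxy _ => reverseOn_iff_not_swap (hant x y hxy))
    (hcount (reverseOn_irrefl arcRel_irrefl A) fun x => by
      rw [ncard_reverseOn (hone 2 (by simp) (by omega) (by omega))
        (hone m (by push_cast; ring) (by omega) (by omega))
        (hone (m - 1) (by push_cast; linear_combination -hn) (by omega) (by omega)),
        ncard_arcRel]
      omega)
    (fun x y hxy _ => hant x y hxy)
    (hcount arcRel_irrefl fun x => by rw [ncard_arcRel]; omega)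
  have hA : ∀ i : ℤ, -1 ≤ i → i ≤ 2 → i ≠ 0 → i ≠ 2 → ((i : ℤ) : ZMod (2 * m + 1)) ∉ A := by
    intro i h1 h2 h3 h4 h5
    rcases h5 with h5 | h5 | h5
    · exact h3 (eq_of_intCast_eq (n := 2 * m + 1) (i := i) (j := 0) (by simpa using h5)
        (by rw [abs_lt]; push_cast; omega))
    · exact h4 (eq_of_intCast_eq (n := 2 * m + 1) (i := i) (j := 2) (by simpa using h5)
        (by rw [abs_lt]; push_cast; omega))
    · have := eq_of_intCast_eq h5 (by rw [abs_lt]; push_cast; omega)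
      omega
  have hA1 : (1 : ZMod (2 * m + 1)) ∉ A := by simpa using hA 1
  have hA2 : (-1 : ZMod (2 * m + 1)) ∉ A := by simpa using hA (-1)
  have key : ∀ x y, reverseOn (arcRel (2 * m + 1)) A x y → arcRel (2 * m + 1) (σ x) (σ y) := by
    intro x y h
    have hxy : x ≠ y := by
      rintro rfl
      exact reverseOn_irrefl arcRel_irrefl A _ h
    exact (hσ x y hxy).2 hc h
  have k1 : ∀ (x y : ZMod (2 * m + 1)) (i : ℤ), y = x + i → 0 < i → i ≤ m → (x ∉ A ∨ y ∉ A) →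
      arcRel (2 * m + 1) (σ x) (σ y) := by
    intro x y i h1 h2 h3 h4
    refine key x y ?_
    rw [reverseOn, if_neg (by tauto)]
    exact (hone i h1 h2 h3).1
  -- After the reversal `-1` dominates the directed 3-cycle `0 → 1 → 2 → 0`; the arc from `-1` to
  -- `2` needs `3 ≤ m`. In the rotational tournament the out-neighbors of a vertex are ordered by
  -- their offsets, so they span no directed cycle.
  have h01 := k1 0 1 1 (by simp) (by omega) (by omega) (Or.inr hA1)
  have h12 := k1 1 2 1 (by push_cast; ring) (by omega) (by omega) (Or.inl hA1)
  have h20 : arcRel (2 * m + 1) (σ 2) (σ 0) := by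
    refine key 2 0 ?_
    rw [reverseOn, if_pos ⟨by simp [A], by simp [A]⟩]
    exact (hone 2 (by simp) (by omega) (by omega)).1
  have hv0 := k1 (-1) 0 1 (by simp) (by omega) (by omega) (Or.inl hA2)
  have hv1 := k1 (-1) 1 2 (by push_cast; ring) (by omega) (by omega) (Or.inl hA2)
  have hv2 := k1 (-1) 2 3 (by push_cast; ring) (by omega) (by omega) (Or.inl hA2)
  revert h01 h12 h20 hv0 hv1 hv2
  generalize σ 0 = x
  generalize σ 1 = y
  generalize σ 2 = z
  generalize σ (-1) = w
  obtain ⟨i, rfl, hi1, hi2⟩ := exists_eq_add_valMinAbs w x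
  obtain ⟨j, rfl, hj1, hj2⟩ := exists_eq_add_valMinAbs w y
  obtain ⟨k, rfl, hk1, hk2⟩ := exists_eq_add_valMinAbs w z
  rw [arcRel_iff i rfl hi1 hi2, arcRel_iff j rfl hj1 hj2, arcRel_iff k rfl hk1 hk2]
  intro hxy hyz hzx hi hj hk
  rw [arcRel_iff (j - i) (by push_cast; ring) (by omega) (by omega)] at hxy
  rw [arcRel_iff (k - j) (by push_cast; ring) (by omega) (by omega)] at hyz
  rw [arcRel_iff (i - k) (by push_cast; ring) (by omega) (by omega)] at hzx
  omega

/-- A perfect matching and a directed color. -/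
theorem not_isParamUnique_of_matching_of_directed (hG : G.IsComplete) (hreg : G.IsColorRegular)
    {m : ℕ} (hm : 3 ≤ m) (hV : Nat.card V = 2 * m) {a b : C} (hab : a ≠ b)
    (hcol : (G.colors : Set C) = {a, b}) (ha : ∀ v, G.totalDegree a v = 1)
    (hb : G.IsDirectedColor b) :
    ¬ G.IsParamUnique := by
  classical
  intro huniq
  have hcol' : G.colors = {a, b} := by rw [← Finset.coe_inj, hcol]; simp
  have : NeZero (2 * m) := ⟨by omega⟩
  have hau : ¬ G.IsDirectedColor a := fun h => by
    obtain ⟨v, -⟩ := id h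
    have := h.totalDegree hreg v
    rw [ha] at this
    omega
  have hout : ∀ v, G.outDegree b v = m - 1 := fun v => by
    have h1 := sum_totalDegree hG v
    rw [hcol', Finset.sum_pair hab, ha, hb.totalDegree hreg, hV] at h1
    omega
  have hn : (2 * m : ZMod (2 * m)) = 0 := by
    have := ZMod.natCast_self (2 * m)
    push_cast at this
    exact this
  have hm0 : (m : ZMod (2 * m)) ≠ 0 := ZMod.natCast_ne_zero_of_lt (by omega) (by omega)
  have hf := isRecoloring_ite (W := ZMod (2 * m)) hG hab hcol
    (by rw [hV, Nat.card_zmod]) (X := fun x y => y = x + m)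
    (fun x y h => by rw [h]; linear_combination -hn) (fun x h => hm0 (by simpa using h.symm))
    fun v x => by simp [ha]
  have hvm : ∀ x y : ZMod (2 * m), y ≠ x + m → 2 * (y - x).valMinAbs ≠ (2 * m : ℕ) := by
    intro x y hxy h
    refine hxy ?_
    have h1 : (y - x).valMinAbs = m := by push_cast at h; omega
    have h2 := ZMod.coe_valMinAbs (y - x)
    rw [h1] at h2
    push_cast at h2
    rw [h2]
    ring
  have hadj : ∀ x y : ZMod (2 * m), (if y = x + m then a else b) = b ↔ y ≠ x + m := by
    intro x y
    split_ifs with h <;> simp [h, hab]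
  have hant : ∀ x y : ZMod (2 * m), x ≠ y → G.IsDirectedColor (if y = x + m then a else b) →
      (arcRel (2 * m) x y ↔ ¬ arcRel (2 * m) y x) := by
    intro x y hxy h
    refine arcRel_iff_not_swap hxy (hvm x y ?_)
    rintro rfl
    simp only [if_true] at h
    exact hau h
  have hcount : ∀ {R : ZMod (2 * m) → ZMod (2 * m) → Prop}, (∀ x, ¬ R x x) →
      (∀ x y, R x y → y ≠ x + m) → (∀ x, {y | R x y}.ncard = m - 1) → ∀ d, G.IsDirectedColor d →
      ∀ (v : V) (x : ZMod (2 * m)), {y | y ≠ x ∧ (if y = x + m then a else b) = d ∧ R x y}.ncard =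
        G.outDegree d v := by
    intro R hirr hRm hR d hd v x
    have hdb : d = b := by
      obtain ⟨x, y, h, -⟩ := id hd
      have := mem_colors.2 ⟨x, y, h⟩
      rw [hcol', Finset.mem_insert, Finset.mem_singleton] at this
      exact this.resolve_left fun h => hau (h ▸ hd)
    subst hdb
    rw [hout]
    refine Eq.trans ?_ (hR x)
    congr 1
    ext y
    simp only [Set.mem_ofPred_eq, hadj]
    exact ⟨fun h => h.2.2, fun h => ⟨by rintro rfl; exact hirr _ h, hRm _ _ h, h⟩⟩
  have hone : ∀ {x y : ZMod (2 * m)} (i : ℤ), y = x + i → 0 < i → i < m →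
      arcRel (2 * m) x y ∧ ¬ arcRel (2 * m) y x := fun i h h1 h2 =>
    arcRel_of_eq i h h1 (by push_cast; omega)
  have harcm : ∀ x y : ZMod (2 * m), arcRel (2 * m) x y → y ≠ x + m := by
    rintro x y h rfl
    have := (arcRel_iff (m : ℤ) (by simp) (by push_cast; omega) (by push_cast; omega)).1 h
    push_cast at this
    omega
  -- The arcs `0 → 2 → m + 1 → 0` have lengths `2`, `m - 1` and `m - 1`, all less than `m`.
  let A : Set (ZMod (2 * m)) := {0, 2, ((m + 1 : ℤ) : ZMod (2 * m))}
  obtain ⟨σ, hσ⟩ := huniq.exists_equiv_of_orientation hG hreg hf hf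
    (R := reverseOn (arcRel (2 * m)) A) (S := arcRel (2 * m))
    (fun x y hxy h => reverseOn_iff_not_swap (hant x y hxy h))
    (hcount (reverseOn_irrefl arcRel_irrefl A) (fun x y h => by
      unfold reverseOn at h
      split_ifs at h
      · rintro rfl
        exact harcm _ _ h (by linear_combination -hn)
      · exact harcm _ _ h) fun x => by
      rw [ncard_reverseOn (hone 2 (by simp) (by omega) (by omega))
        (hone (m - 1) (by push_cast; ring) (by omega) (by omega))
        (hone (m - 1) (by push_cast; linear_combination -hn) (by omega) (by omega)),
        ncard_arcRel]
      omega)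
    hant (hcount arcRel_irrefl harcm fun x => by rw [ncard_arcRel]; omega)
  have hA1 : (1 : ZMod (2 * m)) ∉ A := by
    have hA : ((1 : ℤ) : ZMod (2 * m)) ∉ A := by
      intro h5
      rcases h5 with h5 | h5 | h5
      · have := eq_of_intCast_eq (n := 2 * m) (i := 1) (j := 0) (by simpa using h5)
          (by rw [abs_lt]; push_cast; omega)
        omega
      · have := eq_of_intCast_eq (n := 2 * m) (i := 1) (j := 2) (by simpa using h5)
          (by rw [abs_lt]; push_cast; omega)
        omega
      · have := eq_of_intCast_eq h5 (by rw [abs_lt]; push_cast; omega)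
        omega
    simpa using hA
  have key : ∀ x y, reverseOn (arcRel (2 * m)) A x y → y ≠ x + m →
      arcRel (2 * m) (σ x) (σ y) := by
    intro x y h hxym
    have hxy : x ≠ y := by
      rintro rfl
      exact reverseOn_irrefl arcRel_irrefl A _ h
    exact (hσ x y hxy).2 (by rw [if_neg hxym]; exact hb) h
  -- After the reversal `0` dominates both `1` and `m + 1`, which are matched. In the rotational
  -- orientation the offsets of out-neighbors lie strictly between `0` and `m`, so no two
  -- out-neighbors are matched.
  have h01 : arcRel (2 * m) (σ 0) (σ 1) := by
    refine key 0 1 ?_ ?_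
    · rw [reverseOn, if_neg fun h => hA1 h.2]
      exact (hone 1 (by simp) (by omega) (by omega)).1
    · exact harcm _ _ (hone 1 (by simp) (by omega) (by omega)).1
  have h0m : arcRel (2 * m) (σ 0) (σ (m + 1 : ℤ)) := by
    refine key 0 (m + 1 : ℤ) ?_ ?_
    · rw [reverseOn, if_pos ⟨by simp [A], by simp [A]⟩]
      exact (hone (m - 1) (by push_cast; linear_combination -hn) (by omega) (by omega)).1
    · intro h
      have h1 : ((1 : ℤ) : ZMod (2 * m)) = (0 : ℤ) := by
        push_cast at h ⊢
        linear_combination h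
      have := eq_of_intCast_eq h1 (by rw [abs_lt]; push_cast; omega)
      omega
  have h1m : σ (m + 1 : ℤ) = σ 1 + m := by
    have h1 := (hσ 1 (m + 1 : ℤ) (fun h => hm0 (by push_cast at h; linear_combination -h))).1
    have h2 : (((m : ℤ) + 1 : ℤ) : ZMod (2 * m)) = 1 + m := by push_cast; ring
    rw [if_pos h2] at h1
    by_contra h3
    rw [if_neg h3] at h1
    exact hab h1.symm
  revert h01 h0m h1m
  generalize σ 0 = x
  generalize σ 1 = y
  generalize σ (m + 1 : ℤ) = z
  obtain ⟨i, rfl, hi1, hi2⟩ := exists_eq_add_valMinAbs x y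
  obtain ⟨j, rfl, hj1, hj2⟩ := exists_eq_add_valMinAbs x z
  rw [arcRel_iff i rfl hi1 hi2, arcRel_iff j rfl hj1 hj2]
  intro hi hj h
  have h1 : ((j - i : ℤ) : ZMod (2 * m)) = (m : ℤ) := by
    push_cast
    linear_combination h
  have := eq_of_intCast_eq h1 (by rw [abs_lt]; push_cast at *; omega)
  push_cast at *
  omega

/-- Two directed colors on five vertices. -/
theorem not_isParamUnique_of_two_directed (hG : G.IsComplete) (hreg : G.IsColorRegular)
    (hV : Nat.card V = 5) {a b : C} (hab : a ≠ b) (hcol : (G.colors : Set C) = {a, b})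
    (ha : G.IsDirectedColor a) (hb : G.IsDirectedColor b) :
    ¬ G.IsParamUnique := by
  classical
  intro huniq
  have hcol' : G.colors = {a, b} := by rw [← Finset.coe_inj, hcol]; simp
  obtain ⟨v₀, -⟩ := id ha
  have hsum := sum_totalDegree hG v₀
  have hac : a ∈ G.colors := by simp [hcol']
  have hbc : b ∈ G.colors := by simp [hcol']
  have hapos := totalDegree_pos hreg hac v₀
  have hbpos := totalDegree_pos hreg hbc v₀
  rw [hcol', Finset.sum_pair hab, ha.totalDegree hreg, hb.totalDegree hreg, hV] at hsum
  rw [ha.totalDegree hreg] at hapos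
  rw [hb.totalDegree hreg] at hbpos
  have haout : ∀ v, G.outDegree a v = 1 := fun v => by rw [(hreg a v v₀).2.1]; omega
  have hbout : ∀ v, G.outDegree b v = 1 := fun v => by rw [(hreg b v v₀).2.1]; omega
  have hf := isRecoloring_ite (W := ZMod 5) hG hab hcol
    (by rw [hV, Nat.card_zmod]) (X := fun x y => x - y = 1 ∨ y - x = 1)
    (fun x y h => h.symm) (by decide)
    fun v x => by
      rw [ha.totalDegree hreg, haout]
      exact ncard_cycleRel (by omega) x
  have hdir : ∀ d, G.IsDirectedColor d → d = a ∨ d = b := fun d hd => by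
    obtain ⟨x, y, h, -⟩ := id hd
    have := mem_colors.2 ⟨x, y, h⟩
    rwa [hcol', Finset.mem_insert, Finset.mem_singleton] at this
  have hcount : ∀ k : ZMod 5, k ≠ 0 → k ≠ 1 → k ≠ 4 → ∀ d, G.IsDirectedColor d → ∀ v x,
      {y | y ≠ x ∧ (if x - y = 1 ∨ y - x = 1 then a else b) = d ∧
        (y - x = 1 ∨ y - x = k)}.ncard = G.outDegree d v := by
    intro k hk0 hk1 hk4 d hd v x
    rcases hdir d hd with rfl | rfl
    · rw [haout, Set.ncard_eq_one]
      refine ⟨x + 1, Set.ext fun y => ?_⟩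
      simp only [Set.mem_ofPred_eq, Set.mem_singleton_iff, ite_eq_left_iff, hab.symm, imp_false,
        not_not]
      revert x y k
      decide
    · rw [hbout, Set.ncard_eq_one]
      refine ⟨x + k, Set.ext fun y => ?_⟩
      simp only [Set.mem_ofPred_eq, Set.mem_singleton_iff, ite_eq_right_iff, hab, imp_false]
      revert x y k
      decide
  obtain ⟨σ, hσ⟩ := huniq.exists_equiv_of_orientation hG hreg hf hf
    -- Color `a` is the cycle `x → x + 1` in both orientations. Preserving it forces `σ` to be a
    -- translation, but then `b` cannot pass from step `2` to step `3`.
    (R := fun x y => y - x = 1 ∨ y - x = 2) (S := fun x y => y - x = 1 ∨ y - x = 3)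
    (fun x y hxy h => by clear h; revert x y; decide) (hcount 2 (by decide) (by decide) (by decide))
    (fun x y hxy h => by clear h; revert x y; decide) (hcount 3 (by decide) (by decide) (by decide))
  have keya : ∀ x y, y - x = 1 → σ y - σ x = 1 := by
    intro x y h
    have hxy : x ≠ y := by
      rintro rfl
      rw [sub_self] at h
      exact absurd h (by decide)
    obtain ⟨h1, h2⟩ := hσ x y hxy
    have h3 : x - y = 1 ∨ y - x = 1 := Or.inr h
    rw [if_pos h3] at h1 h2
    have h4 := h2 ha (Or.inl h)
    have h5 : σ x - σ y = 1 ∨ σ y - σ x = 1 := by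
      by_contra h5
      rw [if_neg h5] at h1
      exact hab h1.symm
    revert h4 h5
    generalize σ x = x'
    generalize σ y = y'
    revert x' y'
    decide
  have h1 := keya 0 1 (by decide)
  have h2 := keya 1 2 (by decide)
  have h3 := (hσ 0 2 (by decide)).2 (by rw [if_neg (by decide)]; exact hb) (Or.inr (by decide))
  revert h1 h2 h3
  generalize σ 0 = x
  generalize σ 1 = y
  generalize σ 2 = z
  revert x y z
  decide

end ECPOG

/-! ### Permutations and alternating cycles in standard position -/

section Permutations

variable {V W : Type*}

lemma exists_perm_of_ncard_eq_one [Finite V] {R : V → V → Prop}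
    (hout : ∀ v, {w | R v w}.ncard = 1) (hin : ∀ v, {w | R w v}.ncard = 1) :
    ∃ π : Equiv.Perm V, ∀ v w, R v w ↔ w = π v := by
  have hex : ∀ v, ∃ u, ∀ w, R v w ↔ w = u := fun v => by
    obtain ⟨u, hu⟩ := Set.ncard_eq_one.1 (hout v)
    exact ⟨u, fun w => Set.ext_iff.1 hu w⟩
  choose f hf using hex
  have hinj : Function.Injective f := by
    intro v w hvw
    obtain ⟨u, hu⟩ := Set.ncard_eq_one.1 (hin (f v))
    have h1 := (Set.ext_iff.1 hu v).1 ((hf v _).2 rfl)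
    have h2 := (Set.ext_iff.1 hu w).1 ((hf w _).2 hvw)
    exact h1.trans h2.symm
  exact ⟨Equiv.ofBijective f (Finite.injective_iff_bijective.1 hinj), hf⟩

/-- Any two permutations of equally many points that have the property `P`, which is invariant under
conjugation and determines the cycle type, are conjugate. -/
lemma exists_equiv_semiconj [Fintype V] [DecidableEq V] [Finite W] (hcard : Nat.card V = Nat.card W)
    (π : Equiv.Perm V) (ρ : Equiv.Perm W)
    (h : ∀ e : V ≃ W, π.cycleType = (e.symm.permCongr ρ).cycleType) :
    ∃ e : V ≃ W, ∀ x, e (π x) = ρ (e x) := by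
  obtain ⟨e₀⟩ := Finite.card_eq.1 hcard
  obtain ⟨c, hc⟩ := isConj_iff.1 (Equiv.Perm.isConj_of_cycleType_eq (h e₀))
  refine ⟨c.trans e₀, fun x => ?_⟩
  have h1 := Equiv.congr_fun hc (c x)
  have h2 : c⁻¹ (c x) = x := c.symm_apply_apply x
  rw [Equiv.Perm.mul_apply, Equiv.Perm.mul_apply, h2, Equiv.permCongr_apply,
    Equiv.symm_symm] at h1
  simp [h1]

/-- The order divides `2`, so every nontrivial cycle has length two, and the absence of fixed points
determines how many there are. -/
lemma cycleType_of_involution [Fintype V] [DecidableEq V] {π : Equiv.Perm V}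
    (h : ∀ x, π (π x) = x) (h' : ∀ x, π x ≠ x) :
    π.cycleType = Multiset.replicate (Fintype.card V / 2) 2 := by
  have h1 : ∀ k ∈ π.cycleType, k = 2 := by
    intro k hk
    have h2 : orderOf π ∣ 2 := orderOf_dvd_of_pow_eq_one (Equiv.ext fun x => by
      rw [pow_two, Equiv.Perm.mul_apply, h, Equiv.Perm.one_apply])
    have h3 := Nat.le_of_dvd two_pos ((Equiv.Perm.dvd_of_mem_cycleType hk).trans h2)
    have h4 := Equiv.Perm.two_le_of_mem_cycleType hk
    omega
  have h2 := Multiset.eq_replicate_card.2 h1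
  have h3 := π.sum_cycleType
  have h4 : π.support = Finset.univ := by
    ext x
    simp [h' x]
  rw [h4, Finset.card_univ, h2, Multiset.sum_replicate, smul_eq_mul] at h3
  rw [h2]
  congr 1
  omega

lemma exists_equiv_of_involutions [Finite V] [Finite W] (hcard : Nat.card V = Nat.card W)
    {π : Equiv.Perm V} {ρ : Equiv.Perm W} (hπ : ∀ x, π (π x) = x) (hπ' : ∀ x, π x ≠ x)
    (hρ : ∀ x, ρ (ρ x) = x) (hρ' : ∀ x, ρ x ≠ x) : ∃ e : V ≃ W, ∀ x, e (π x) = ρ (e x) := by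
  classical
  have := Fintype.ofFinite V
  refine exists_equiv_semiconj hcard π ρ fun e => ?_
  rw [cycleType_of_involution hπ hπ', cycleType_of_involution]
  · intro x
    simp [Equiv.permCongr_apply, hρ]
  · intro x
    simp [Equiv.permCongr_apply, Equiv.symm_apply_eq, hρ']

/-- All cycles have length at least three, and two of them need at least six points. -/
lemma cycleType_of_card_le_five [Fintype V] [DecidableEq V] {π : Equiv.Perm V}
    (h3 : 3 ≤ Fintype.card V) (h5 : Fintype.card V ≤ 5) (h : ∀ x, π (π x) ≠ x)
    (h' : ∀ x, π x ≠ x) : π.cycleType = {Fintype.card V} := by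
  have h1 : ∀ k ∈ π.cycleType, 3 ≤ k := by
    intro k hk
    have h4 := Equiv.Perm.two_le_of_mem_cycleType hk
    by_contra hlt
    obtain rfl : k = 2 := by omega
    obtain ⟨c, τ, hπ, hd, hc, hc2⟩ := Equiv.Perm.mem_cycleType_iff.1 hk
    obtain ⟨x, hx, -⟩ := id hc
    obtain ⟨y, z, hyz, rfl⟩ := Equiv.Perm.card_support_eq_two.1 hc2
    have h6 : ∀ u, Equiv.swap y z u ≠ u → π u = Equiv.swap y z u := fun u hu => by
      rw [hπ, Equiv.Perm.mul_apply, (hd u).resolve_left hu]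
    have h7 : Equiv.swap y z y ≠ y := by simpa using hyz.symm
    have h8 : Equiv.swap y z z ≠ z := by simpa using hyz
    refine h y ?_
    rw [h6 y h7, Equiv.swap_apply_left, h6 z h8, Equiv.swap_apply_right]
  have h2 : π.support = Finset.univ := by
    ext x
    simp [h' x]
  have h4 := π.sum_cycleType
  rw [h2, Finset.card_univ] at h4
  have h6 := Multiset.card_nsmul_le_sum h1
  rw [h4, smul_eq_mul] at h6
  have h7 : π.cycleType ≠ 0 := by
    intro h7
    rw [h7, Multiset.sum_zero] at h4
    omega
  have h8 := Multiset.card_pos.2 h7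
  obtain ⟨k, hk⟩ := Multiset.card_eq_one.1 (by omega : Multiset.card π.cycleType = 1)
  rw [hk, Multiset.sum_singleton] at h4
  rw [hk, h4]

lemma exists_equiv_of_card_le_five [Finite V] [Finite W] (hcard : Nat.card V = Nat.card W)
    (h3 : 3 ≤ Nat.card V) (h5 : Nat.card V ≤ 5)
    {π : Equiv.Perm V} {ρ : Equiv.Perm W} (hπ : ∀ x, π (π x) ≠ x) (hπ' : ∀ x, π x ≠ x)
    (hρ : ∀ x, ρ (ρ x) ≠ x) (hρ' : ∀ x, ρ x ≠ x) : ∃ e : V ≃ W, ∀ x, e (π x) = ρ (e x) := by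
  classical
  have := Fintype.ofFinite V
  rw [Nat.card_eq_fintype_card] at h3 h5
  refine exists_equiv_semiconj hcard π ρ fun e => ?_
  rw [cycleType_of_card_le_five h3 h5 hπ hπ', cycleType_of_card_le_five h3 h5]
  · intro x
    simp [Equiv.permCongr_apply, Equiv.symm_apply_eq, hρ]
  · intro x
    simp [Equiv.permCongr_apply, Equiv.symm_apply_eq, hρ']

lemma exists_equiv_add_one [Finite V] {n : ℕ} (hcard : Nat.card V = n) (h3 : 3 ≤ n) (h5 : n ≤ 5)
    {π : Equiv.Perm V} (hπ : ∀ x, π (π x) ≠ x) (hπ' : ∀ x, π x ≠ x) :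
    ∃ e : V ≃ ZMod n, ∀ x, e (π x) = e x + 1 := by
  have : NeZero n := ⟨by omega⟩
  have h1 : (1 : ZMod n) ≠ 0 := by
    simpa using ZMod.natCast_ne_zero_of_lt (n := n) one_pos (by omega)
  have h2 : (2 : ZMod n) ≠ 0 := by
    simpa using ZMod.natCast_ne_zero_of_lt (n := n) two_pos (by omega)
  refine exists_equiv_of_card_le_five (ρ := Equiv.addRight (1 : ZMod n))
    (by rw [hcard, Nat.card_zmod]) (by omega) (by omega) hπ hπ' ?_ ?_
  · intro x h
    simp only [Equiv.coe_addRight] at h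
    exact h2 (by linear_combination h)
  · intro x h
    simp only [Equiv.coe_addRight] at h
    exact h1 (by linear_combination h)

lemma exists_equiv_fin [Finite V] {n : ℕ} (hcard : Nat.card V = n) {f : Fin n → V}
    (hf : Function.Injective f) : ∃ e : Fin n ≃ V, ∀ i, e i = f i := by
  have h : Function.Bijective f := by
    have := Fintype.ofFinite V
    rw [Fintype.bijective_iff_injective_and_card]
    exact ⟨hf, by rw [Fintype.card_fin, ← Nat.card_eq_fintype_card, hcard]⟩
  exact ⟨Equiv.ofBijective f h, fun _ => rfl⟩

/-- Two disjoint perfect matchings on four vertices form a cycle. -/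
lemma exists_square [Finite V] (hcard : Nat.card V = 4) {α β : Equiv.Perm V}
    (hα : ∀ x, α (α x) = x) (hα' : ∀ x, α x ≠ x) (hβ : ∀ x, β (β x) = x) (hβ' : ∀ x, β x ≠ x)
    (hαβ : ∀ x, α x ≠ β x) :
    ∃ e : Fin 4 ≃ V, (∀ i, α (e i) = e (![1, 0, 3, 2] i)) ∧ ∀ i, β (e i) = e (![3, 2, 1, 0] i) := by
  have : Nonempty V := (Nat.card_pos_iff.1 (by omega)).1
  obtain ⟨x0⟩ := this
  -- The cycle is the walk from `x0` that follows `α` and `β` alternately.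
  obtain ⟨x1, h1⟩ : ∃ x1, x1 = α x0 := ⟨_, rfl⟩
  obtain ⟨x2, h2⟩ : ∃ x2, x2 = β x1 := ⟨_, rfl⟩
  obtain ⟨x3, h3⟩ : ∃ x3, x3 = α x2 := ⟨_, rfl⟩
  have h1' : α x1 = x0 := by rw [h1, hα]
  have h2' : β x2 = x1 := by rw [h2, hβ]
  have h3' : α x3 = x2 := by rw [h3, hα]
  have n01 : x0 ≠ x1 := h1 ▸ (hα' x0).symm
  have n12 : x1 ≠ x2 := h2 ▸ (hβ' x1).symm
  have n23 : x2 ≠ x3 := h3 ▸ (hα' x2).symm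
  have n02 : x0 ≠ x2 := by rw [← h1', h2]; exact hαβ x1
  have n03 : x0 ≠ x3 := by rw [← h1', h3]; exact α.injective.ne n12
  have n13 : x1 ≠ x3 := by rw [← h2', h3]; exact (hαβ x2).symm
  obtain ⟨e, he⟩ := exists_equiv_fin hcard (f := ![x0, x1, x2, x3]) (by
    intro i j h
    fin_cases i <;> fin_cases j <;> simp_all)
  have h4 : β x3 = x0 := by
    obtain ⟨i, hi⟩ := e.surjective (β x3)
    rw [he] at hi
    fin_cases i <;> simp only [Fin.zero_eta, Fin.mk_one, Fin.reduceFinMk, Matrix.cons_val] at hi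
    · exact hi.symm
    · exact (n23 (by rw [h2, hi, hβ])).elim
    · exact (n13 (by rw [← h2', hi, hβ])).elim
    · exact (hβ' _ hi.symm).elim
  have h4' : β x0 = x3 := by rw [← h4, hβ]
  refine ⟨e, fun i => ?_, fun i => ?_⟩ <;> rw [he, he] <;> fin_cases i
  exacts [h1.symm, h1', h3.symm, h3', h4', h2.symm, h2', h4]

/-- Two disjoint perfect matchings on six vertices form a cycle. -/
lemma exists_hexagon [Finite V] (hcard : Nat.card V = 6) {α β : Equiv.Perm V}
    (hα : ∀ x, α (α x) = x) (hα' : ∀ x, α x ≠ x) (hβ : ∀ x, β (β x) = x) (hβ' : ∀ x, β x ≠ x)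
    (hαβ : ∀ x, α x ≠ β x) :
    ∃ e : Fin 6 ≃ V, (∀ i, α (e i) = e (![1, 0, 3, 2, 5, 4] i)) ∧
      ∀ i, β (e i) = e (![5, 2, 1, 4, 3, 0] i) := by
  have : Nonempty V := (Nat.card_pos_iff.1 (by omega)).1
  obtain ⟨x0⟩ := this
  obtain ⟨x1, h1⟩ : ∃ x1, x1 = α x0 := ⟨_, rfl⟩
  obtain ⟨x2, h2⟩ : ∃ x2, x2 = β x1 := ⟨_, rfl⟩
  obtain ⟨x3, h3⟩ : ∃ x3, x3 = α x2 := ⟨_, rfl⟩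
  obtain ⟨x4, h4⟩ : ∃ x4, x4 = β x3 := ⟨_, rfl⟩
  obtain ⟨x5, h5⟩ : ∃ x5, x5 = α x4 := ⟨_, rfl⟩
  have h1' : α x1 = x0 := by rw [h1, hα]
  have h2' : β x2 = x1 := by rw [h2, hβ]
  have h3' : α x3 = x2 := by rw [h3, hα]
  have h4' : β x4 = x3 := by rw [h4, hβ]
  have h5' : α x5 = x4 := by rw [h5, hα]
  have n01 : x0 ≠ x1 := h1 ▸ (hα' x0).symm
  have n12 : x1 ≠ x2 := h2 ▸ (hβ' x1).symm
  have n23 : x2 ≠ x3 := h3 ▸ (hα' x2).symm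
  have n34 : x3 ≠ x4 := h4 ▸ (hβ' x3).symm
  have n45 : x4 ≠ x5 := h5 ▸ (hα' x4).symm
  have n02 : x0 ≠ x2 := by rw [← h1', h2]; exact hαβ x1
  have n13 : x1 ≠ x3 := by rw [← h2', h3]; exact (hαβ x2).symm
  have n24 : x2 ≠ x4 := by rw [← h3', h4]; exact hαβ x3
  have n35 : x3 ≠ x5 := by rw [← h4', h5]; exact (hαβ x4).symm
  have n03 : x0 ≠ x3 := by rw [← h1', h3]; exact α.injective.ne n12
  have n14 : x1 ≠ x4 := by rw [← h2', h4]; exact β.injective.ne n23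
  have n25 : x2 ≠ x5 := by rw [← h3', h5]; exact α.injective.ne n34
  -- If the walk closed up after four steps, its vertices would be closed under both matchings. A
  -- vertex `y` outside, together with `α y` and `β y`, would raise the number of vertices to seven.
  have n04 : x0 ≠ x4 := by
    intro h
    have hclosed : ∀ y, y ∉ ({x0, x1, x2, x3} : Set V) →
        α y ∉ ({x0, x1, x2, x3} : Set V) ∧ β y ∉ ({x0, x1, x2, x3} : Set V) := by
      intro y hy
      simp only [Set.mem_insert_iff, Set.mem_singleton_iff, not_or] at hy ⊢
      obtain ⟨y0, y1, y2, y3⟩ := hy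
      refine ⟨⟨fun h' => y1 ?_, fun h' => y0 ?_, fun h' => y3 ?_, fun h' => y2 ?_⟩,
        ⟨fun h' => y3 ?_, fun h' => y2 ?_, fun h' => y1 ?_, fun h' => y0 ?_⟩⟩
      · rw [h1, ← h', hα]
      · rw [← h1', ← h', hα]
      · rw [h3, ← h', hα]
      · rw [← h3', ← h', hα]
      · rw [← h4', ← h, ← h', hβ]
      · rw [h2, ← h', hβ]
      · rw [← h2', ← h', hβ]
      · rw [h, h4, ← h', hβ]
    have hex : ∃ y, y ∉ ({x0, x1, x2, x3} : Set V) := by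
      by_contra hno
      push Not at hno
      have h6 : (Set.univ : Set V) ⊆ {x0, x1, x2, x3} := fun y _ => hno y
      have h7 := Set.ncard_le_ncard h6
      rw [Set.ncard_univ, hcard] at h7
      have h8 := Set.ncard_insert_le x0 {x1, x2, x3}
      have h9 := Set.ncard_insert_le x1 {x2, x3}
      have h10 := Set.ncard_insert_le x2 {x3}
      rw [Set.ncard_singleton] at h10
      omega
    obtain ⟨y, hy⟩ := hex
    obtain ⟨hαy, hβy⟩ := hclosed y hy
    simp only [Set.mem_insert_iff, Set.mem_singleton_iff, not_or] at hy hαy hβy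
    have hnodup : [x0, x1, x2, x3, y, α y, β y].Nodup := by
      simp [n01, n02, n03, n12, n13, n23, hαβ y, (hα' y).symm, (hβ' y).symm, Ne.symm hy.1,
        Ne.symm hy.2.1, Ne.symm hy.2.2.1, Ne.symm hy.2.2.2, Ne.symm hαy.1, Ne.symm hαy.2.1,
        Ne.symm hαy.2.2.1, Ne.symm hαy.2.2.2, Ne.symm hβy.1, Ne.symm hβy.2.1, Ne.symm hβy.2.2.1,
        Ne.symm hβy.2.2.2]
    have := Fintype.ofFinite V
    have h6 := hnodup.length_le_card
    rw [← Nat.card_eq_fintype_card (α := V), hcard] at h6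
    simp at h6
  have n05 : x0 ≠ x5 := by rw [← h1', h5]; exact α.injective.ne n14
  have n15 : x1 ≠ x5 := by rw [h1, h5]; exact α.injective.ne n04
  obtain ⟨e, he⟩ := exists_equiv_fin hcard (f := ![x0, x1, x2, x3, x4, x5]) (by
    intro i j h
    fin_cases i <;> fin_cases j <;> simp_all)
  have h6 : β x5 = x0 := by
    obtain ⟨i, hi⟩ := e.surjective (β x5)
    rw [he] at hi
    fin_cases i <;> simp only [Fin.zero_eta, Fin.mk_one, Fin.reduceFinMk, Matrix.cons_val] at hi
    · exact hi.symm
    · exact (n25 (by rw [h2, hi, hβ])).elim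
    · exact (n15 (by rw [← h2', hi, hβ])).elim
    · exact (n45 (by rw [h4, hi, hβ])).elim
    · exact (n35 (by rw [← h4', hi, hβ])).elim
    · exact (hβ' _ hi.symm).elim
  have h6' : β x0 = x5 := by rw [← h6, hβ]
  refine ⟨e, fun i => ?_, fun i => ?_⟩ <;> rw [he, he] <;> fin_cases i
  exacts [h1.symm, h1', h3.symm, h3', h5.symm, h5', h6', h2.symm, h2', h4.symm, h4', h6]

end Permutations

namespace ECPOG

/-! ### Transfer of structure between graphs with equal parameters -/

section Transfer

variable {V W C : Type*} {G : ECPOG V C} {H : ECPOG W C} {c : C}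

lemma isUndirected_iff : G.IsUndirected ↔ ∀ c, G.IsUndirectedColor c :=
  ⟨fun h _ _ _ hc => hc.symm_of_adj (h _ _ hc.1), fun h _ _ hvw =>
    (h _ _ _ (exists_hasColor hvw).choose_spec).1⟩

lemma IsUndirectedColor.colorGraph_adj (h : G.IsUndirectedColor c) {v w : V} :
    (G.colorGraph c).Adj v w ↔ G.HasColor c v w := by
  rw [ECPOG.colorGraph_adj]
  exact ⟨fun h' => h'.elim id (h _ _), Or.inl⟩

/-- If only one color outside of `S` occurs, and it is undirected, then it joins the vertices that
are not joined in a color of `S`. -/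
lemma IsComplete.hasColor_iff_of_subsingleton (hG : G.IsComplete) {S : Set C}
    (hu : ∀ c ∉ S, G.IsUndirectedColor c) (hs : (G.edgeColors \ S).Subsingleton)
    (hc : c ∈ G.edgeColors \ S) {x y : V} :
    G.HasColor c x y ↔ x ≠ y ∧ ∀ d ∈ S, ¬ G.HasColor d x y ∧ ¬ G.HasColor d y x := by
  constructor
  · refine fun hxy => ⟨hxy.ne, fun d hd => ⟨fun h' => hc.2 ?_, fun h' => hc.2 ?_⟩⟩
    · rwa [hxy.unique h']
    · rwa [hxy.unique_swap h']
  · rintro ⟨hne, hd⟩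
    rcases hG x y hne with h' | h' <;> obtain ⟨d, hd'⟩ := exists_hasColor h'
    · rwa [hs hc ⟨⟨_, _, hd'⟩, fun h2 => (hd d h2).1 hd'⟩]
    · rw [hs hc ⟨⟨_, _, hd'⟩, fun h2 => (hd d h2).2 hd'⟩]
      exact hu _ (fun h2 => (hd d h2).2 hd') _ _ hd'

variable [Finite W]

lemma ParamEq.nonempty (h : ParamEq G H) (w : W) : Nonempty V := by
  have : Nonempty W := ⟨w⟩
  have h1 : 0 < Nat.card W := Nat.card_pos
  exact (Nat.card_pos_iff.1 (h.card ▸ h1)).1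

lemma ParamEq.isColorRegular (h : ParamEq G H) : H.IsColorRegular := by
  intro c x y
  obtain ⟨v⟩ := h.nonempty x
  obtain ⟨h1, h2, h3⟩ := h.deg c v x
  obtain ⟨h4, h5, h6⟩ := h.deg c v y
  exact ⟨h1.symm.trans h4, h2.symm.trans h5, h3.symm.trans h6⟩

lemma ParamEq.isUndirectedColor (h : ParamEq G H) (hc : G.IsUndirectedColor c) :
    H.IsUndirectedColor c := by
  intro x y hxy
  obtain ⟨v⟩ := h.nonempty x
  have h1 := (h.deg c v x).2.1
  rw [hc.outDegree, eq_comm, outDegree, Set.ncard_eq_zero] at h1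
  by_contra h2
  have h3 : y ∈ {w | H.HasColor c x w ∧ ¬ H.Adj w x} := ⟨hxy, fun h4 => h2 (hxy.symm_of_adj h4)⟩
  rw [h1] at h3
  exact h3

variable [Finite V]

lemma ParamEq.edgeColors_subset (h : ParamEq G H) : H.edgeColors ⊆ G.edgeColors := by
  rintro c ⟨x, y, hxy⟩
  obtain ⟨v⟩ := h.nonempty x
  have h1 := totalDegree_pos h.isColorRegular (mem_colors.2 ⟨x, y, hxy⟩) x
  rw [← h.totalDegree_eq c v x] at h1
  by_contra h2
  exact h1.ne' (totalDegree_eq_zero (mt mem_colors.1 h2) v)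

lemma ParamEq.edgeColors_eq (h : ParamEq G H) : G.edgeColors = H.edgeColors :=
  h.symm.edgeColors_subset.antisymm h.edgeColors_subset

lemma ParamEq.forall_totalDegree (h : ParamEq G H) {k : ℕ} (hk : ∀ v, G.totalDegree c v = k)
    (w : W) : H.totalDegree c w = k := by
  obtain ⟨v⟩ := h.nonempty w
  rw [← h.totalDegree_eq c v w, hk]

/-- An equivalence of the vertices that preserves all colors but one undirected color is an
isomorphism. -/
lemma ParamEq.nonempty_iso (h : ParamEq G H) (S : Set C) (e : V ≃ W)
    (he : ∀ c ∈ S, ∀ v w, G.HasColor c v w ↔ H.HasColor c (e v) (e w))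
    (hS : ∀ c ∉ S, G.IsUndirectedColor c) (hS' : (G.edgeColors \ S).Subsingleton) :
    Nonempty (G.Iso H) := by
  refine ⟨⟨e, fun c v w => ?_⟩⟩
  change _ ↔ H.HasColor c (e v) (e w)
  by_cases hcS : c ∈ S
  · exact he c hcS v w
  by_cases hc : c ∈ G.edgeColors
  · have hc' : c ∈ H.edgeColors := h.edgeColors_eq ▸ hc
    rw [h.left.hasColor_iff_of_subsingleton hS hS' ⟨hc, hcS⟩,
      h.right.hasColor_iff_of_subsingleton (fun d hd => h.isUndirectedColor (hS d hd))
        (h.edgeColors_eq ▸ hS') ⟨hc', hcS⟩, e.injective.ne_iff]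
    refine and_congr_right fun _ => forall₂_congr fun d hd => ?_
    rw [he d hd, he d hd]
  · exact iff_of_false (fun h' => hc ⟨_, _, h'⟩) fun h' => hc (h.edgeColors_subset ⟨_, _, h'⟩)

lemma IsUndirectedColor.exists_perm (hc : G.IsUndirectedColor c)
    (h1 : ∀ v, G.totalDegree c v = 1) : ∃ α : Equiv.Perm V,
      (∀ v w, G.HasColor c v w ↔ w = α v) ∧ (∀ v, α (α v) = v) ∧ ∀ v, α v ≠ v := by
  obtain ⟨α, hα⟩ := exists_perm_of_ncard_eq_one (R := G.HasColor c)
    (fun v => by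
      rw [← h1 v, ECPOG.totalDegree]
      simp only [hc.colorGraph_adj])
    fun v => by
      rw [← h1 v, ECPOG.totalDegree]
      simp only [hc.colorGraph_adj]
      congr 1
      ext w
      exact ⟨hc _ _, hc _ _⟩
  exact ⟨α, hα, fun v => ((hα _ _).1 (hc _ _ ((hα v _).2 rfl))).symm, fun v =>
    ((hα v _).2 rfl).ne.symm⟩

lemma IsDirectedColor.exists_perm (hc : G.IsDirectedColor c) (hreg : G.IsColorRegular)
    (h2 : ∀ v, G.totalDegree c v = 2) : ∃ π : Equiv.Perm V,
      (∀ v w, G.HasColor c v w ↔ w = π v) ∧ (∀ v, π (π v) ≠ v) ∧ ∀ v, π v ≠ v := by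
  have hout : ∀ v, G.outDegree c v = 1 := fun v => by
    have := hc.totalDegree hreg v
    have := h2 v
    omega
  obtain ⟨π, hπ⟩ := exists_perm_of_ncard_eq_one (R := G.HasColor c)
    (fun v => by
      rw [← hout v, ECPOG.outDegree]
      congr 1
      ext w
      exact ⟨fun h => ⟨h, hc.not_adj h⟩, fun h => h.1⟩)
    fun v => by
      rw [← hout v, ← hreg.inDegree_eq_outDegree, ECPOG.inDegree]
      congr 1
      ext w
      exact ⟨fun h => ⟨h, hc.not_adj h⟩, fun h => h.1⟩
  exact ⟨π, hπ, fun v h => hc.not_hasColor ((hπ v _).2 rfl) ((hπ _ _).2 h.symm), fun v =>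
    ((hπ v _).2 rfl).ne.symm⟩

/-- A balanced orientation of a 2-regular graph is the graph of a permutation, and antisymmetry
excludes 2-cycles. This makes undirected cycles accessible to the argument for directed ones. -/
lemma exists_perm_colorGraph (h2 : ∀ v, G.totalDegree c v = 2) : ∃ π : Equiv.Perm V,
    (∀ v w, (G.colorGraph c).Adj v w ↔ w = π v ∨ v = π w) ∧ (∀ v, π (π v) ≠ v) ∧
      ∀ v, π v ≠ v := by
  obtain ⟨R, hR, hR', hd⟩ := (G.colorGraph c).exists_balanced_orientation 1 h2
  obtain ⟨π, hπ⟩ := exists_perm_of_ncard_eq_one (fun v => (hd v).1) fun v => (hd v).2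
  have h3 : ∀ v, R v (π v) := fun v => (hπ v _).2 rfl
  refine ⟨π, fun v w => ⟨fun h => ?_, ?_⟩, fun v h => ?_, fun v => (hR _ _ (h3 v)).ne.symm⟩
  · by_cases h' : R v w
    · exact Or.inl ((hπ v w).1 h')
    · refine Or.inr ((hπ w v).1 ?_)
      by_contra h4
      exact h' ((hR' v w h).2 h4)
  · rintro (rfl | rfl)
    exacts [hR _ _ (h3 v), (hR _ _ (h3 w)).symm]
  · have h4 := h3 (π v)
    rw [h] at h4
    exact (hR' _ _ (hR _ _ (h3 v))).1 (h3 v) h4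

end Transfer

/-! ### Uniqueness from one color or from two matchings -/

section Uniqueness

universe u v

variable {V : Type u} {C : Type v} [Finite V] {G : ECPOG V C} {c c₁ c₂ : C}

lemma ParamEq.isDirectedColor {W : Type*} {H : ECPOG W C} (h : ParamEq G H) (hc : G.IsDirectedColor c) :
    H.IsDirectedColor c := by
  by_contra h'
  exact isUndirectedColor_iff.1 (h.symm.isUndirectedColor (isUndirectedColor_iff.2 h')) hc

lemma isParamUnique_of_subsingleton (hu : G.IsUndirected) (h : G.edgeColors.Subsingleton) :
    G.IsParamUnique := fun _ _ _ hH =>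
  hH.nonempty_iso ∅ (Finite.card_eq.1 hH.card).some (fun _ h => h.elim)
    (fun c _ => isUndirected_iff.1 hu c) (h.anti Set.sdiff_subset)

lemma isParamUnique_of_matching (hu : G.IsUndirected) (h1 : ∀ v, G.totalDegree c v = 1)
    (h : (G.edgeColors \ {c}).Subsingleton) : G.IsParamUnique := by
  intro W _ H hH
  have hc := isUndirected_iff.1 hu c
  obtain ⟨α, hα, hα1, hα2⟩ := hc.exists_perm h1
  obtain ⟨β, hβ, hβ1, hβ2⟩ := (hH.isUndirectedColor hc).exists_perm (hH.forall_totalDegree h1)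
  obtain ⟨e, he⟩ := exists_equiv_of_involutions hH.card hα1 hα2 hβ1 hβ2
  refine hH.nonempty_iso {c} e ?_ (fun c _ => isUndirected_iff.1 hu c) h
  rintro _ rfl v w
  rw [hα, hβ, ← he, e.apply_eq_iff_eq]

/-- The arcs of `c` form a permutation without fixed points or 2-cycles, unique up to conjugation on
at most five points; the rest is a single undirected color. -/
lemma isParamUnique_of_directed (hreg : G.IsColorRegular) (hV : 3 ≤ Nat.card V)
    (hV' : Nat.card V ≤ 5) (hc : G.IsDirectedColor c) (h2 : ∀ v, G.totalDegree c v = 2)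
    (hu : ∀ d, d ≠ c → G.IsUndirectedColor d) (h : (G.edgeColors \ {c}).Subsingleton) :
    G.IsParamUnique := by
  intro W _ H hH
  obtain ⟨π, hπ, hπ1, hπ2⟩ := hc.exists_perm hreg h2
  obtain ⟨ρ, hρ, hρ1, hρ2⟩ := (hH.isDirectedColor hc).exists_perm hH.isColorRegular
    (hH.forall_totalDegree h2)
  obtain ⟨e, he⟩ := exists_equiv_of_card_le_five hH.card hV hV' hπ1 hπ2 hρ1 hρ2
  refine hH.nonempty_iso {c} e ?_ hu h
  rintro _ rfl v w
  rw [hπ, hρ, ← he, e.apply_eq_iff_eq]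

lemma isParamUnique_of_cycle (hV : 3 ≤ Nat.card V) (hV' : Nat.card V ≤ 5) (hu : G.IsUndirected)
    (h2 : ∀ v, G.totalDegree c v = 2) (h : (G.edgeColors \ {c}).Subsingleton) :
    G.IsParamUnique := by
  intro W _ H hH
  have hc := isUndirected_iff.1 hu c
  obtain ⟨π, hπ, hπ1, hπ2⟩ := exists_perm_colorGraph h2
  obtain ⟨ρ, hρ, hρ1, hρ2⟩ := exists_perm_colorGraph (hH.forall_totalDegree h2)
  obtain ⟨e, he⟩ := exists_equiv_of_card_le_five hH.card hV hV' hπ1 hπ2 hρ1 hρ2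
  refine hH.nonempty_iso {c} e ?_ (fun c _ => isUndirected_iff.1 hu c) h
  rintro _ rfl v w
  rw [← hc.colorGraph_adj, ← (hH.isUndirectedColor hc).colorGraph_adj, hπ, hρ, ← he, ← he,
    e.apply_eq_iff_eq, e.apply_eq_iff_eq]

/-- Two disjoint perfect matchings form alternating cycles of length at least four, and on four or
six vertices there is room for only one. -/
lemma isParamUnique_of_two_matchings (hV : Nat.card V = 4 ∨ Nat.card V = 6) (hu : G.IsUndirected)
    (hc : c₁ ≠ c₂) (h1 : ∀ v, G.totalDegree c₁ v = 1) (h2 : ∀ v, G.totalDegree c₂ v = 1)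
    (h : (G.edgeColors \ {c₁, c₂}).Subsingleton) : G.IsParamUnique := by
  intro W _ H hH
  have hc₁ := isUndirected_iff.1 hu c₁
  have hc₂ := isUndirected_iff.1 hu c₂
  obtain ⟨α, hα, hα1, hα2⟩ := hc₁.exists_perm h1
  obtain ⟨β, hβ, hβ1, hβ2⟩ := hc₂.exists_perm h2
  obtain ⟨α', hα', hα1', hα2'⟩ := (hH.isUndirectedColor hc₁).exists_perm (hH.forall_totalDegree h1)
  obtain ⟨β', hβ', hβ1', hβ2'⟩ := (hH.isUndirectedColor hc₂).exists_perm (hH.forall_totalDegree h2)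
  have hne : ∀ x, α x ≠ β x := fun x h' => hc (((hα x _).2 rfl).unique ((hβ x _).2 h'))
  have hne' : ∀ x, α' x ≠ β' x := fun x h' => hc (((hα' x _).2 rfl).unique ((hβ' x _).2 h'))
  obtain ⟨e, he, he'⟩ : ∃ e : V ≃ W, (∀ x, e (α x) = α' (e x)) ∧ ∀ x, e (β x) = β' (e x) := by
    rcases hV with hV | hV
    · obtain ⟨e, he1, he2⟩ := exists_square hV hα1 hα2 hβ1 hβ2 hne
      obtain ⟨f, hf1, hf2⟩ := exists_square (hH.card ▸ hV) hα1' hα2' hβ1' hβ2' hne'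
      refine ⟨e.symm.trans f, fun x => ?_, fun x => ?_⟩ <;> obtain ⟨i, rfl⟩ := e.surjective x
      · simp [he1, hf1]
      · simp [he2, hf2]
    · obtain ⟨e, he1, he2⟩ := exists_hexagon hV hα1 hα2 hβ1 hβ2 hne
      obtain ⟨f, hf1, hf2⟩ := exists_hexagon (hH.card ▸ hV) hα1' hα2' hβ1' hβ2' hne'
      refine ⟨e.symm.trans f, fun x => ?_, fun x => ?_⟩ <;> obtain ⟨i, rfl⟩ := e.surjective x
      · simp [he1, hf1]
      · simp [he2, hf2]
  refine hH.nonempty_iso {c₁, c₂} e ?_ (fun c _ => isUndirected_iff.1 hu c) h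
  rintro _ (rfl | rfl) v w
  · rw [hα, hα', ← he, e.apply_eq_iff_eq]
  · rw [hβ, hβ', ← he', e.apply_eq_iff_eq]

end Uniqueness

end ECPOG

/-! ### Four matchings on six vertices and the tournament on five -/

section SmallConfigurations

variable {V : Type*} [Finite V]

/-- A fixed-point-free involution of a hexagon without its sides. -/
lemma eq_of_involution_of_hexagon (σ : Fin 6 → Fin 6) (h : ∀ i, σ (σ i) = i) (h0 : ∀ i, σ i ≠ i)
    (h1 : ∀ i, σ i ≠ ![1, 0, 3, 2, 5, 4] i) (h2 : ∀ i, σ i ≠ ![5, 2, 1, 4, 3, 0] i) :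
    ∃ k : Fin 4, σ = ![![3, 4, 5, 0, 1, 2], ![3, 5, 4, 0, 2, 1], ![2, 4, 0, 5, 1, 3],
      ![4, 3, 5, 1, 0, 2]] k := by
  -- The image of each `i` is one of the three vertices that are neither `i` nor its neighbors on
  -- the hexagon, which leaves `3 ^ 6` candidates.
  have key : ∀ s0 ∈ ({2, 3, 4} : Finset (Fin 6)),
      ∀ s1 ∈ ({3, 4, 5} : Finset (Fin 6)),
      ∀ s2 ∈ ({0, 4, 5} : Finset (Fin 6)),
      ∀ s3 ∈ ({0, 1, 5} : Finset (Fin 6)),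
      ∀ s4 ∈ ({0, 1, 2} : Finset (Fin 6)),
      ∀ s5 ∈ ({1, 2, 3} : Finset (Fin 6)),
      (∀ i : Fin 6, ![s0, s1, s2, s3, s4, s5] (![s0, s1, s2, s3, s4, s5] i) = i) →
      ∃ k : Fin 4, ![s0, s1, s2, s3, s4, s5] = ![![3, 4, 5, 0, 1, 2], ![3, 5, 4, 0, 2, 1],
        ![2, 4, 0, 5, 1, 3], ![4, 3, 5, 1, 0, 2]] k := by
    set_option maxRecDepth 100000 in decide
  have hσ : σ = ![σ 0, σ 1, σ 2, σ 3, σ 4, σ 5] := by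
    ext i
    fin_cases i <;> rfl
  rw [hσ]
  have hmem : ∀ i : Fin 6, ∀ x : Fin 6, x ≠ i → x ≠ ![1, 0, 3, 2, 5, 4] i →
      x ≠ ![5, 2, 1, 4, 3, 0] i → x ∈ ![({2, 3, 4} : Finset (Fin 6)), {3, 4, 5}, {0, 4, 5},
        {0, 1, 5}, {0, 1, 2}, {1, 2, 3}] i := by
    decide
  have hσ' := fun i => hmem i _ (h0 i) (h1 i) (h2 i)
  exact key _ (hσ' 0) _ (hσ' 1) _ (hσ' 2) _ (hσ' 3) _ (hσ' 4) _ (hσ' 5) (hσ ▸ h)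

/-- Four disjoint perfect matchings on six vertices are unique up to isomorphism. -/
lemma exists_hexagon_of_four_matchings (hcard : Nat.card V = 6) {α β γ δ : Equiv.Perm V}
    (hα : ∀ x, α (α x) = x) (hα' : ∀ x, α x ≠ x) (hβ : ∀ x, β (β x) = x) (hβ' : ∀ x, β x ≠ x)
    (hγ : ∀ x, γ (γ x) = x) (hγ' : ∀ x, γ x ≠ x) (hδ : ∀ x, δ (δ x) = x) (hδ' : ∀ x, δ x ≠ x)
    (hαβ : ∀ x, α x ≠ β x) (hγα : ∀ x, γ x ≠ α x) (hγβ : ∀ x, γ x ≠ β x) (hδα : ∀ x, δ x ≠ α x)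
    (hδβ : ∀ x, δ x ≠ β x) (hγδ : ∀ x, γ x ≠ δ x) :
    ∃ e : Fin 6 ≃ V, (∀ i, α (e i) = e (![1, 0, 3, 2, 5, 4] i)) ∧
      (∀ i, β (e i) = e (![5, 2, 1, 4, 3, 0] i)) ∧ (∀ i, γ (e i) = e (![2, 4, 0, 5, 1, 3] i)) ∧
      ∀ i, δ (e i) = e (![4, 3, 5, 1, 0, 2] i) := by
  obtain ⟨e, he1, he2⟩ := exists_hexagon hcard hα hα' hβ hβ' hαβ
  have key : ∀ {σ : Equiv.Perm V}, (∀ x, σ (σ x) = x) → (∀ x, σ x ≠ x) → (∀ x, σ x ≠ α x) →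
      (∀ x, σ x ≠ β x) → ∃ k : Fin 4, ∀ i, σ (e i) = e (![![3, 4, 5, 0, 1, 2],
        ![3, 5, 4, 0, 2, 1], ![2, 4, 0, 5, 1, 3], ![4, 3, 5, 1, 0, 2]] k i) := by
    intro σ h h' ha hb
    obtain ⟨k, hk⟩ := eq_of_involution_of_hexagon (fun i => e.symm (σ (e i))) (fun i => by simp [h])
      (fun i hi => h' (e i) (e.symm_apply_eq.1 hi))
      (fun i hi => ha (e i) (by rw [he1]; exact e.symm_apply_eq.1 hi))
      (fun i hi => hb (e i) (by rw [he2]; exact e.symm_apply_eq.1 hi))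
    exact ⟨k, fun i => e.symm_apply_eq.1 (congrFun hk i)⟩
  obtain ⟨k, hk⟩ := key hγ hγ' hγα hγβ
  obtain ⟨l, hl⟩ := key hδ hδ' hδα hδβ
  obtain ⟨i, hi⟩ | ⟨s, hs, hs1, hs2, hs3, hs4⟩ : (∃ i, ![![3, 4, 5, 0, 1, 2], ![3, 5, 4, 0, 2, 1],
      ![2, 4, 0, 5, 1, 3], ![4, 3, 5, 1, 0, 2]] k i = ![![3, 4, 5, 0, 1, 2], ![3, 5, 4, 0, 2, 1],
      ![2, 4, 0, 5, 1, 3], ![4, 3, 5, 1, 0, (2 : Fin 6)]] l i) ∨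
      ∃ s : Fin 6 → Fin 6, (∀ i j, s i = s j → i = j) ∧
        (∀ i, ![1, 0, 3, 2, 5, 4] (s i) = s (![1, 0, 3, 2, 5, 4] i)) ∧
        (∀ i, ![5, 2, 1, 4, 3, 0] (s i) = s (![5, 2, 1, 4, 3, 0] i)) ∧
        (∀ i, ![![3, 4, 5, 0, 1, 2], ![3, 5, 4, 0, 2, 1],
          ![2, 4, 0, 5, 1, 3], ![4, 3, 5, 1, 0, 2]] k (s i) = s (![2, 4, 0, 5, 1, 3] i)) ∧
        ∀ i, ![![3, 4, 5, 0, 1, 2], ![3, 5, 4, 0, 2, 1],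
          ![2, 4, 0, 5, 1, 3], ![4, 3, 5, 1, 0, 2]] l (s i) = s (![4, 3, 5, 1, 0, 2] i) := by
    -- The antipodal matching shares an edge with each of the other three, so it is excluded. The
    -- rotations `i ↦ r + i` with `r` even and the reflections `i ↦ r - i` with `r` odd preserve
    -- both matchings of the hexagon, and they permute the other three matchings in all six ways.
    suffices h : ∀ k l : Fin 4, (∃ i, ![![3, 4, 5, 0, 1, 2], ![3, 5, 4, 0, 2, 1],
      ![2, 4, 0, 5, 1, 3], ![4, 3, 5, 1, 0, 2]] k i = ![![3, 4, 5, 0, 1, 2], ![3, 5, 4, 0, 2, 1],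
      ![2, 4, 0, 5, 1, 3], ![4, 3, 5, 1, 0, (2 : Fin 6)]] l i) ∨
      ∃ r : Fin 6, let s : Fin 6 → Fin 6 := fun i => if r.val % 2 = 0 then r + i else r - i
        (∀ i j, s i = s j → i = j) ∧
        (∀ i, ![1, 0, 3, 2, 5, 4] (s i) = s (![1, 0, 3, 2, 5, 4] i)) ∧
        (∀ i, ![5, 2, 1, 4, 3, 0] (s i) = s (![5, 2, 1, 4, 3, 0] i)) ∧
        (∀ i, ![![3, 4, 5, 0, 1, 2], ![3, 5, 4, 0, 2, 1],
          ![2, 4, 0, 5, 1, 3], ![4, 3, 5, 1, 0, 2]] k (s i) = s (![2, 4, 0, 5, 1, 3] i)) ∧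
        ∀ i, ![![3, 4, 5, 0, 1, 2], ![3, 5, 4, 0, 2, 1],
          ![2, 4, 0, 5, 1, 3], ![4, 3, 5, 1, 0, 2]] l (s i) = s (![4, 3, 5, 1, 0, 2] i) from
      (h k l).imp id fun ⟨_, hr⟩ => ⟨_, hr⟩
    set_option maxRecDepth 100000 in decide
  · exact (hγδ (e i) (by rw [hk, hl, hi])).elim
  · obtain ⟨f, hf⟩ := exists_equiv_fin hcard (f := fun i => e (s i)) fun i j h =>
      hs i j (e.injective h)
    refine ⟨f, fun i => ?_, fun i => ?_, fun i => ?_, fun i => ?_⟩ <;> rw [hf, hf]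
    · rw [he1, hs1]
    · rw [he2, hs2]
    · rw [hk, hs3]
    · rw [hl, hs4]

/-- The regular tournament on five vertices. -/
lemma exists_equiv_of_tournament (hcard : Nat.card V = 5) {R : V → V → Prop}
    (hR : ∀ v w, v ≠ w → (R v w ↔ ¬ R w v)) (hR' : ∀ v, ¬ R v v)
    (hout : ∀ v, {w | R v w}.ncard = 2) :
    ∃ e : Fin 5 ≃ V, ∀ i j, R (e i) (e j) ↔ j = i + 1 ∨ j = i + 2 := by
  have hpair : ∀ {v x y}, R v x → R v y → x ≠ y → ∀ w, R v w ↔ w = x ∨ w = y := by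
    intro v x y hx hy hxy w
    have h1 : ({x, y} : Set V) ⊆ {w | R v w} := by
      rintro _ (rfl | rfl)
      exacts [hx, hy]
    have h2 := Set.eq_of_subset_of_ncard_le h1 (by rw [hout, Set.ncard_pair hxy])
    exact (Set.ext_iff.1 h2 w).symm
  have hne : ∀ {v w}, R v w → v ≠ w := by
    rintro v _ h rfl
    exact hR' _ h
  -- Let `a → b` be the out-neighbors of `v`, `c` the second out-neighbor of `a`, and `d` the last
  -- vertex. The outdegrees then force all other arcs, with cyclic order `v, a, b, c, d`.
  obtain ⟨v⟩ : Nonempty V := (Nat.card_pos_iff.1 (by omega)).1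
  obtain ⟨a, b, hv, hab⟩ : ∃ a b, (∀ w, R v w ↔ w = a ∨ w = b) ∧ R a b := by
    obtain ⟨x, y, hxy, h⟩ := Set.ncard_eq_two.1 (hout v)
    have h1 : ∀ w, R v w ↔ w = x ∨ w = y := fun w => Set.ext_iff.1 h w
    by_cases h2 : R x y
    · exact ⟨x, y, h1, h2⟩
    · exact ⟨y, x, fun w => (h1 w).trans or_comm, (hR _ _ hxy.symm).2 h2⟩
  obtain ⟨c, hcb, ha⟩ : ∃ c, c ≠ b ∧ ∀ w, R a w ↔ w = b ∨ w = c := by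
    obtain ⟨x, y, hxy, h⟩ := Set.ncard_eq_two.1 (hout a)
    have h1 : ∀ w, R a w ↔ w = x ∨ w = y := fun w => Set.ext_iff.1 h w
    rcases (h1 b).1 hab with rfl | rfl
    · exact ⟨y, hxy.symm, h1⟩
    · exact ⟨x, hxy, fun w => (h1 w).trans or_comm⟩
  have hva : R v a := (hv a).2 (Or.inl rfl)
  have hvb : R v b := (hv b).2 (Or.inr rfl)
  have hac : R a c := (ha c).2 (Or.inr rfl)
  have hcv : c ≠ v := by
    rintro rfl
    exact (hR _ _ (hne hva)).1 hva hac
  obtain ⟨d, hdv, hda, hdb, hdc⟩ : ∃ d, d ≠ v ∧ d ≠ a ∧ d ≠ b ∧ d ≠ c := by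
    by_contra hno
    push Not at hno
    have h6 : (Set.univ : Set V) ⊆ {v, a, b, c} := fun y _ => by
      simp only [Set.mem_insert_iff, Set.mem_singleton_iff]
      have := hno y
      tauto
    have h7 := Set.ncard_le_ncard h6
    rw [Set.ncard_univ, hcard] at h7
    have h8 := Set.ncard_insert_le v {a, b, c}
    have h9 := Set.ncard_insert_le a {b, c}
    have h10 := Set.ncard_insert_le b {c}
    rw [Set.ncard_singleton] at h10
    omega
  have h1 : R c v := (hR _ _ hcv).2 fun h => ((hv c).1 h).elim (hne hac).symm hcb
  have h2 : R d v := (hR _ _ hdv).2 fun h => ((hv d).1 h).elim hda hdb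
  have h3 : R d a := (hR _ _ hda).2 fun h => ((ha d).1 h).elim hdb hdc
  have hd := hpair h2 h3 (hne hva)
  have h4 : R b d := (hR _ _ hdb.symm).2 fun h => ((hd b).1 h).elim (hne hvb).symm (hne hab).symm
  have h5 : R c d := (hR _ _ hdc.symm).2 fun h => ((hd c).1 h).elim hcv (hne hac).symm
  have hc := hpair h5 h1 hdv
  have h6 : R b c := (hR _ _ hcb.symm).2 fun h => ((hc b).1 h).elim hdb.symm (hne hvb).symm
  have hb := hpair h6 h4 hdc.symm
  have hnodup : [v, a, b, c, d].Nodup := by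
    simp [hne hva, hne hvb, hcv.symm, hdv.symm, hne hab, hne hac, hda.symm, hcb.symm, hdb.symm,
      hdc.symm]
  obtain ⟨e, he⟩ := exists_equiv_fin hcard (f := ![v, a, b, c, d])
    (List.nodup_ofFn.1 (by simpa [List.ofFn_succ] using hnodup))
  have key : ∀ i w, R (e i) w ↔ w = e (i + 1) ∨ w = e (i + 2) := by
    intro i w
    rw [he, he, he]
    fin_cases i
    exacts [hv w, ha w, hb w, hc w, hd w]
  exact ⟨e, fun i j => by rw [key, e.apply_eq_iff_eq, e.apply_eq_iff_eq]⟩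

end SmallConfigurations

namespace ECPOG

universe u v

variable {V : Type u} {C : Type v} [Finite V] {G : ECPOG V C} {c : C}

/-- Four of the five matchings can be put into standard position simultaneously, and the fifth
consists of the remaining edges. -/
lemma isParamUnique_of_matchings (hV : Nat.card V = 6) (hu : G.IsUndirected)
    (h1 : ∀ c ∈ G.edgeColors, ∀ v, G.totalDegree c v = 1) (h5 : G.edgeColors.ncard = 5) :
    G.IsParamUnique := by
  obtain ⟨c₁, s₁, hc₁, hs₁, h4⟩ := Set.eq_insert_of_ncard_eq_succ h5
  obtain ⟨c₂, s₂, hc₂, rfl, h3⟩ := Set.eq_insert_of_ncard_eq_succ h4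
  obtain ⟨c₃, s₃, hc₃, rfl, h2⟩ := Set.eq_insert_of_ncard_eq_succ h3
  obtain ⟨c₄, s₄, hc₄, rfl, h1'⟩ := Set.eq_insert_of_ncard_eq_succ h2
  obtain ⟨c₅, rfl⟩ := Set.ncard_eq_one.1 h1'
  simp only [Set.mem_insert_iff, Set.mem_singleton_iff, not_or] at hc₁ hc₂ hc₃ hc₄
  have hd₁ := h1 c₁ (hs₁ ▸ by simp)
  have hd₂ := h1 c₂ (hs₁ ▸ by simp)
  have hd₃ := h1 c₃ (hs₁ ▸ by simp)
  have hd₄ := h1 c₄ (hs₁ ▸ by simp)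
  have key : ∀ {W : Type u} [Finite W] {K : ECPOG W C}, Nat.card W = 6 →
      (∀ c, K.IsUndirectedColor c) → (∀ v, K.totalDegree c₁ v = 1) →
      (∀ v, K.totalDegree c₂ v = 1) → (∀ v, K.totalDegree c₃ v = 1) →
      (∀ v, K.totalDegree c₄ v = 1) → ∃ e : Fin 6 ≃ W,
        (∀ i j, K.HasColor c₁ (e i) (e j) ↔ j = ![1, 0, 3, 2, 5, 4] i) ∧
        (∀ i j, K.HasColor c₂ (e i) (e j) ↔ j = ![5, 2, 1, 4, 3, 0] i) ∧
        (∀ i j, K.HasColor c₃ (e i) (e j) ↔ j = ![2, 4, 0, 5, 1, 3] i) ∧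
        (∀ i j, K.HasColor c₄ (e i) (e j) ↔ j = ![4, 3, 5, 1, 0, 2] i) := by
    intro W _ K hW hK h₁ h₂ h₃ h₄
    obtain ⟨α, hα, hα1, hα2⟩ := (hK c₁).exists_perm h₁
    obtain ⟨β, hβ, hβ1, hβ2⟩ := (hK c₂).exists_perm h₂
    obtain ⟨γ, hγ, hγ1, hγ2⟩ := (hK c₃).exists_perm h₃
    obtain ⟨δ, hδ, hδ1, hδ2⟩ := (hK c₄).exists_perm h₄
    have hne : ∀ {c c' : C} {σ τ : Equiv.Perm W}, (∀ v w, K.HasColor c v w ↔ w = σ v) →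
        (∀ v w, K.HasColor c' v w ↔ w = τ v) → c ≠ c' → ∀ x, σ x ≠ τ x :=
      fun h h' hc x hx => hc (((h x _).2 rfl).unique ((h' x _).2 hx))
    obtain ⟨e, he1, he2, he3, he4⟩ := exists_hexagon_of_four_matchings hW hα1 hα2 hβ1 hβ2 hγ1 hγ2
      hδ1 hδ2 (hne hα hβ hc₁.1) (hne hγ hα (Ne.symm hc₁.2.1)) (hne hγ hβ (Ne.symm hc₂.1))
      (hne hδ hα (Ne.symm hc₁.2.2.1)) (hne hδ hβ (Ne.symm hc₂.2.1)) (hne hγ hδ hc₃.1)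
    refine ⟨e, fun i j => ?_, fun i j => ?_, fun i j => ?_, fun i j => ?_⟩
    · rw [hα, he1, e.apply_eq_iff_eq]
    · rw [hβ, he2, e.apply_eq_iff_eq]
    · rw [hγ, he3, e.apply_eq_iff_eq]
    · rw [hδ, he4, e.apply_eq_iff_eq]
  intro W _ H hH
  have hu' := isUndirected_iff.1 hu
  obtain ⟨e, he1, he2, he3, he4⟩ := key hV hu' hd₁ hd₂ hd₃ hd₄
  obtain ⟨f, hf1, hf2, hf3, hf4⟩ := key (hH.card ▸ hV) (fun c => hH.isUndirectedColor (hu' c))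
    (hH.forall_totalDegree hd₁) (hH.forall_totalDegree hd₂) (hH.forall_totalDegree hd₃)
    (hH.forall_totalDegree hd₄)
  refine hH.nonempty_iso {c₁, c₂, c₃, c₄} (e.symm.trans f) ?_ (fun c _ => hu' c) ?_
  · intro c hc v w
    obtain ⟨i, rfl⟩ := e.surjective v
    obtain ⟨j, rfl⟩ := e.surjective w
    simp only [Equiv.trans_apply, Equiv.symm_apply_apply]
    rcases hc with rfl | rfl | rfl | rfl
    · rw [he1, hf1]
    · rw [he2, hf2]
    · rw [he3, hf3]
    · rw [he4, hf4]
  · rw [← hs₁]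
    refine (Set.subsingleton_singleton (a := c₅)).anti ?_
    rintro c ⟨hc, hc'⟩
    simp only [Set.mem_insert_iff, Set.mem_singleton_iff] at hc hc' ⊢
    tauto

lemma IsDirectedColor.exists_equiv_fin_five (hc : G.IsDirectedColor c) (hG : G.IsComplete)
    (hreg : G.IsColorRegular) (hV : Nat.card V = 5) (h : G.edgeColors = {c}) :
    ∃ e : Fin 5 ≃ V, ∀ i j, G.HasColor c (e i) (e j) ↔ j = i + 1 ∨ j = i + 2 := by
  have hadj : ∀ {v w}, G.Adj v w → G.HasColor c v w := fun hvw => by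
    obtain ⟨d, hd⟩ := exists_hasColor hvw
    have hd' : d ∈ G.edgeColors := ⟨_, _, hd⟩
    rw [h] at hd'
    rwa [Set.mem_singleton_iff.1 hd'] at hd
  refine exists_equiv_of_tournament hV (fun v w hvw => ⟨hc.not_hasColor, fun h' => ?_⟩)
    (not_hasColor_self G c) fun v => ?_
  · rcases hG v w hvw with h1 | h1
    exacts [hadj h1, (h' (hadj h1)).elim]
  · have h1 := sum_totalDegree hG v
    have h2 : G.colors = {c} := by
      ext d
      rw [mem_colors, h, Set.mem_singleton_iff, Finset.mem_singleton]
    rw [h2, Finset.sum_singleton, hc.totalDegree hreg, hV] at h1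
    have h3 : {w | G.HasColor c v w}.ncard = G.outDegree c v := by
      rw [ECPOG.outDegree]
      congr 1
      ext w
      exact ⟨fun h => ⟨h, hc.not_adj h⟩, fun h => h.1⟩
    omega

lemma isParamUnique_of_tournament (hG : G.IsComplete) (hreg : G.IsColorRegular)
    (hV : Nat.card V = 5) (h : G.edgeColors = {c}) (hc : G.IsDirectedColor c) :
    G.IsParamUnique := by
  intro W _ H hH
  obtain ⟨e, he⟩ := hc.exists_equiv_fin_five hG hreg hV h
  obtain ⟨f, hf⟩ := (hH.isDirectedColor hc).exists_equiv_fin_five hH.right hH.isColorRegular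
    (hH.card ▸ hV) (hH.edgeColors_eq ▸ h)
  refine ⟨⟨e.symm.trans f, fun d v w => ?_⟩⟩
  change _ ↔ H.HasColor d ((e.symm.trans f) v) ((e.symm.trans f) w)
  obtain ⟨i, rfl⟩ := e.surjective v
  obtain ⟨j, rfl⟩ := e.surjective w
  simp only [Equiv.trans_apply, Equiv.symm_apply_apply]
  by_cases hd : d ∈ G.edgeColors
  · obtain rfl : d = c := by rwa [h] at hd
    rw [he, hf]
  · exact iff_of_false (fun h' => hd ⟨_, _, h'⟩) fun h' => hd (hH.edgeColors_subset ⟨_, _, h'⟩)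

end ECPOG

namespace ECPOG

/-! ### The listed types in terms of degrees -/

section Types

variable {V C : Type*} {G : ECPOG V C} {c : C} {n : ℕ}

lemma isMatchingColor_iff :
    G.IsMatchingColor c ↔ G.IsUndirectedColor c ∧ ∀ v, G.totalDegree c v = 1 := by
  rw [IsMatchingColor, SimpleGraph.Subgraph.isPerfectMatching_iff]
  refine and_congr_right fun _ => forall_congr' fun v => ?_
  rw [totalDegree, Set.ncard_eq_one]
  simp only [SimpleGraph.Subgraph.top_adj]
  constructor
  · rintro ⟨w, hw, h⟩
    refine ⟨w, Set.ext fun x => ⟨h x, ?_⟩⟩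
    rintro rfl
    exact hw
  · rintro ⟨w, hw⟩
    exact ⟨w, (Set.ext_iff.1 hw w).2 rfl, fun x => (Set.ext_iff.1 hw x).1⟩

lemma isUndirectedColor_of_notMem (h : c ∉ G.edgeColors) : G.IsUndirectedColor c :=
  fun _ _ h' => (h ⟨_, _, h'⟩).elim

lemma IsUndirectedCycleColor.totalDegree (h : G.IsUndirectedCycleColor n c) (hn : 3 ≤ n) (v : V) :
    G.totalDegree c v = 2 := by
  obtain ⟨m, rfl⟩ := Nat.exists_eq_add_of_le' hn
  obtain ⟨φ⟩ := h.2
  rw [ECPOG.totalDegree, ← SimpleGraph.cycleGraph_degree_three_le (v := φ v),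
    ← SimpleGraph.card_neighborSet_eq_degree, ← Nat.card_eq_fintype_card,
    Nat.card_coe_set_eq, ← Set.ncard_image_of_injective _ φ.injective]
  congr 1
  ext w
  simp only [Set.mem_image, Set.mem_ofPred_eq, SimpleGraph.mem_neighborSet]
  constructor
  · rintro ⟨x, hx, rfl⟩
    exact φ.map_adj_iff.2 hx
  · intro hw
    obtain ⟨x, rfl⟩ := φ.surjective w
    exact ⟨x, φ.map_adj_iff.1 hw, rfl⟩

lemma IsDirectedCycleColor.card (h : G.IsDirectedCycleColor n c) : Nat.card V = n := by
  obtain ⟨e, -⟩ := h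
  rw [Nat.card_congr e, Nat.card_zmod]

lemma IsDirectedCycleColor.not_hasColor_swap (h : G.IsDirectedCycleColor n c) (hn : 3 ≤ n)
    {v w : V} (hvw : G.HasColor c v w) : ¬ G.HasColor c w v := by
  obtain ⟨e, he⟩ := h
  intro h'
  rw [he] at hvw h'
  have h2 : (2 : ZMod n) ≠ 0 := by
    simpa using ZMod.natCast_ne_zero_of_lt (n := n) two_pos (by omega)
  exact h2 (by linear_combination - hvw - h')

lemma IsDirectedCycleColor.isDirectedColor (h : G.IsDirectedCycleColor n c) (hn : 3 ≤ n) :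
    G.IsDirectedColor c := by
  obtain ⟨e, he⟩ := id h
  have h0 : G.HasColor c (e.symm 0) (e.symm 1) := by simp [he]
  exact ⟨_, _, h0, fun h' => h.not_hasColor_swap hn h0 (h0.symm_of_adj h')⟩

variable [Finite V]

lemma IsDirectedCycleColor.totalDegree (hreg : G.IsColorRegular) (h : G.IsDirectedCycleColor n c)
    (hn : 3 ≤ n) (v : V) : G.totalDegree c v = 2 := by
  have hd := h.isDirectedColor hn
  obtain ⟨e, he⟩ := h
  rw [hd.totalDegree hreg, outDegree]
  suffices h : {w | G.HasColor c v w ∧ ¬ G.Adj w v} = {e.symm (e v + 1)} by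
    rw [h, Set.ncard_singleton]
  ext w
  rw [Set.mem_singleton_iff, Equiv.eq_symm_apply, ← he]
  exact ⟨fun h => h.1, fun h => ⟨h, hd.not_adj h⟩⟩

lemma IsUndirectedColor.isUndirectedCycleColor (hu : G.IsUndirectedColor c)
    (hV : Nat.card V = n) (h3 : 3 ≤ n) (h5 : n ≤ 5) (h2 : ∀ v, G.totalDegree c v = 2) :
    G.IsUndirectedCycleColor n c := by
  obtain ⟨π, hπ, hπ1, hπ2⟩ := exists_perm_colorGraph h2
  obtain ⟨e, he⟩ := exists_equiv_add_one hV h3 h5 hπ1 hπ2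
  obtain ⟨m, rfl⟩ := Nat.exists_eq_add_of_le' h3
  refine ⟨hu, ⟨⟨e, fun {v w} => ?_⟩⟩⟩
  rw [hπ]
  refine SimpleGraph.cycleGraph_adj.trans ?_
  change (e v - e w = 1 ∨ e w - e v = 1) ↔ _
  rw [← e.apply_eq_iff_eq, he, ← e.apply_eq_iff_eq, he, sub_eq_iff_eq_add', sub_eq_iff_eq_add',
    or_comm]

lemma IsDirectedColor.isDirectedCycleColor (hd : G.IsDirectedColor c) (hreg : G.IsColorRegular)
    (hV : Nat.card V = n) (h3 : 3 ≤ n) (h5 : n ≤ 5) (h2 : ∀ v, G.totalDegree c v = 2) :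
    G.IsDirectedCycleColor n c := by
  obtain ⟨π, hπ, hπ1, hπ2⟩ := hd.exists_perm hreg h2
  obtain ⟨e, he⟩ := exists_equiv_add_one hV h3 h5 hπ1 hπ2
  exact ⟨e, fun v w => by rw [hπ, ← he, e.apply_eq_iff_eq]⟩

/-- The two matchings form a hexagon, and `c₁` takes all edges outside of it. -/
lemma IsComplete.nonempty_colorGraph_iso (hG : G.IsComplete) (hu : G.IsUndirected)
    (hV : Nat.card V = 6) {c₁ c₂ c₃ : C} (h12 : c₁ ≠ c₂) (h13 : c₁ ≠ c₃) (h23 : c₂ ≠ c₃)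
    (hcol : G.edgeColors = {c₁, c₂, c₃}) (h2 : ∀ v, G.totalDegree c₂ v = 1)
    (h3 : ∀ v, G.totalDegree c₃ v = 1) :
    Nonempty (G.colorGraph c₁ ≃g (SimpleGraph.cycleGraph 6)ᶜ) := by
  have hu' := isUndirected_iff.1 hu
  obtain ⟨α, hα, hα1, hα2⟩ := (hu' c₂).exists_perm h2
  obtain ⟨β, hβ, hβ1, hβ2⟩ := (hu' c₃).exists_perm h3
  obtain ⟨e, he1, he2⟩ := exists_hexagon hV hα1 hα2 hβ1 hβ2
    fun x h' => h23 (((hα x _).2 rfl).unique ((hβ x _).2 h'))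
  refine ⟨RelIso.symm ⟨e, fun {i j} => ?_⟩⟩
  rw [(hu' c₁).colorGraph_adj, hG.hasColor_iff_of_subsingleton (S := {c₂, c₃}) (fun c _ => hu' c)
    ((Set.subsingleton_singleton (a := c₁)).anti fun c hc => by
      rw [hcol] at hc
      exact hc.1.resolve_right hc.2)
    ⟨by rw [hcol]; exact Or.inl rfl, by simp [h12, h13]⟩]
  simp only [Set.mem_insert_iff, Set.mem_singleton_iff, forall_eq_or_imp, forall_eq, hα, hβ, he1,
    he2, e.apply_eq_iff_eq, SimpleGraph.compl_adj, ne_eq, SimpleGraph.cycleGraph_adj]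
  revert i j
  decide

end Types

/-! ### All listed graphs are unique -/

section Backward

universe u v

variable {V : Type u} {C : Type v} [Finite V] {G : ECPOG V C}

lemma subsingleton_sdiff_singleton {C : Type*} {s : Set C} {a b : C} (h : s = {a, b}) :
    (s \ {a}).Subsingleton :=
  (Set.subsingleton_singleton (a := b)).anti fun _ hc => by
    rw [h] at hc
    exact hc.1.resolve_left hc.2

theorem isParamUnique_of_types (hG : G.IsComplete) (hreg : G.IsColorRegular)
    (h : G.IsMonochromatic ∨ G.IsMatchingAndComplement ∨ G.IsDirectedTriangle ∨
      G.IsMatchingDecomposition 4 3 ∨ G.IsFourCycleAndMatching ∨ G.IsFiveTournament ∨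
      G.IsTwoFiveCycles ∨ G.IsMatchingDecomposition 6 5 ∨ G.IsCoSixCycleAndTwoMatchings) :
    G.IsParamUnique := by
  obtain ⟨hu, hs⟩ | ⟨hu, c₁, c₂, hc, hcol, h1⟩ | ⟨c, hcol, hc⟩ | ⟨hV, hu, hm, hc⟩ |
    ⟨hV, c₁, c₂, hc, hcol, h1, h2⟩ | ⟨hV, ⟨c, hcol⟩, ht, -⟩ | ⟨hV, c₁, c₂, hc, hcol, h1, h2⟩ |
    ⟨hV, hu, hm, hc⟩ | ⟨hV, hu, c₁, c₂, c₃, -, -, hc, hcol, -, h2, h3⟩ := h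
  · exact isParamUnique_of_subsingleton hu hs
  · exact isParamUnique_of_matching hu (isMatchingColor_iff.1 h1).2
      (subsingleton_sdiff_singleton hcol)
  · have hV := hc.card
    exact isParamUnique_of_directed hreg (by omega) (by omega) (hc.isDirectedColor le_rfl)
      (hc.totalDegree hreg le_rfl)
      (fun d hd => isUndirectedColor_of_notMem (by rwa [hcol]))
      (by rw [hcol, Set.sdiff_self]; exact Set.subsingleton_empty)
  · obtain ⟨c₁, c₂, c₃, h12, h13, h23, hcol⟩ := Set.ncard_eq_three.1 hm
    refine isParamUnique_of_two_matchings (c₁ := c₁) (c₂ := c₂) (Or.inl hV) hu h12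
      (isMatchingColor_iff.1 (hc _ (by simp [hcol]))).2
      (isMatchingColor_iff.1 (hc _ (by simp [hcol]))).2
      ((Set.subsingleton_singleton (a := c₃)).anti ?_)
    rintro c ⟨h1, h2⟩
    rw [hcol] at h1
    simp only [Set.mem_insert_iff, Set.mem_singleton_iff] at h1 h2 ⊢
    tauto
  · have hu : ∀ d, d ≠ c₁ → G.IsUndirectedColor d := fun d hd => by
      by_cases hd' : d ∈ G.edgeColors
      · rw [hcol] at hd'
        rw [hd'.resolve_left hd]
        exact h2.1
      · exact isUndirectedColor_of_notMem hd'
    -- An undirected 4-cycle is the complement of the matching, so the matching alone determines the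
    -- graph; a directed one has to be matched itself.
    rcases h1 with h1 | h1
    · have hu' : G.IsUndirected := isUndirected_iff.2 fun d => by
        by_cases hd : d = c₁
        · exact hd ▸ h1.1
        · exact hu d hd
      exact isParamUnique_of_matching hu' (isMatchingColor_iff.1 h2).2
        (subsingleton_sdiff_singleton (hcol.trans (Set.pair_comm _ _)))
    · exact isParamUnique_of_directed hreg (by omega) (by omega)
        (h1.isDirectedColor (by norm_num)) (h1.totalDegree hreg (by norm_num)) hu
        (subsingleton_sdiff_singleton hcol)
  · refine isParamUnique_of_tournament hG hreg hV hcol ?_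
    obtain ⟨v, w, hvw⟩ : c ∈ G.edgeColors := by simp [hcol]
    exact ⟨v, w, hvw, (ht v w hvw.ne).1 hvw.1⟩
  · have hu : ∀ d, d ≠ c₂ → G.IsUndirectedColor d := fun d hd => by
      by_cases hd' : d ∈ G.edgeColors
      · rw [hcol] at hd'
        rw [hd'.resolve_right hd]
        exact h1.1
      · exact isUndirectedColor_of_notMem hd'
    have hs := subsingleton_sdiff_singleton (hcol.trans (Set.pair_comm _ _))
    rcases h2 with h2 | h2
    · have hu' : G.IsUndirected := isUndirected_iff.2 fun d => by
        by_cases hd : d = c₂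
        · exact hd ▸ h2.1
        · exact hu d hd
      exact isParamUnique_of_cycle (by omega) (by omega) hu' (h2.totalDegree (by norm_num)) hs
    · exact isParamUnique_of_directed hreg (by omega) (by omega)
        (h2.isDirectedColor (by norm_num)) (h2.totalDegree hreg (by norm_num)) hu hs
  · exact isParamUnique_of_matchings hV hu (fun c h => (isMatchingColor_iff.1 (hc c h)).2) hm
  · refine isParamUnique_of_two_matchings (Or.inr hV) hu hc (isMatchingColor_iff.1 h2).2
      (isMatchingColor_iff.1 h3).2 ((Set.subsingleton_singleton (a := c₁)).anti ?_)
    rintro c ⟨h1, h2⟩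
    rw [hcol] at h1
    exact h1.resolve_right h2

end Backward

end ECPOG

/-! ### Sums of degrees over sets of colors -/

section Weights

variable {C : Type*} {s : Finset C} {d : C → ℕ}

lemma Finset.card_le_sum_of_one_le (hd : ∀ c ∈ s, 1 ≤ d c) : s.card ≤ ∑ c ∈ s, d c := by
  simpa using Finset.card_nsmul_le_sum s d 1 hd

/-- When elements are added one at a time, the sum first reaches `t` with an excess of less than
`b`. -/
lemma Finset.exists_subset_sum_mem_Ico {b : ℕ} (hb : 0 < b) (hd : ∀ c ∈ s, d c ≤ b) {t : ℕ}
    (ht : t ≤ ∑ c ∈ s, d c) : ∃ T ⊆ s, t ≤ ∑ c ∈ T, d c ∧ ∑ c ∈ T, d c < t + b := by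
  classical
  induction s using Finset.induction_on with
  | empty =>
    rw [Finset.sum_empty] at ht
    exact ⟨∅, subset_rfl, ht, by rw [Finset.sum_empty]; omega⟩
  | insert a s ha ih =>
    by_cases h : t ≤ ∑ c ∈ s, d c
    · obtain ⟨T, hT, h1⟩ := ih (fun c hc => hd c (Finset.mem_insert_of_mem hc)) h
      exact ⟨T, hT.trans (Finset.subset_insert _ _), h1⟩
    · refine ⟨_, subset_rfl, ht, ?_⟩
      rw [Finset.sum_insert ha]
      have := hd a (Finset.mem_insert_self _ _)
      omega

variable [DecidableEq C]

lemma Finset.eq_singleton_of_sum_le {a : C} (hd : ∀ c ∈ s, 1 ≤ d c) (ha : a ∈ s)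
    (h : ∑ c ∈ s, d c ≤ d a) : s = {a} := by
  have h1 := Finset.add_sum_erase s d ha
  have hd' : ∀ c ∈ s.erase a, 1 ≤ d c := fun c hc => hd c (Finset.mem_of_mem_erase hc)
  have h2 := Finset.card_le_sum_of_one_le hd'
  have h3 : s.erase a = ∅ := Finset.card_eq_zero.1 (by omega)
  rw [← Finset.insert_erase ha, h3, insert_empty_eq]

lemma Finset.eq_pair_of_sum_eq {a : C} (hd : ∀ c ∈ s, 1 ≤ d c) (ha : a ∈ s)
    (h : ∑ c ∈ s, d c = d a + 1) : ∃ b, b ≠ a ∧ s = {a, b} ∧ d b = 1 := by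
  have h1 := Finset.add_sum_erase s d ha
  have hd' : ∀ c ∈ s.erase a, 1 ≤ d c := fun c hc => hd c (Finset.mem_of_mem_erase hc)
  have h2 := Finset.card_le_sum_of_one_le hd'
  have h3 : (s.erase a).card ≠ 0 := fun h3 => by
    rw [Finset.card_eq_zero.1 h3, Finset.sum_empty] at h1
    omega
  obtain ⟨b, hb⟩ := Finset.card_eq_one.1 (by omega : (s.erase a).card = 1)
  have hb' : b ∈ s.erase a := by simp [hb]
  rw [hb, Finset.sum_singleton] at h1
  exact ⟨b, Finset.ne_of_mem_erase hb', by rw [← hb, Finset.insert_erase ha], by omega⟩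

lemma Finset.eq_pair_or_triple_of_sum_eq {a : C} (hd : ∀ c ∈ s, 1 ≤ d c) (ha : a ∈ s)
    (h : ∑ c ∈ s, d c = d a + 2) : (∃ b, b ≠ a ∧ s = {a, b} ∧ d b = 2) ∨
      ∃ b b', b ≠ a ∧ b' ≠ a ∧ b ≠ b' ∧ s = {a, b, b'} ∧ d b = 1 ∧ d b' = 1 := by
  have h1 := Finset.add_sum_erase s d ha
  have hd' : ∀ c ∈ s.erase a, 1 ≤ d c := fun c hc => hd c (Finset.mem_of_mem_erase hc)
  have h2 := Finset.card_le_sum_of_one_le hd'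
  have h3 : (s.erase a).card ≠ 0 := fun h3 => by
    rw [Finset.card_eq_zero.1 h3, Finset.sum_empty] at h1
    omega
  obtain h4 | h4 : (s.erase a).card = 1 ∨ (s.erase a).card = 2 := by omega
  · obtain ⟨b, hb⟩ := Finset.card_eq_one.1 h4
    have hb' : b ∈ s.erase a := by simp [hb]
    rw [hb, Finset.sum_singleton] at h1
    exact Or.inl ⟨b, Finset.ne_of_mem_erase hb', by rw [← hb, Finset.insert_erase ha], by omega⟩
  · obtain ⟨b, b', hne, hb⟩ := Finset.card_eq_two.1 h4
    have hb1 : b ∈ s.erase a := by simp [hb]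
    have hb2 : b' ∈ s.erase a := by simp [hb]
    rw [hb, Finset.sum_pair hne] at h1
    have := hd' b hb1
    have := hd' b' hb2
    exact Or.inr ⟨b, b', Finset.ne_of_mem_erase hb1, Finset.ne_of_mem_erase hb2, hne, by
      rw [← hb, Finset.insert_erase ha], by omega, by omega⟩

end Weights

namespace ECPOG

/-! ### From degrees to the listed types -/

section Forward

universe u v

variable {V : Type u} {C : Type v} [Finite V] {G : ECPOG V C} {a b c : C}

/-- This is the handshake lemma for one color; it makes all degrees even when the order is odd. -/
lemma even_card_mul_totalDegree (hreg : G.IsColorRegular) (c : C) (v : V) :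
    Even (Nat.card V * G.totalDegree c v) := by
  classical
  have := Fintype.ofFinite V
  have h1 := (G.colorGraph c).sum_degrees_eq_twice_card_edges
  have h2 : ∀ w ∈ Finset.univ, (G.colorGraph c).degree w = G.totalDegree c v := fun w _ => by
    rw [hreg.totalDegree_eq c v w, totalDegree, ← SimpleGraph.card_neighborSet_eq_degree,
      ← Nat.card_eq_fintype_card, Nat.card_coe_set_eq]
    rfl
  rw [Finset.sum_congr rfl h2, Finset.sum_const, smul_eq_mul, Finset.card_univ,
    ← Nat.card_eq_fintype_card] at h1
  exact h1 ▸ even_two_mul _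

lemma coe_colors (G : ECPOG V C) : (G.colors : Set C) = G.edgeColors := by
  ext c
  simp

/-- The total degrees of the colors, as a function of the color only. -/
lemma exists_totalDegree_eq [Nonempty V] (hG : G.IsComplete) (hreg : G.IsColorRegular) :
    ∃ d : C → ℕ, (∀ c v, G.totalDegree c v = d c) ∧ (∀ c ∈ G.colors, 1 ≤ d c) ∧
      ∑ c ∈ G.colors, d c = Nat.card V - 1 ∧ (∀ c, G.IsDirectedColor c → Even (d c)) ∧
      ∀ c, Even (Nat.card V * d c) := by
  obtain ⟨v⟩ := ‹Nonempty V›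
  exact ⟨fun c => G.totalDegree c v, fun c w => hreg.totalDegree_eq c w v,
    fun c hc => totalDegree_pos hreg hc v, sum_totalDegree hG v,
    fun c hc => ⟨_, (hc.totalDegree hreg v).trans (two_mul _)⟩,
    fun c => even_card_mul_totalDegree hreg c v⟩

lemma isUndirected_of_forall_mem (h : ∀ c ∈ G.colors, G.IsUndirectedColor c) :
    G.IsUndirected := isUndirected_iff.2 fun c => by
  by_cases hc : c ∈ G.colors
  · exact h c hc
  · exact isUndirectedColor_of_notMem (mt mem_colors.2 hc)

/-- If the color is directed with outdegree `k`, there are `2 * k + 1` vertices: `k = 1` is the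
triangle, `k = 2` the tournament on five vertices, and larger `k` contradicts uniqueness. -/
lemma IsParamUnique.of_colors_eq_singleton (h : G.IsParamUnique) (hG : G.IsComplete)
    (hreg : G.IsColorRegular) (hcol : G.colors = {a}) :
    G.IsMonochromatic ∨ G.IsDirectedTriangle ∨ G.IsFiveTournament := by
  have hcol' : G.edgeColors = {a} := by rw [← coe_colors, hcol, Finset.coe_singleton]
  by_cases ha : G.IsDirectedColor a
  swap
  · refine Or.inl ⟨isUndirected_of_forall_mem fun c hc => ?_, ?_⟩
    · rw [hcol, Finset.mem_singleton] at hc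
      rwa [hc, isUndirectedColor_iff]
    · rw [hcol']
      exact Set.subsingleton_singleton
  obtain ⟨v, -⟩ := id ha
  have h1 := sum_totalDegree hG v
  have h2 := ha.totalDegree hreg v
  have h3 := totalDegree_pos hreg (by rw [hcol, Finset.mem_singleton] : a ∈ G.colors) v
  rw [hcol, Finset.sum_singleton] at h1
  have h4 : Nat.card V = 2 * G.outDegree a v + 1 := by omega
  obtain h5 | h5 | h5 : G.outDegree a v = 1 ∨ G.outDegree a v = 2 ∨ 3 ≤ G.outDegree a v := by omega
  · refine Or.inr (Or.inl ⟨a, hcol', ha.isDirectedCycleColor hreg (by omega) (by omega) (by omega)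
      fun w => ?_⟩)
    rw [hreg.totalDegree_eq a w v]
    omega
  · have hadj : ∀ {v w}, G.Adj v w → G.HasColor a v w := fun hvw => by
      obtain ⟨d, hd⟩ := exists_hasColor hvw
      have hd' : d ∈ G.edgeColors := ⟨_, _, hd⟩
      rw [hcol'] at hd'
      rwa [Set.mem_singleton_iff.1 hd'] at hd
    have h6 : ∀ w, {x | G.Adj w x}.ncard = 2 ∧ {x | G.Adj x w}.ncard = 2 := fun w => by
      have h7 : {x | G.Adj w x}.ncard = G.outDegree a w := by
        rw [outDegree]
        congr 1
        ext x
        exact ⟨fun h => ⟨hadj h, ha.not_adj (hadj h)⟩, fun h => h.1.1⟩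
      have h8 : {x | G.Adj x w}.ncard = G.inDegree a w := by
        rw [inDegree]
        congr 1
        ext x
        exact ⟨fun h => ⟨hadj h, ha.not_adj (hadj h)⟩, fun h => h.1.1⟩
      rw [h7, h8, hreg.inDegree_eq_outDegree, (hreg a w v).2.1]
      exact ⟨h5, h5⟩
    exact Or.inr (Or.inr ⟨by omega, ⟨a, hcol'⟩, fun v w hvw =>
      ⟨fun h => ha.not_adj (hadj h), (hG v w hvw).resolve_right⟩, 2, h6⟩)
  · exact (not_isParamUnique_of_tournament hG hreg h5 h4 hcol ha h).elim

/-- The matching color is undirected because its degree is odd. If `b` is directed with outdegree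
`k`, there are `2 * (k + 1)` vertices, and only `k = 1`, the directed 4-cycle, is compatible with
uniqueness. -/
lemma IsParamUnique.of_colors_eq_pair (h : G.IsParamUnique) (hG : G.IsComplete)
    (hreg : G.IsColorRegular) (hab : a ≠ b) (hcol : G.edgeColors = {a, b})
    (ha : ∀ v, G.totalDegree a v = 1) :
    G.IsMatchingAndComplement ∨ G.IsFourCycleAndMatching := by
  classical
  have ha' : G.IsUndirectedColor a := isUndirectedColor_iff.2 fun h' => by
    obtain ⟨v, -⟩ := id h'
    have := h'.totalDegree hreg v
    have := ha v
    omega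
  have ham : G.IsMatchingColor a := isMatchingColor_iff.2 ⟨ha', ha⟩
  by_cases hb : G.IsDirectedColor b
  swap
  · refine Or.inl ⟨isUndirected_of_forall_mem fun c hc => ?_, a, b, hab, hcol, ham⟩
    rw [mem_colors, hcol] at hc
    rcases hc with rfl | rfl
    exacts [ha', isUndirectedColor_iff.2 hb]
  have hcol' : (G.colors : Set C) = {a, b} := by rw [coe_colors, hcol]
  have hcol'' : G.colors = {a, b} := by exact_mod_cast hcol'
  obtain ⟨v, -⟩ := id hb
  have h1 := sum_totalDegree hG v
  have h2 := hb.totalDegree hreg v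
  have h3 := totalDegree_pos hreg (by simp [hcol] : b ∈ G.colors) v
  rw [hcol'', Finset.sum_pair hab, ha] at h1
  have h4 : Nat.card V = 2 * (G.outDegree b v + 1) := by omega
  obtain h5 | h5 : G.outDegree b v = 1 ∨ 3 ≤ G.outDegree b v + 1 := by omega
  · refine Or.inr ⟨by omega, b, a, hab.symm, hcol.trans (Set.pair_comm _ _),
      Or.inr (hb.isDirectedCycleColor hreg (by omega) (by omega) (by omega) fun w => ?_), ham⟩
    rw [hreg.totalDegree_eq b w v]
    omega
  · exact (not_isParamUnique_of_matching_of_directed hG hreg h5 h4 hab hcol' ha hb h).elim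

lemma IsParamUnique.of_two_cycles (h : G.IsParamUnique) (hG : G.IsComplete)
    (hreg : G.IsColorRegular) (hV : Nat.card V = 5) (hab : a ≠ b) (hcol : G.edgeColors = {a, b})
    (ha : ∀ v, G.totalDegree a v = 2) (hb : ∀ v, G.totalDegree b v = 2) : G.IsTwoFiveCycles := by
  by_cases ha' : G.IsDirectedColor a
  · by_cases hb' : G.IsDirectedColor b
    · exact (not_isParamUnique_of_two_directed hG hreg hV hab (by rw [coe_colors, hcol]) ha' hb'
        h).elim
    · exact ⟨hV, b, a, hab.symm, hcol.trans (Set.pair_comm _ _),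
        (isUndirectedColor_iff.2 hb').isUndirectedCycleColor hV (by norm_num) le_rfl hb,
        Or.inr (ha'.isDirectedCycleColor hreg hV (by norm_num) le_rfl ha)⟩
  · refine ⟨hV, a, b, hab, hcol,
      (isUndirectedColor_iff.2 ha').isUndirectedCycleColor hV (by norm_num) le_rfl ha, ?_⟩
    by_cases hb' : G.IsDirectedColor b
    · exact Or.inr (hb'.isDirectedCycleColor hreg hV (by norm_num) le_rfl hb)
    · exact Or.inl ((isUndirectedColor_iff.2 hb').isUndirectedCycleColor hV (by norm_num) le_rfl hb)

lemma isMatchingDecomposition (hG : G.IsComplete) (hreg : G.IsColorRegular) [Nonempty V]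
    (h : ∀ c ∈ G.colors, ∀ v, G.totalDegree c v = 1) :
    G.IsMatchingDecomposition (Nat.card V) (Nat.card V - 1) := by
  have hu : ∀ c ∈ G.colors, G.IsUndirectedColor c := fun c hc =>
    isUndirectedColor_iff.2 fun h' => by
      obtain ⟨v, -⟩ := id h'
      have := h'.totalDegree hreg v
      have := h c hc v
      omega
  refine ⟨rfl, isUndirected_of_forall_mem hu, ?_, fun c hc => ?_⟩
  · obtain ⟨v⟩ := ‹Nonempty V›
    rw [← sum_totalDegree hG v, ← coe_colors, Set.ncard_coe_finset,
      Finset.sum_congr rfl fun c hc => h c hc v, Finset.sum_const, smul_eq_mul, mul_one]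
  · have hc' := mem_colors.2 hc
    exact isMatchingColor_iff.2 ⟨hu c hc', h c hc'⟩

end Forward

end ECPOG

/-! ### Case distinction by the order of the graph -/

namespace ECPOG

universe u v

variable {V : Type u} {C : Type v} [Finite V] {G : ECPOG V C}

lemma edgeColors_eq_pair [DecidableEq C] {a b : C} (h : G.colors = {a, b}) :
    G.edgeColors = {a, b} := by
  rw [← coe_colors, h, Finset.coe_pair]

lemma IsParamUnique.types_of_odd (h : G.IsParamUnique) (hG : G.IsComplete)
    (hreg : G.IsColorRegular) {m : ℕ} (hm : m ≠ 0) (hV : Nat.card V = 2 * m + 1) :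
    G.IsMonochromatic ∨ G.IsDirectedTriangle ∨ G.IsFiveTournament ∨ G.IsTwoFiveCycles := by
  classical
  have : Nonempty V := (Nat.card_pos_iff.1 (by omega)).1
  obtain ⟨d, hd, hd1, hsum, -, heven⟩ := exists_totalDegree_eq hG hreg
  have hk : ∀ c, ∃ k, d c = k * 2 := fun c => by
    have h1 := heven c
    rw [hV, Nat.even_mul] at h1
    obtain ⟨k, hk⟩ := h1.resolve_left (by simp)
    exact ⟨k, by omega⟩
  choose k hk using hk
  obtain rfl : d = fun c => k c * 2 := funext hk
  dsimp only at hd hd1 hsum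
  have hk1 : ∀ c ∈ G.colors, 1 ≤ k c := fun c hc => by
    have := hd1 c hc
    omega
  have hksum : ∑ c ∈ G.colors, k c = m := by
    rw [← Finset.sum_mul] at hsum
    omega
  have hsing : ∀ a ∈ G.colors, m ≤ k a →
      G.IsMonochromatic ∨ G.IsDirectedTriangle ∨ G.IsFiveTournament ∨ G.IsTwoFiveCycles := by
    intro a ha hka
    have := h.of_colors_eq_singleton hG hreg (Finset.eq_singleton_of_sum_le hk1 ha (by omega))
    tauto
  obtain ⟨a₀, ha₀⟩ : G.colors.Nonempty := by
    by_contra hne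
    rw [Finset.not_nonempty_iff_eq_empty.1 hne, Finset.sum_empty] at hksum
    exact hm hksum.symm
  have h1 := hk1 a₀ ha₀
  obtain rfl | rfl | hm3 : m = 1 ∨ m = 2 ∨ 3 ≤ m := by omega
  · exact hsing a₀ ha₀ h1
  · by_cases h2 : 2 ≤ k a₀
    · exact hsing a₀ ha₀ h2
    · obtain ⟨b, hb, hcol, hb1⟩ := Finset.eq_pair_of_sum_eq hk1 ha₀ (by omega)
      have := h.of_two_cycles hG hreg hV hb.symm (edgeColors_eq_pair hcol)
        (fun v => by rw [hd]; omega) fun v => by rw [hd]; omega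
      tauto
  -- Otherwise `T` and its complement both have weight at least `2`, and the lighter of them has
  -- weight at most `m / 2`, where the circulants apply.
  have hT : ∀ T ⊆ G.colors, 2 ≤ ∑ c ∈ T, k c → m - 1 ≤ ∑ c ∈ T, k c := by
    intro T hT h2
    by_contra hlt
    have h3 := Finset.sum_sdiff (f := k) hT
    by_cases h4 : 2 * ∑ c ∈ T, k c ≤ m
    · exact not_isParamUnique_of_circulants hG hreg hV hd hT h2 h4 h
    · exact not_isParamUnique_of_circulants hG hreg hV hd
        (Finset.sdiff_subset (s := G.colors) (t := T)) (by omega) (by omega) h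
  by_cases hex : ∃ a ∈ G.colors, 2 ≤ k a
  · obtain ⟨a, ha, h2⟩ := hex
    have h3 := hT {a} (Finset.singleton_subset_iff.2 ha) (by rwa [Finset.sum_singleton])
    rw [Finset.sum_singleton] at h3
    by_cases h4 : m ≤ k a
    · exact hsing a ha h4
    · obtain ⟨b, hb, hcol, hb1⟩ := Finset.eq_pair_of_sum_eq hk1 ha (by omega)
      refine (not_isParamUnique_of_cycles hG hreg (by omega) hV hb (a := b) (b := a) ?_
        (fun v => by rw [hd]; omega) h).elim
      rw [hcol, Finset.coe_pair, Set.pair_comm]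
  · push Not at hex
    have hk1' : ∀ c ∈ G.colors, k c = 1 := fun c hc => by
      have := hk1 c hc
      have := hex c hc
      omega
    -- All weights are `1`, so some `T` has weight exactly `2`, which forces `m - 1 ≤ 2`.
    obtain ⟨T, hTs, h2, h3⟩ := Finset.exists_subset_sum_mem_Ico one_pos
      (fun c hc => (hk1' c hc).le) (by omega : 2 ≤ ∑ c ∈ G.colors, k c)
    have h4 := hT T hTs h2
    obtain rfl : m = 3 := by omega
    exact (not_isParamUnique_of_card_seven hG hreg hV
      (fun c hc v => by rw [hd, hk1' c hc]) h).elim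

lemma IsParamUnique.types_of_even (h : G.IsParamUnique) (hG : G.IsComplete)
    (hreg : G.IsColorRegular) {m : ℕ} (hm : m ≠ 0) (hV : Nat.card V = 2 * m) :
    G.IsMonochromatic ∨ G.IsMatchingAndComplement ∨ G.IsDirectedTriangle ∨
      G.IsMatchingDecomposition 4 3 ∨ G.IsFourCycleAndMatching ∨ G.IsFiveTournament ∨
      G.IsMatchingDecomposition 6 5 ∨ G.IsCoSixCycleAndTwoMatchings := by
  classical
  have : Nonempty V := (Nat.card_pos_iff.1 (by omega)).1
  obtain ⟨d, hd, hd1, hsum, hdir, -⟩ := exists_totalDegree_eq hG hreg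
  have hsing : ∀ a ∈ G.colors, 2 * m - 1 ≤ d a → G.IsMonochromatic ∨ G.IsDirectedTriangle ∨
      G.IsFiveTournament := fun a ha hka =>
    h.of_colors_eq_singleton hG hreg (Finset.eq_singleton_of_sum_le hd1 ha (by omega))
  have hpair : ∀ a ∈ G.colors, 2 * m - 1 = d a + 1 → G.IsMatchingAndComplement ∨
      G.IsFourCycleAndMatching := by
    intro a ha hka
    obtain ⟨b, hb, hcol, hb1⟩ := Finset.eq_pair_of_sum_eq hd1 ha (by omega)
    exact h.of_colors_eq_pair hG hreg hb
      ((edgeColors_eq_pair hcol).trans (Set.pair_comm _ _)) fun v => by rw [hd, hb1]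
  have hone : (∀ c ∈ G.colors, d c = 1) → G.IsMatchingDecomposition (2 * m) (2 * m - 1) := by
    intro h1
    rw [← hV]
    exact isMatchingDecomposition hG hreg fun c hc v => by rw [hd, h1 c hc]
  obtain ⟨a₀, ha₀⟩ : G.colors.Nonempty := by
    by_contra hne
    rw [Finset.not_nonempty_iff_eq_empty.1 hne, Finset.sum_empty] at hsum
    omega
  have h1 := hd1 a₀ ha₀
  obtain rfl | rfl | rfl | hm4 : m = 1 ∨ m = 2 ∨ m = 3 ∨ 4 ≤ m := by omega
  · have := hsing a₀ ha₀ (by omega)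
    tauto
  · by_cases hex : ∃ a ∈ G.colors, 2 ≤ d a
    · obtain ⟨a, ha, h2⟩ := hex
      by_cases h3 : 3 ≤ d a
      · have := hsing a ha (by omega)
        tauto
      · have := hpair a ha (by omega)
        tauto
    · push Not at hex
      have := hone fun c hc => by
        have := hd1 c hc
        have := hex c hc
        omega
      tauto
  -- On six vertices the degrees sum to `5` and none is `2`. What remains is `5`, `4 + 1`, `3 + 1 +
  -- 1` and five times `1`.
  · have h2 : ∀ c, d c ≠ 2 := fun c hc =>
      not_isParamUnique_of_card_six hG hreg hV (fun v => (hd c v).trans hc) h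
    by_cases hex : ∃ a ∈ G.colors, 2 ≤ d a
    · obtain ⟨a, ha, h3⟩ := hex
      have h4 := h2 a
      obtain h5 | h5 | h5 : 5 ≤ d a ∨ d a = 4 ∨ d a = 3 := by omega
      · have := hsing a ha (by omega)
        tauto
      · have := hpair a ha (by omega)
        tauto
      obtain ⟨b, -, -, hb⟩ | ⟨b, b', hb, hb', hbb', hcol, hb1, hb1'⟩ :=
        Finset.eq_pair_or_triple_of_sum_eq hd1 ha (by omega)
      · exact (h2 b hb).elim
      · have hcol' : G.edgeColors = {a, b, b'} := by rw [← coe_colors, hcol]; simp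
        have hu : G.IsUndirected := isUndirected_of_forall_mem fun c hc =>
          isUndirectedColor_iff.2 fun hc' => by
            have h6 := hdir c hc'
            rw [hcol] at hc
            simp only [Finset.mem_insert, Finset.mem_singleton] at hc
            rcases hc with rfl | rfl | rfl <;> revert h6 <;> simp only [h5, hb1, hb1'] <;> decide
        have hu' := isUndirected_iff.1 hu
        have hb2 : ∀ v, G.totalDegree b v = 1 := fun v => (hd b v).trans hb1
        have hb2' : ∀ v, G.totalDegree b' v = 1 := fun v => (hd b' v).trans hb1'
        have : G.IsCoSixCycleAndTwoMatchings := ⟨hV, hu, a, b, b', hb.symm, hb'.symm, hbb', hcol',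
          hG.nonempty_colorGraph_iso hu hV hb.symm hb'.symm hbb' hcol' hb2 hb2',
          isMatchingColor_iff.2 ⟨hu' b, hb2⟩, isMatchingColor_iff.2 ⟨hu' b', hb2'⟩⟩
        tauto
    · push Not at hex
      have := hone fun c hc => by
        have := hd1 c hc
        have := hex c hc
        omega
      tauto
  -- The degrees sum to `2 * m - 1`. Otherwise `T` and its complement both have degree at least `3`,
  -- and one of them has degree at most `m - 1`.
  have hT : ∀ T ⊆ G.colors, 3 ≤ ∑ c ∈ T, d c → 2 * m - 3 ≤ ∑ c ∈ T, d c := by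
    intro T hT h2
    by_contra hlt
    have h3 := Finset.sum_sdiff (f := d) hT
    by_cases h4 : ∑ c ∈ T, d c ≤ m - 1
    · exact not_isParamUnique_of_one_factorizations hG hreg hV hT hd h2 h4 h
    · exact not_isParamUnique_of_one_factorizations hG hreg hV
        (Finset.sdiff_subset (s := G.colors) (t := T)) hd (by omega) (by omega) h
  by_cases hex : ∃ a ∈ G.colors, 3 ≤ d a
  · obtain ⟨a, ha, h2⟩ := hex
    have h3 := hT {a} (Finset.singleton_subset_iff.2 ha) (by rwa [Finset.sum_singleton])
    rw [Finset.sum_singleton] at h3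
    obtain h4 | h4 | h4 : 2 * m - 1 ≤ d a ∨ 2 * m - 1 = d a + 1 ∨ 2 * m - 1 = d a + 2 := by omega
    · have := hsing a ha h4
      tauto
    · have := hpair a ha h4
      tauto
    obtain ⟨b, hb, hcol, hb2⟩ | ⟨b, b', hb, hb', hbb', hcol, hb1, hb1'⟩ :=
        Finset.eq_pair_or_triple_of_sum_eq hd1 ha (by omega)
    · refine (not_isParamUnique_of_cycles hG hreg (by omega) hV hb (a := b) (b := a) ?_
        (fun v => (hd b v).trans hb2) h).elim
      rw [hcol, Finset.coe_pair, Set.pair_comm]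
    · refine (not_isParamUnique_of_two_matchings hG hreg (by omega) ⟨m, two_mul m⟩ hV hbb' hb hb'
        (a := b) (b := b') (c := a) ?_ (fun v => (hd b v).trans hb1)
        (fun v => (hd b' v).trans hb1') h).elim
      rw [hcol]
      ext c
      simp
      tauto
  · push Not at hex
    -- With all degrees at most `2`, some `T` has degree `3` or `4`, less than `2 * m - 3` because
    -- `4 ≤ m`.
    obtain ⟨T, hTs, h2, h3⟩ := Finset.exists_subset_sum_mem_Ico two_pos
      (fun c hc => Nat.le_of_lt_succ (hex c hc)) (by omega : 3 ≤ ∑ c ∈ G.colors, d c)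
    have h4 := hT T hTs h2
    omega

theorem IsParamUnique.types (h : G.IsParamUnique) (hG : G.IsComplete) (hreg : G.IsColorRegular) :
    G.IsMonochromatic ∨ G.IsMatchingAndComplement ∨ G.IsDirectedTriangle ∨
      G.IsMatchingDecomposition 4 3 ∨ G.IsFourCycleAndMatching ∨ G.IsFiveTournament ∨
      G.IsTwoFiveCycles ∨ G.IsMatchingDecomposition 6 5 ∨ G.IsCoSixCycleAndTwoMatchings := by
  by_cases hV : Nat.card V ≤ 1
  · have := Finite.card_le_one_iff_subsingleton.1 hV
    refine Or.inl ⟨fun v w hvw => ?_, ?_⟩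
    · exact Subsingleton.elim v w ▸ hvw
    · rintro c ⟨v, w, hvw⟩
      exact (hvw.ne (Subsingleton.elim v w)).elim
  · obtain ⟨m, hm | hm⟩ := Nat.even_or_odd' (Nat.card V)
    · have := h.types_of_even hG hreg (by omega) hm
      tauto
    · have := h.types_of_odd hG hreg (by omega) hm
      tauto

end ECPOG

theorem mainTheorem3 {V C : Type*} [Finite V] (G : ECPOG V C)
    (hcomplete : G.IsComplete) (hregular : G.IsColorRegular) :
    G.IsIdentifiedByCounting 2 ↔
      G.IsMonochromatic ∨
      G.IsMatchingAndComplement ∨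
      G.IsDirectedTriangle ∨
      G.IsMatchingDecomposition 4 3 ∨
      G.IsFourCycleAndMatching ∨
      G.IsFiveTournament ∨
      G.IsTwoFiveCycles ∨
      G.IsMatchingDecomposition 6 5 ∨
      G.IsCoSixCycleAndTwoMatchings := by
  rw [ECPOG.isIdentifiedByCounting_two_iff hcomplete hregular]
  exact ⟨fun h => h.types hcomplete hregular,
    ECPOG.isParamUnique_of_types hcomplete hregular⟩
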